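/- Let $\mathbb D$ be the open unit disc, $\mathbb T$ its boundary, $dA$ the area measure on $\mathbb D$ normalized to have total mass one, and $\operatorname{Hol}(\mathbb D)$ the space of holomorphic functions on $\mathbb D$. Let $\mu$ be a finite nonzero positive Borel measure on $\overline{\mathbb D}$, and for $z\in\mathbb D$ put $$U_\mu(z)=\int_{\mathbb D}\log\left|\frac{1-\overline w z}{z-w}\right|^2\frac{d\mu(w)}{1-|w|^2}+\int_{\mathbb T}\frac{1-|z|^2}{|1-\overline w z|^2}\,d\mu(w),\qquad V_\mu(z)=\int_{\overline{\mathbb D}}\frac{1-|z|^2}{|1-\overline\zeta z|^2}\,d\mu(\zeta).$$ Let $D(\mu)$ be the space of all $f\in\operatorname{Hol}(\mathbb D)$ with $\int_{\mathbb D}|f'|^2U_\mu\,dA<\infty$, with the inner product $\langle f,g\rangle_{D(\mu)}=\langle f,g\rangle_{H^2}+\int_{\mathbb D}f'\,\overline{g'}\,U_\mu\,dA$ and the corresponding norm (recall that $D(\mu)\subseteq H^2$). Let $L^2_{a,\mu}$ be the space of all $f\in\operatorname{Hol}(\mathbb D)$ for which $$\|f\|^2_{L^2_{a,\mu}}=|f(0)|^2+\int_{\mathbb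 D}|f'(z)|^2\,\frac{(1-|z|^2)^2}{V_\mu(z)}\,dA(z)$$ is finite, and let $E(\mu)$ be the closure of the polynomials in $L^2_{a,\mu}$, with the same norm. Then: (i) $H^2\subseteq E(\mu)\subseteq L^2_a\big((1-|z|^2)\,dA\big)=\left\{f\in\operatorname{Hol}(\mathbb D):\int_{\mathbb D}|f(z)|^2(1-|z|^2)\,dA(z)<\infty\right\}$. (ii) $E(\mu)$ is a reproducing kernel Hilbert space on $\mathbb D$, that is, it is complete and its point evaluations are continuous. (iii) $E(\mu)$ is the Cauchy dual of $D(\mu)$, with equivalent norms. That is, for every $\lambda\in\mathbb D$ the function $k_\lambda(z)=(1-\overline\lambda z)^{-1}$ belongs to $D(\mu)$; the map $f\mapsto Uf$, $(Uf)(\lambda)=\langle f,k_\lambda\rangle_{D(\mu)}$, is a bijection from $D(\mu)$ onto $E(\mu)$; if $f\in D(\mu)$ and $Uf=q$ is a polynomial, then $\langle p,f\rangle_{D(\mu)}=\int_{\mathbb T}p(\zeta)\overline{q(\zeta)}\,\frac{|d\zeta|}{2\pi}$ for every polynomial $p$; and there are constants $c,C>0$, depending only on $\mu$, such that $c\,\|f\|_{D(\mu)}\le\|Uf\|_{L^2_{a,\mu}}\le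 C\,\|f\|_{D(\mu)}$ for all $f\in D(\mu)$. (iv) The multiplier algebra $M(E(\mu))=\{\varphi\in E(\mu):\varphi f\in E(\mu)\text{ for all }f\in E(\mu)\}$ is equal, as a set of functions, to $H^\infty$, the space of bounded holomorphic functions on $\mathbb D$. -/

import Mathlib

open MeasureTheory Metric ComplexConjugate
open scoped ENNReal

noncomputable section

namespace DirichletType

/-- The open unit disc, as a type. -/
abbrev Disc : Type := ball (0 : ℂ) 1

/-- The closed unit disc, as a type. -/
abbrev ClosedDisc : Type := closedBall (0 : ℂ) 1

/-- Normalized area measure `dA` on the open unit disc (total mass one). -/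
def dA : Measure Disc := (ENNReal.ofReal Real.pi)⁻¹ • (volume : Measure ℂ).comap Subtype.val

/-- A function on the disc, extended by `0` to the whole plane. It only serves to apply Mathlib's
derivatives, at points of the (open) disc, to functions that are defined on the disc. -/
def ext (f : Disc → ℂ) : ℂ → ℂ := Function.extend Subtype.val f 0

/-- The complex derivative `f'` of a function on the disc. -/
def cderiv (f : Disc → ℂ) (z : Disc) : ℂ := deriv (ext f) z

/-- The `n`-th Taylor coefficient at the origin. -/
def coeff (f : Disc → ℂ) (n : ℕ) : ℂ := iteratedDeriv n (ext f) 0 / (n.factorial : ℂ)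

/-- The origin, as a point of the disc. -/
def origin : Disc := ⟨0, mem_ball_self one_pos⟩

lemma ext_coe (f : Disc → ℂ) (z : Disc) : ext f z = f z :=
  Subtype.val_injective.extend_apply f 0 z

lemma ext_of_notMem (f : Disc → ℂ) {z : ℂ} (hz : z ∉ ball (0 : ℂ) 1) : ext f z = 0 := by
  unfold ext
  rw [Function.extend_apply']
  · rfl
  · rintro ⟨a, rfl⟩
    exact hz a.2

lemma ext_add (f g : Disc → ℂ) : ext (f + g) = ext f + ext g := by
  funext z
  by_cases hz : z ∈ ball (0 : ℂ) 1
  · lift z to Disc using hz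
    simp only [Pi.add_apply, ext_coe]
  · simp [ext_of_notMem _ hz]

lemma ext_smul (c : ℂ) (f : Disc → ℂ) : ext (c • f) = c • ext f := by
  funext z
  by_cases hz : z ∈ ball (0 : ℂ) 1
  · lift z to Disc using hz
    simp only [Pi.smul_apply, ext_coe]
  · simp [ext_of_notMem _ hz]

lemma ext_zero : ext 0 = 0 := by
  simpa using ext_smul 0 0

/-- The holomorphic functions on the open unit disc. -/
def Hol : Submodule ℂ (Disc → ℂ) where
  carrier := {f | DifferentiableOn ℂ (ext f) (ball 0 1)}
  zero_mem' := by
    simp only [Set.mem_ofPred_eq, ext_zero]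
    exact differentiableOn_const 0
  add_mem' := by
    intro f g hf hg
    simp only [Set.mem_ofPred_eq, ext_add] at *
    exact hf.add hg
  smul_mem' := by
    intro c f hf
    simp only [Set.mem_ofPred_eq, ext_smul] at *
    exact hf.const_smul c

lemma Hol.differentiableAt {f : Disc → ℂ} (hf : f ∈ Hol) (z : Disc) :
    DifferentiableAt ℂ (ext f) z :=
  DifferentiableOn.differentiableAt hf (isOpen_ball.mem_nhds z.2)

lemma cderiv_add {f g : Disc → ℂ} (hf : f ∈ Hol) (hg : g ∈ Hol) (z : Disc) :
    cderiv (f + g) z = cderiv f z + cderiv g z := by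
  unfold cderiv
  rw [ext_add]
  exact deriv_add (Hol.differentiableAt hf z) (Hol.differentiableAt hg z)

lemma cderiv_smul (c : ℂ) {f : Disc → ℂ} (hf : f ∈ Hol) (z : Disc) :
    cderiv (c • f) z = c * cderiv f z := by
  unfold cderiv
  rw [ext_smul]
  exact deriv_const_smul c (Hol.differentiableAt hf z)

lemma continuous_cderiv {f : Disc → ℂ} (hf : f ∈ Hol) : Continuous (cderiv f) := by
  have h : ContinuousOn (deriv (ext f)) (ball 0 1) :=
    (DifferentiableOn.deriv hf isOpen_ball).continuousOn
  exact continuousOn_iff_continuous_domRestrict.mp h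

/-- The Hardy space `H²`: holomorphic functions with square summable Taylor coefficients. -/
def hardyTwo : Set (Disc → ℂ) := {f | f ∈ Hol ∧ Summable fun n => ‖coeff f n‖ ^ 2}

/-- `H^∞`: the bounded holomorphic functions. -/
def hardyInfty : Set (Disc → ℂ) := {f | f ∈ Hol ∧ ∃ C : ℝ, ∀ z, ‖f z‖ ≤ C}

/-- The weighted Bergman space `L²_a((1 - |z|²) dA)`. -/
def bergman : Set (Disc → ℂ) :=
  {f | f ∈ Hol ∧ Integrable (fun z => ‖f z‖ ^ 2 * (1 - ‖(z : ℂ)‖ ^ 2)) dA}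

/-- The polynomials, as functions on the disc. -/
def polynomials : Submodule ℂ (Disc → ℂ) where
  carrier := {f | ∃ p : Polynomial ℂ, ∀ z : Disc, f z = p.eval (z : ℂ)}
  zero_mem' := ⟨0, fun z => by simp⟩
  add_mem' := by
    rintro f g ⟨p, hp⟩ ⟨q, hq⟩
    exact ⟨p + q, fun z => by simp [hp, hq]⟩
  smul_mem' := by
    rintro c f ⟨p, hp⟩
    exact ⟨c • p, fun z => by simp [hp]⟩

/-- The multiplier algebra `M(B) = {φ ∈ B : φ f ∈ B for all f ∈ B}`. -/
def multipliers (B : Set (Disc → ℂ)) : Set (Disc → ℂ) := {φ | φ ∈ B ∧ ∀ f ∈ B, φ * f ∈ B}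

/-! ### The Dirichlet-type space `D(μ)` and its Cauchy transform -/

/-- The Poisson type kernel `(1 - |z|²) / |1 - conj ζ * z|²`. -/
def poisson (z : Disc) (ζ : ClosedDisc) : ℝ :=
  (1 - ‖(z : ℂ)‖ ^ 2) / ‖1 - conj (ζ : ℂ) * (z : ℂ)‖ ^ 2

open Classical in
/-- The kernel `log |(1 - conj w * z) / (z - w)|² / (1 - |w|²)`, with its value `∞` at `w = z`. -/
def greenKernel (z : Disc) (w : ClosedDisc) : ℝ≥0∞ :=
  if (w : ℂ) = z then ∞
  else ENNReal.ofReal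
    (Real.log (‖(1 - conj (w : ℂ) * (z : ℂ)) / ((z : ℂ) - w)‖ ^ 2) / (1 - ‖(w : ℂ)‖ ^ 2))

/-- The superharmonic weight `U_μ`. -/
def weightU (μ : Measure ClosedDisc) (z : Disc) : ℝ≥0∞ :=
  (∫⁻ w in {w : ClosedDisc | ‖(w : ℂ)‖ < 1}, greenKernel z w ∂μ) +
    ∫⁻ w in {w : ClosedDisc | ‖(w : ℂ)‖ = 1}, ENNReal.ofReal (poisson z w) ∂μ

/-- The Dirichlet-type space `D(μ)`. -/
def dirichletSpace (μ : Measure ClosedDisc) : Set (Disc → ℂ) :=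
  {f | f ∈ Hol ∧ ∫⁻ z, ‖cderiv f z‖ₑ ^ 2 * weightU μ z ∂dA < ∞}

/-- The squared norm `‖f‖²_{H²} + ∫ |f'|² U_μ dA` of `D(μ)`, as an extended nonnegative real. -/
def dirichletNormSq (μ : Measure ClosedDisc) (f : Disc → ℂ) : ℝ≥0∞ :=
  ∑' n, ‖coeff f n‖ₑ ^ 2 + ∫⁻ z, ‖cderiv f z‖ₑ ^ 2 * weightU μ z ∂dA

/-- The inner product `⟨f, g⟩_{H²} + ∫ f' conj g' U_μ dA` of `D(μ)`. -/
def dirichletInner (μ : Measure ClosedDisc) (f g : Disc → ℂ) : ℂ :=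
  ∑' n, coeff f n * conj (coeff g n) +
    ∫ z, cderiv f z * conj (cderiv g z) * ((weightU μ z).toReal : ℂ) ∂dA

/-- The function `z ↦ 1 / (1 - conj l * z)`. -/
def szego (l : Disc) (z : Disc) : ℂ := 1 / (1 - conj (l : ℂ) * (z : ℂ))

/-- The map `U` of Cauchy duality, `(U f)(l) = ⟨f, 1 / (1 - conj l * z)⟩`, for `D(μ)`. The Cauchy
dual of `D(μ)` is the image of `D(μ)` under `U`, with the norm carried over by `U`. -/
def cauchyMap (μ : Measure ClosedDisc) (f : Disc → ℂ) (l : Disc) : ℂ :=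
  dirichletInner μ f (szego l)

/-! ### The weighted space `L²_{a,μ}` and the closure `E(μ)` of the polynomials -/

/-- `V_μ(z)`. -/
def weightV (μ : Measure ClosedDisc) (z : Disc) : ℝ := ∫ ζ, poisson z ζ ∂μ

/-- The weight `(1 - |z|²)² / V_μ(z)`. -/
def weightE (μ : Measure ClosedDisc) (z : Disc) : ℝ :=
  (1 - ‖(z : ℂ)‖ ^ 2) ^ 2 / weightV μ z

lemma one_sub_pos (z : Disc) : 0 < 1 - ‖(z : ℂ)‖ ^ 2 := by
  have h : ‖(z : ℂ)‖ < 1 := mem_ball_zero_iff.mp z.2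
  nlinarith [norm_nonneg (z : ℂ)]

lemma denom_lower (z : Disc) (ζ : ClosedDisc) :
    1 - ‖(z : ℂ)‖ ≤ ‖1 - conj (ζ : ℂ) * (z : ℂ)‖ := by
  have h1 : ‖(ζ : ℂ)‖ ≤ 1 := mem_closedBall_zero_iff.mp ζ.2
  have h2 := norm_sub_norm_le (1 : ℂ) (conj (ζ : ℂ) * (z : ℂ))
  rw [norm_mul, RCLike.norm_conj, norm_one] at h2
  nlinarith [norm_nonneg (z : ℂ)]

lemma denom_pos (z : Disc) (ζ : ClosedDisc) : 0 < ‖1 - conj (ζ : ℂ) * (z : ℂ)‖ := by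
  have h : ‖(z : ℂ)‖ < 1 := mem_ball_zero_iff.mp z.2
  linarith [denom_lower z ζ]

lemma poisson_pos (z : Disc) (ζ : ClosedDisc) : 0 < poisson z ζ :=
  div_pos (one_sub_pos z) (pow_pos (denom_pos z ζ) 2)

lemma continuous_poisson : Continuous fun p : Disc × ClosedDisc => poisson p.1 p.2 := by
  unfold poisson
  refine Continuous.div (by fun_prop) ?_ fun p => (pow_pos (denom_pos p.1 p.2) 2).ne'
  have : Continuous fun p : Disc × ClosedDisc => conj (p.2 : ℂ) :=
    Complex.continuous_conj.comp (by fun_prop)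
  fun_prop

lemma integrable_poisson (μ : Measure ClosedDisc) [IsFiniteMeasure μ] (z : Disc) :
    Integrable (poisson z) μ := by
  have hc : Continuous (poisson z) := continuous_poisson.comp (Continuous.prodMk_right z)
  exact hc.integrable_of_hasCompactSupport (HasCompactSupport.of_compactSpace _)

lemma weightV_pos (μ : Measure ClosedDisc) [IsFiniteMeasure μ] [NeZero μ] (z : Disc) :
    0 < weightV μ z := by
  unfold weightV
  rw [integral_pos_iff_support_of_nonneg (fun ζ => (poisson_pos z ζ).le)
    (integrable_poisson μ z)]
  have : Function.support (poisson z) = Set.univ := by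
    ext ζ
    simp [(poisson_pos z ζ).ne']
  rw [this]
  exact Measure.measure_univ_pos.mpr (NeZero.ne μ)

lemma weightE_nonneg (μ : Measure ClosedDisc) (z : Disc) : 0 ≤ weightE μ z :=
  div_nonneg (sq_nonneg _) (integral_nonneg fun ζ => (poisson_pos z ζ).le)

lemma weightE_pos (μ : Measure ClosedDisc) [IsFiniteMeasure μ] [NeZero μ] (z : Disc) :
    0 < weightE μ z :=
  div_pos (pow_pos (one_sub_pos z) 2) (weightV_pos μ z)

lemma measurable_weightE (μ : Measure ClosedDisc) [IsFiniteMeasure μ] :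
    Measurable (weightE μ) := by
  have h : StronglyMeasurable (weightV μ) :=
    StronglyMeasurable.integral_prod_right (continuous_poisson.stronglyMeasurable)
  exact Measurable.div (by fun_prop) h.measurable

variable (μ : Measure ClosedDisc)

/-- The integrals `∫ conj f' g' (1 - |z|²)² / V_μ dA` converge absolutely on `L²_{a,μ}`. -/
lemma integrable_mul [IsFiniteMeasure μ] {f g : Disc → ℂ} (hf : f ∈ Hol) (hg : g ∈ Hol)
    (hf2 : Integrable (fun z => ‖cderiv f z‖ ^ 2 * weightE μ z) dA)
    (hg2 : Integrable (fun z => ‖cderiv g z‖ ^ 2 * weightE μ z) dA) :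
    Integrable (fun z => conj (cderiv f z) * cderiv g z * (weightE μ z : ℂ)) dA := by
  refine (hf2.add hg2).mono' ?_ (Filter.Eventually.of_forall fun z => ?_)
  · refine Measurable.aestronglyMeasurable ?_
    have h1 := (Complex.continuous_conj.comp (continuous_cderiv hf)).measurable
    exact (h1.mul (continuous_cderiv hg).measurable).mul
      (Complex.measurable_ofReal.comp (measurable_weightE μ))
  · have h0 := weightE_nonneg μ z
    simp only [norm_mul, RCLike.norm_conj, Complex.norm_real, Real.norm_eq_abs, abs_of_nonneg h0,
      Pi.add_apply]
    nlinarith [mul_nonneg (sq_nonneg (‖cderiv f z‖ - ‖cderiv g z‖)) h0,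
      mul_nonneg (mul_nonneg (norm_nonneg (cderiv f z)) (norm_nonneg (cderiv g z))) h0]

/-- `L²_{a,μ}`: the holomorphic `f` with `∫ |f'|² (1 - |z|²)² / V_μ dA < ∞`, as a linear space. -/
def weightedSubmodule [IsFiniteMeasure μ] : Submodule ℂ (Disc → ℂ) where
  carrier := {f | f ∈ Hol ∧ Integrable (fun z => ‖cderiv f z‖ ^ 2 * weightE μ z) dA}
  zero_mem' := by
    refine ⟨Hol.zero_mem, ?_⟩
    have : ∀ z, cderiv 0 z = 0 := fun z => by simp [cderiv, ext_zero]
    simp [this]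
  add_mem' := by
    rintro f g ⟨hf, hf2⟩ ⟨hg, hg2⟩
    have hfg := Hol.add_mem hf hg
    refine ⟨hfg, ((hf2.const_mul 2).add (hg2.const_mul 2)).mono' ?_
      (Filter.Eventually.of_forall fun z => ?_)⟩
    · exact (((continuous_cderiv hfg).norm.pow 2).measurable.mul
        (measurable_weightE μ)).aestronglyMeasurable
    · have h0 := weightE_nonneg μ z
      have h1 := norm_add_le (cderiv f z) (cderiv g z)
      have h2 : ‖cderiv f z + cderiv g z‖ ^ 2 ≤ 2 * ‖cderiv f z‖ ^ 2 + 2 * ‖cderiv g z‖ ^ 2 := by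
        nlinarith [sq_nonneg (‖cderiv f z‖ - ‖cderiv g z‖), norm_nonneg (cderiv f z + cderiv g z)]
      rw [cderiv_add hf hg, Real.norm_eq_abs, abs_of_nonneg (mul_nonneg (sq_nonneg _) h0)]
      simp only [Pi.add_apply]
      nlinarith [mul_le_mul_of_nonneg_right h2 h0]
  smul_mem' := by
    rintro c f ⟨hf, hf2⟩
    refine ⟨Hol.smul_mem c hf, (hf2.const_mul (‖c‖ ^ 2)).congr
      (Filter.Eventually.of_forall fun z => ?_)⟩
    simp only [cderiv_smul c hf, norm_mul]
    ring

/-- `L²_{a,μ}` as a type, so that it carries the topology of its norm and not the topology of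
pointwise convergence. -/
def WeightedSpace [IsFiniteMeasure μ] : Type := weightedSubmodule μ

instance [IsFiniteMeasure μ] : AddCommGroup (WeightedSpace μ) :=
  inferInstanceAs (AddCommGroup (weightedSubmodule μ))

instance [IsFiniteMeasure μ] : Module ℂ (WeightedSpace μ) :=
  inferInstanceAs (Module ℂ (weightedSubmodule μ))

/-- The elements of `L²_{a,μ}` as functions on the disc. -/
def WeightedSpace.toFun [IsFiniteMeasure μ] : WeightedSpace μ →ₗ[ℂ] (Disc → ℂ) :=
  (weightedSubmodule μ).subtype

lemma eq_zero_of_cderiv {f : Disc → ℂ} (hf : f ∈ Hol) (h0 : f origin = 0)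
    (h : ∀ z, cderiv f z = 0) : f = 0 := by
  funext z
  have hfd : ∀ x ∈ ball (0 : ℂ) 1, fderivWithin ℂ (ext f) (ball 0 1) x = 0 := by
    intro x hx
    rw [fderivWithin_of_isOpen isOpen_ball hx]
    ext
    simpa [cderiv] using h ⟨x, hx⟩
  have h1 := (convex_ball (0 : ℂ) 1).is_const_of_fderivWithin_eq_zero hf hfd z.2 origin.2
  rw [ext_coe, ext_coe, h0] at h1
  simpa using h1

lemma cderiv_eq_zero_of_integral [IsFiniteMeasure μ] [NeZero μ] {f : Disc → ℂ} (hf : f ∈ Hol)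
    (hf2 : Integrable (fun z => ‖cderiv f z‖ ^ 2 * weightE μ z) dA)
    (h : ∫ z, ‖cderiv f z‖ ^ 2 * weightE μ z ∂dA = 0) (z : Disc) : cderiv f z = 0 := by
  have h1 := (integral_eq_zero_iff_of_nonneg
    (fun z => mul_nonneg (sq_nonneg _) (weightE_nonneg μ z)) hf2).mp h
  have hπ : (ENNReal.ofReal Real.pi)⁻¹ ≠ 0 := ENNReal.inv_ne_zero.mpr ENNReal.ofReal_ne_top
  have h2 : cderiv f =ᵐ[(volume : Measure ℂ).comap (Subtype.val : Disc → ℂ)] 0 := by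
    have h3 : ∀ᵐ z ∂(volume : Measure ℂ).comap (Subtype.val : Disc → ℂ), ‖cderiv f z‖ ^ 2 * weightE μ z = 0 := by
      rw [Filter.EventuallyEq, dA, Measure.ae_ennreal_smul_measure_eq hπ] at h1
      exact h1
    filter_upwards [h3] with z hz
    rcases mul_eq_zero.mp hz with hz | hz
    · simpa using hz
    · exact absurd hz (weightE_pos μ z).ne'
  have h4 : ∀ᵐ x : ℂ, ∀ hx : x ∈ ball (0 : ℂ) 1, cderiv f ⟨x, hx⟩ = 0 := by
    have := (ae_restrict_iff_subtype (μ := (volume : Measure ℂ)) (s := ball (0 : ℂ) 1)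
      measurableSet_ball (p := fun x => deriv (ext f) x = 0)).mpr h2
    exact (ae_restrict_iff' measurableSet_ball).mp this
  have h5 : Set.EqOn (deriv (ext f)) 0 (ball (0 : ℂ) 1) := by
    refine Measure.eqOn_open_of_ae_eq (μ := (volume : Measure ℂ)) ?_ isOpen_ball
      (DifferentiableOn.deriv hf isOpen_ball).continuousOn continuousOn_const
    exact (ae_restrict_iff' measurableSet_ball).mpr h4
  exact h5 z.2

/-- The inner product of `L²_{a,μ}` (conjugate linear in the first variable, as in Mathlib):
`conj f(0) g(0) + ∫ conj f' g' (1 - |z|²)² / V_μ dA`. -/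
@[reducible]
def WeightedSpace.core [IsFiniteMeasure μ] [NeZero μ] :
    InnerProductSpace.Core ℂ (WeightedSpace μ) where
  inner f g := conj (f.1 origin) * g.1 origin +
    ∫ z, conj (cderiv f.1 z) * cderiv g.1 z * (weightE μ z : ℂ) ∂dA
  conj_inner_symm f g := by
    simp only [map_add, map_mul, Complex.conj_conj, ← integral_conj, Complex.conj_ofReal]
    congr 1
    · ring
    · congr 1
      funext z
      ring
  re_inner_nonneg f := by
    have h : (fun z => conj (cderiv f.1 z) * cderiv f.1 z * (weightE μ z : ℂ)) =
        fun z => ((‖cderiv f.1 z‖ ^ 2 * weightE μ z : ℝ) : ℂ) := by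
      funext z
      rw [Complex.conj_mul']
      push_cast
      rfl
    rw [h, integral_complex_ofReal, Complex.conj_mul']
    have h2 : 0 ≤ ∫ z, ‖cderiv f.1 z‖ ^ 2 * weightE μ z ∂dA :=
      integral_nonneg fun z => mul_nonneg (sq_nonneg _) (weightE_nonneg μ z)
    have h3 := add_nonneg (sq_nonneg ‖f.1 origin‖) h2
    exact_mod_cast h3
  add_left f g h := by
    have e : (f + g).1 = f.1 + g.1 := rfl
    rw [e]
    simp only [cderiv_add f.2.1 g.2.1, Pi.add_apply, map_add, add_mul]
    rw [integral_add (integrable_mul μ f.2.1 h.2.1 f.2.2 h.2.2)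
      (integrable_mul μ g.2.1 h.2.1 g.2.2 h.2.2)]
    ring
  smul_left f g c := by
    have e : (c • f).1 = c • f.1 := rfl
    rw [e]
    simp only [cderiv_smul c f.2.1, Pi.smul_apply, smul_eq_mul, map_mul, mul_assoc, mul_add]
    rw [integral_const_mul]
  definite f hf := by
    have h : (fun z => conj (cderiv f.1 z) * cderiv f.1 z * (weightE μ z : ℂ)) =
        fun z => ((‖cderiv f.1 z‖ ^ 2 * weightE μ z : ℝ) : ℂ) := by
      funext z
      rw [Complex.conj_mul']
      push_cast
      rfl
    rw [h, integral_complex_ofReal, Complex.conj_mul'] at hf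
    have h2 : 0 ≤ ∫ z, ‖cderiv f.1 z‖ ^ 2 * weightE μ z ∂dA :=
      integral_nonneg fun z => mul_nonneg (sq_nonneg _) (weightE_nonneg μ z)
    have h3 : ‖f.1 origin‖ ^ 2 + ∫ z, ‖cderiv f.1 z‖ ^ 2 * weightE μ z ∂dA = 0 := by
      exact_mod_cast hf
    have h4 : ‖f.1 origin‖ ^ 2 = 0 := by nlinarith [sq_nonneg ‖f.1 origin‖]
    refine Subtype.ext (eq_zero_of_cderiv f.2.1 (by simpa using h4)
      (cderiv_eq_zero_of_integral μ f.2.1 f.2.2 ?_))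
    linarith

instance [IsFiniteMeasure μ] [NeZero μ] : NormedAddCommGroup (WeightedSpace μ) :=
  (WeightedSpace.core μ).toNormedAddCommGroup

instance [IsFiniteMeasure μ] [NeZero μ] : InnerProductSpace ℂ (WeightedSpace μ) :=
  InnerProductSpace.ofCore (WeightedSpace.core μ).toCore

/-- The norm of `L²_{a,μ}`. -/
lemma WeightedSpace.norm_sq [IsFiniteMeasure μ] [NeZero μ] (f : WeightedSpace μ) :
    ‖f‖ ^ 2 = ‖WeightedSpace.toFun μ f origin‖ ^ 2 +
      ∫ z, ‖cderiv (WeightedSpace.toFun μ f) z‖ ^ 2 * weightE μ z ∂dA := by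
  have h1 : ((‖f‖ ^ 2 : ℝ) : ℂ) = inner ℂ f f := by
    rw [inner_self_eq_norm_sq_to_K]
    push_cast
    rfl
  have h2 : inner ℂ f f = conj (f.1 origin) * f.1 origin +
      ∫ z, conj (cderiv f.1 z) * cderiv f.1 z * (weightE μ z : ℂ) ∂dA := rfl
  have h : (fun z => conj (cderiv f.1 z) * cderiv f.1 z * (weightE μ z : ℂ)) =
      fun z => ((‖cderiv f.1 z‖ ^ 2 * weightE μ z : ℝ) : ℂ) := by
    funext z
    rw [Complex.conj_mul']
    push_cast
    rfl
  rw [h2, h, integral_complex_ofReal, Complex.conj_mul'] at h1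
  exact_mod_cast h1

/-- `E(μ)`: the closure of the polynomials in `L²_{a,μ}`. -/
def E [IsFiniteMeasure μ] [NeZero μ] : Submodule ℂ (WeightedSpace μ) :=
  (polynomials.comap (WeightedSpace.toFun μ)).topologicalClosure

/-- The elements of `E(μ)`, as functions on the disc. -/
def carrierE [IsFiniteMeasure μ] [NeZero μ] : Set (Disc → ℂ) :=
  WeightedSpace.toFun μ '' (E μ : Set (WeightedSpace μ))

end DirichletType

end

namespace DirichletType

open Filter Topology

/-! ### Taylor series on the disc -/

/-! For `w` in the closed disc let `D_w(f)` be the integral of `|f'|²` against the kernel of `U_μ`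
at `w`, so that `∫ |f'|² U_μ dA = ∫ D_w(f) dμ(w)`. Everything rests on the identity `D_w(f) = ‖Q_w
f‖²` in `H²`, with `Q_w f = (f - f(w)) / (z - w)` (`locDir_eq`; on the circle, finiteness of
`D_w(f)` itself produces the quotient and the constant `f(w)`). Inside the disc a Möbius change of
variables reduces it to the Littlewood–Paley formula at the origin (`locDir_interior`). On the
circle it is an identity between the coefficients of `f' / (1 - conj w z)` and differences of Cesàro
means (`sqsum_eq_of_cesaro`). Hence `‖f‖²_{D(μ)} = ‖f‖² + ∫ ‖Q_w f‖² dμ(w)` involves `H²` norms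
only.

Three facts follow. The measures `(1 - |z|²) / |1 - conj w z|² dA` are uniformly Carleson
(`lintegral_poisson_le`). Dilations are uniformly bounded on `D(μ)`, so polynomials are dense
(`topologicalClosure_polyD`). Coanalytic Toeplitz operators commute with `Q_w`, so they are bounded
on polynomials in `D(μ)` by the supremum of the symbol (`DSpace.exists_toeplitz`).

Upper bound for `U`: on polynomials `U f = f + ∫ z Q_w f / (1 - conj w z) dμ(w)`. Differentiating
and applying Cauchy–Schwarz in `w` yields the factor `∫ |1 - conj w z|⁻² dμ = V_μ / (1 - |z|²)`,
which the weight `(1 - |z|²)² / V_μ` turns into `1 - |z|²`; the Carleson bound finishes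
(`weightedNormSq_cauchy_le_of_mem_polyD`).

Lower bound: the `H²` pairing of `f` and `q` is `f(0) conj q(0)` plus the integral of `(f' + (f -
f(0)) / z) conj q'` against `(1 - |z|²) dA`. Splitting `1 - |z|²` as `V_μ^{1/2}` times `(1 - |z|²) /
V_μ^{1/2}` and using `V_μ ≤ U_μ` and the Carleson bound controls it by the norms of `D(μ)` and
`L²_{a,μ}` (`re_pairing_le`). The representers of Taylor coefficients in `D(μ)` span a dense
subspace that `U` maps onto the polynomials, and there the `D(μ)` pairing with `f` is the `H²`
pairing with `U f`. So `U` is bounded below, and its closed range is `E(μ)`.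

Multipliers: multiplication by a bounded `φ` is the `H²` adjoint of a coanalytic Toeplitz operator,
so duality makes it bounded on `E(μ)`. Conversely, the closed graph theorem makes a multiplier
bounded, and point evaluations are eigenvectors of the adjoint. -/

lemma Disc.norm_lt_one (z : Disc) : ‖(z : ℂ)‖ < 1 := mem_ball_zero_iff.mp z.2

lemma hasSum_coeff {f : Disc → ℂ} (hf : f ∈ Hol) (z : Disc) :
    HasSum (fun n => coeff f n * (z : ℂ) ^ n) (f z) := by
  have h := Complex.hasSum_taylorSeries_on_ball (f := ext f) (c := 0) (r := 1) hf z.2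
  rw [ext_coe] at h
  refine h.congr_fun ?_
  intro n
  simp only [sub_zero, smul_eq_mul, coeff]
  ring

/-- The norms of the terms of a power series that converges on the disc are summable. -/
lemma summable_norm_mul_pow {a : ℕ → ℂ} (h : ∀ z : Disc, Summable fun n => a n * (z : ℂ) ^ n)
    {r : ℝ} (hr0 : 0 ≤ r) (hr1 : r < 1) : Summable fun n => ‖a n‖ * r ^ n := by
  have hr : ((r : ℝ) : ℂ) ∈ ball (0 : ℂ) 1 := by
    simpa [abs_of_nonneg hr0] using hr1
  refine (h ⟨r, hr⟩).norm.congr fun n => ?_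
  simp [abs_of_nonneg hr0]

lemma hasFPowerSeriesOnBall_of_hasSum {a : ℕ → ℂ} {f : Disc → ℂ}
    (h : ∀ z : Disc, HasSum (fun n => a n * (z : ℂ) ^ n) (f z)) :
    HasFPowerSeriesOnBall (ext f) (FormalMultilinearSeries.ofScalars ℂ a) 0 1 where
  r_le := by
    refine ENNReal.le_of_forall_nnreal_lt fun r hr => ?_
    refine FormalMultilinearSeries.le_radius_of_summable _ ?_
    have hr' : (r : ℝ) < 1 := by exact_mod_cast hr
    simp only [FormalMultilinearSeries.ofScalars_norm]
    exact summable_norm_mul_pow (fun z => (h z).summable) r.2 hr'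
  r_pos := one_pos
  hasSum := by
    intro y hy
    have hy' : y ∈ ball (0 : ℂ) 1 := by
      rw [← ENNReal.ofReal_one, eball_ofReal] at hy
      exact hy
    have := h ⟨y, hy'⟩
    rw [← ext_coe f] at this
    simpa [FormalMultilinearSeries.ofScalars_apply_eq, zero_add, mul_comm] using this

lemma hol_of_hasSum {a : ℕ → ℂ} {f : Disc → ℂ}
    (h : ∀ z : Disc, HasSum (fun n => a n * (z : ℂ) ^ n) (f z)) : f ∈ Hol := by
  have h1 := (hasFPowerSeriesOnBall_of_hasSum h).differentiableOn
  rw [← ENNReal.ofReal_one, eball_ofReal] at h1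
  exact h1

/-- Uniqueness of power series. Coefficients below are found by exhibiting a convergent expansion
and applying this, instead of computing iterated derivatives. -/
lemma coeff_of_hasSum {a : ℕ → ℂ} {f : Disc → ℂ}
    (h : ∀ z : Disc, HasSum (fun n => a n * (z : ℂ) ^ n) (f z)) : coeff f = a := by
  have h1 := hasFPowerSeriesOnBall_of_hasSum h
  have h2 := h1.analyticAt.hasFPowerSeriesAt
  have h3 := h2.eq_formalMultilinearSeries h1.hasFPowerSeriesAt
  exact FormalMultilinearSeries.ofScalars_series_injective ℂ ℂ h3

/-- The function on the disc with Taylor coefficients `a`. -/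
noncomputable def ofCoeff (a : ℕ → ℂ) (z : Disc) : ℂ := ∑' n, a n * (z : ℂ) ^ n

/-- Linear growth is what is available both for coefficients in `L²_{a,μ}` and for the inner
products with monomials that define `DSpace.cauchy`. -/
lemma summable_mul_pow_of_bound {a : ℕ → ℂ} {C : ℝ} (h : ∀ n, ‖a n‖ ≤ C * (n + 1)) (z : Disc) :
    Summable fun n => a n * (z : ℂ) ^ n := by
  have h1 : Summable fun n : ℕ => C * ((n : ℝ) ^ 1 * ‖(z : ℂ)‖ ^ n + ‖(z : ℂ)‖ ^ n) := by
    refine Summable.mul_left _ (Summable.add ?_ ?_)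
    · exact summable_pow_mul_geometric_of_norm_lt_one 1 (by simpa using z.norm_lt_one)
    · exact summable_geometric_of_lt_one (norm_nonneg _) z.norm_lt_one
  refine Summable.of_norm_bounded h1 fun n => ?_
  rw [norm_mul, norm_pow]
  have := mul_le_mul_of_nonneg_right (h n) (pow_nonneg (norm_nonneg (z : ℂ)) n)
  nlinarith [this]

lemma eq_of_coeff_eq {f g : Disc → ℂ} (hf : f ∈ Hol) (hg : g ∈ Hol) (h : coeff f = coeff g) :
    f = g := by
  funext z
  have h1 := hasSum_coeff hf z
  rw [h] at h1
  exact h1.unique (hasSum_coeff hg z)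

lemma coeff_zero_eq (f : Disc → ℂ) : coeff f 0 = f origin := by
  simp only [coeff, iteratedDeriv_zero, Nat.factorial_zero, Nat.cast_one, div_one]
  exact ext_coe f origin

lemma coeff_add {f g : Disc → ℂ} (hf : f ∈ Hol) (hg : g ∈ Hol) :
    coeff (f + g) = coeff f + coeff g :=
  coeff_of_hasSum fun z => by
    simpa [add_mul] using (hasSum_coeff hf z).add (hasSum_coeff hg z)

lemma coeff_smul (c : ℂ) {f : Disc → ℂ} (hf : f ∈ Hol) : coeff (c • f) = c • coeff f :=
  coeff_of_hasSum fun z => by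
    simpa [mul_assoc] using (hasSum_coeff hf z).mul_left c

lemma coeff_sub {f g : Disc → ℂ} (hf : f ∈ Hol) (hg : g ∈ Hol) :
    coeff (f - g) = coeff f - coeff g :=
  coeff_of_hasSum fun z => by
    simpa [sub_mul] using (hasSum_coeff hf z).sub (hasSum_coeff hg z)

lemma cderiv_sub {f g : Disc → ℂ} (hf : f ∈ Hol) (hg : g ∈ Hol) (z : Disc) :
    cderiv (f - g) z = cderiv f z - cderiv g z := by
  have h := cderiv_add (Hol.sub_mem hf hg) hg z
  rw [sub_add_cancel] at h
  rw [h, add_sub_cancel_right]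

lemma cderiv_eq_of_hasDerivAt {f : Disc → ℂ} {F : ℂ → ℂ} {d : ℂ} (z : Disc)
    (hF : ∀ u : Disc, F u = f u) (h : HasDerivAt F d z) : cderiv f z = d := by
  have : ext f =ᶠ[𝓝 (z : ℂ)] F := by
    filter_upwards [isOpen_ball.mem_nhds z.2] with u hu
    lift u to Disc using hu
    rw [ext_coe, hF]
  exact (h.congr_of_eventuallyEq this).deriv

lemma hol_of_differentiableOn {f : Disc → ℂ} {F : ℂ → ℂ} (hF : ∀ u : Disc, F u = f u)
    (h : DifferentiableOn ℂ F (ball 0 1)) : f ∈ Hol :=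
  h.congr fun u hu => by
    lift u to Disc using hu
    rw [ext_coe, hF]

lemma cderiv_mem_hol {f : Disc → ℂ} (hf : f ∈ Hol) : cderiv f ∈ Hol :=
  hol_of_differentiableOn (F := deriv (ext f)) (fun _ => rfl)
    (DifferentiableOn.deriv hf isOpen_ball)

lemma coeff_cderiv (f : Disc → ℂ) (n : ℕ) :
    coeff (cderiv f) n = (n + 1) * coeff f (n + 1) := by
  have : ext (cderiv f) =ᶠ[𝓝 0] deriv (ext f) := by
    filter_upwards [isOpen_ball.mem_nhds (mem_ball_self one_pos)] with u hu
    lift u to Disc using hu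
    rw [ext_coe, cderiv]
  rw [coeff, coeff, this.iteratedDeriv_eq, iteratedDeriv_succ', Nat.factorial_succ]
  have h1 : (n.factorial : ℂ) ≠ 0 := by exact_mod_cast n.factorial_ne_zero
  have h2 : (n + 1 : ℂ) ≠ 0 := by exact_mod_cast n.succ_ne_zero
  push_cast
  field_simp

lemma continuous_hol {f : Disc → ℂ} (hf : f ∈ Hol) : Continuous f := by
  have h1 : Continuous fun z : Disc => ext f z :=
    continuousOn_iff_continuous_domRestrict.mp (DifferentiableOn.continuousOn hf)
  exact h1.congr fun z => ext_coe f z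

lemma mul_mem_hol {f g : Disc → ℂ} (hf : f ∈ Hol) (hg : g ∈ Hol) : f * g ∈ Hol :=
  hol_of_differentiableOn (F := ext f * ext g) (fun u => by simp [ext_coe])
    (DifferentiableOn.mul hf hg)

lemma cderiv_mul {f g : Disc → ℂ} (hf : f ∈ Hol) (hg : g ∈ Hol) (z : Disc) :
    cderiv (f * g) z = cderiv f z * g z + f z * cderiv g z := by
  refine cderiv_eq_of_hasDerivAt (F := ext f * ext g) z (fun u => by simp [ext_coe]) ?_
  have := (Hol.differentiableAt hf z).hasDerivAt.mul (Hol.differentiableAt hg z).hasDerivAt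
  rwa [ext_coe, ext_coe] at this

lemma summable_norm_coeff {f : Disc → ℂ} (hf : f ∈ Hol) {r : ℝ} (hr0 : 0 ≤ r) (hr1 : r < 1) :
    Summable fun n => ‖coeff f n‖ * r ^ n :=
  summable_norm_mul_pow (fun z => (hasSum_coeff hf z).summable) hr0 hr1

lemma coeff_mul {f g : Disc → ℂ} (hf : f ∈ Hol) (hg : g ∈ Hol) (n : ℕ) :
    coeff (f * g) n = ∑ kl ∈ Finset.HasAntidiagonal.antidiagonal n, coeff f kl.1 * coeff g kl.2 := by
  have key : coeff (f * g) =
      fun n => ∑ kl ∈ Finset.HasAntidiagonal.antidiagonal n, coeff f kl.1 * coeff g kl.2 := by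
    refine coeff_of_hasSum fun z => ?_
    have h1 := (hasSum_coeff hf z).summable.norm
    have h2 := (hasSum_coeff hg z).summable.norm
    have h3 := (summable_norm_sum_mul_antidiagonal_of_summable_norm h1 h2).of_norm.hasSum
    rw [← tsum_mul_tsum_eq_tsum_sum_antidiagonal_of_summable_norm h1 h2,
      (hasSum_coeff hf z).tsum_eq, (hasSum_coeff hg z).tsum_eq] at h3
    refine h3.congr_fun fun n => ?_
    rw [Finset.sum_mul]
    refine Finset.sum_congr rfl fun kl hkl => ?_
    rw [← Finset.HasAntidiagonal.mem_antidiagonal.mp hkl, pow_add]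
    ring
  rw [key]

/-- The coordinate function `z - w`. -/
def coordSub (w : ℂ) (z : Disc) : ℂ := z - w

lemma coordSub_mem_hol (w : ℂ) : coordSub w ∈ Hol :=
  hol_of_differentiableOn (F := fun z => z - w) (fun _ => rfl) (by fun_prop)

lemma cderiv_coordSub (w : ℂ) (z : Disc) : cderiv (coordSub w) z = 1 :=
  cderiv_eq_of_hasDerivAt (F := fun z => z - w) z (fun _ => rfl)
    ((hasDerivAt_id _).sub_const w)

/-- `c + (z - w) F` in terms of Taylor coefficients. -/
lemma hasSum_const_add_coordSub_mul {b F : ℕ → ℂ} {w c s : ℂ} {z : ℂ}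
    (h : ∀ n, b (n + 1) = F n - w * F (n + 1)) (h0 : b 0 = c - w * F 0)
    (hF : HasSum (fun n => F n * z ^ n) s) :
    HasSum (fun n => b n * z ^ n) (c + (z - w) * s) := by
  rw [← hasSum_nat_add_iff' 1]
  have h1 : HasSum (fun n => F (n + 1) * z ^ (n + 1)) (s - F 0) := by
    have := (hasSum_nat_add_iff' 1).mpr hF
    simpa using this
  have h2 := (hF.mul_left z).sub (h1.mul_left w)
  simp only [Finset.range_one, Finset.sum_singleton, pow_zero, mul_one, h0]
  have e : z * s - w * (s - F 0) = c + (z - w) * s - (c - w * F 0) := by ring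
  rw [← e]
  refine h2.congr_fun fun n => ?_
  rw [h]
  ring

/-! ### Parseval's identity on circles and on the disc -/

/-- The square of the `ℓ²` norm, with value in `[0, ∞]`. -/
noncomputable def sqsum (a : ℕ → ℂ) : ℝ≥0∞ := ∑' n, ‖a n‖ₑ ^ 2

lemma enorm_sq_eq_ofReal (c : ℂ) : ‖c‖ₑ ^ 2 = ENNReal.ofReal (‖c‖ ^ 2) := by
  rw [← ofReal_norm, ENNReal.ofReal_pow (norm_nonneg c)]

lemma sqsum_lt_top_iff {a : ℕ → ℂ} : sqsum a < ∞ ↔ Summable fun n => ‖a n‖ ^ 2 := by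
  constructor
  · intro h
    have h1 := ENNReal.summable_toReal h.ne
    refine h1.congr fun n => ?_
    rw [enorm_sq_eq_ofReal, ENNReal.toReal_ofReal (sq_nonneg _)]
  · intro h
    have : sqsum a = ENNReal.ofReal (∑' n, ‖a n‖ ^ 2) := by
      rw [ENNReal.ofReal_tsum_of_nonneg (fun n => sq_nonneg _) h]
      exact tsum_congr fun n => enorm_sq_eq_ofReal _
    rw [this]
    exact ENNReal.ofReal_lt_top

lemma sqsum_eq_ofReal {a : ℕ → ℂ} (h : Summable fun n => ‖a n‖ ^ 2) :
    sqsum a = ENNReal.ofReal (∑' n, ‖a n‖ ^ 2) := by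
  rw [ENNReal.ofReal_tsum_of_nonneg (fun n => sq_nonneg _) h]
  exact tsum_congr fun n => enorm_sq_eq_ofReal _

/-- **Parseval's identity** for absolutely convergent power series on a circle. -/
lemma hasSum_sq_circleAverage {a : ℕ → ℂ} {r : ℝ} (hr : 0 ≤ r)
    (hs : Summable fun n => ‖a n‖ * r ^ n) {F : ℂ → ℂ}
    (hF : ∀ z ∈ sphere (0 : ℂ) r, HasSum (fun n => a n * z ^ n) (F z)) :
    HasSum (fun n => ‖a n‖ ^ 2 * r ^ (2 * n)) (Real.circleAverage (fun z => ‖F z‖ ^ 2) 0 r) := by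
  rw [hasSum_iff_tendsto_nat_of_nonneg (fun n => by positivity)]
  set p : ℕ → Polynomial ℂ := fun N =>
    ∑ n ∈ Finset.range N, Polynomial.monomial n (a n * (r : ℂ) ^ n) with hp
  have hpc : ∀ N i, (p N).coeff i = if i < N then a i * (r : ℂ) ^ i else 0 := by
    intro N i
    simp only [hp, Polynomial.finsetSum_coeff, Polynomial.coeff_monomial]
    rw [Finset.sum_ite_eq' (Finset.range N) i]
    simp
  -- Absorbing `r ^ n` into the coefficients moves the circle to radius one, where the polynomial
  -- Parseval identity applies.
  have h1 : ∀ N, ∑ n ∈ Finset.range N, ‖a n‖ ^ 2 * r ^ (2 * n) =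
      Real.circleAverage (fun z => ‖∑ n ∈ Finset.range N, a n * z ^ n‖ ^ 2) 0 r := by
    intro N
    rw [Real.circleAverage_eq_circleAverage_zero_one]
    have h2 := Polynomial.sum_sq_norm_coeff_eq_circleAverage (p N)
    have h3 : ∑ i ∈ (p N).support, ‖(p N).coeff i‖ ^ 2 =
        ∑ n ∈ Finset.range N, ‖a n‖ ^ 2 * r ^ (2 * n) := by
      rw [Finset.sum_subset (s₂ := Finset.range N)]
      · refine Finset.sum_congr rfl fun n hn => ?_
        rw [hpc, if_pos (Finset.mem_range.mp hn), norm_mul, mul_pow, norm_pow, Complex.norm_real,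
          Real.norm_eq_abs, abs_of_nonneg hr, ← pow_mul, mul_comm n 2]
      · intro n hn
        rw [Polynomial.mem_support_iff, hpc] at hn
        by_contra h
        simp only [Finset.mem_range] at h
        exact hn (if_neg h)
      · intro n _ hn
        rw [Polynomial.notMem_support_iff.mp hn]
        simp
    rw [← h3, h2]
    congr 1
    funext z
    simp only [hp, Polynomial.eval_finsetSum, Polynomial.eval_monomial, add_zero, mul_pow]
    simp only [mul_assoc]
  simp_rw [h1, Real.circleAverage_def]
  refine Tendsto.const_smul ?_ _
  -- All partial sums are bounded by `M` on the circle, so dominated convergence passes to the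
  -- limit.
  set M : ℝ := ∑' n, ‖a n‖ * r ^ n with hM
  have hz : ∀ θ, circleMap 0 r θ ∈ sphere (0 : ℂ) r := fun θ => circleMap_mem_sphere 0 hr θ
  refine intervalIntegral.tendsto_integral_filter_of_dominated_convergence (fun _ => M ^ 2)
    (Eventually.of_forall fun N => ?_) (Eventually.of_forall fun N => ?_) (by simp) ?_
  · exact (Continuous.aestronglyMeasurable (by fun_prop))
  · refine Eventually.of_forall fun θ _ => ?_
    rw [Real.norm_eq_abs, abs_of_nonneg (sq_nonneg _)]
    refine pow_le_pow_left₀ (norm_nonneg _) ((norm_sum_le _ _).trans ?_) 2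
    refine le_trans (le_of_eq ?_) (hs.sum_le_tsum (Finset.range N) fun n _ => by positivity)
    refine Finset.sum_congr rfl fun n _ => ?_
    rw [norm_mul, norm_pow, mem_sphere_zero_iff_norm.mp (hz θ)]
  · refine Eventually.of_forall fun θ _ => ?_
    exact ((hF _ (hz θ)).tendsto_sum_nat.norm.pow 2)

lemma hasSum_sq_circleAverage_of_hol {f : Disc → ℂ} (hf : f ∈ Hol) {r : ℝ} (hr : 0 ≤ r)
    (hr1 : r < 1) :
    HasSum (fun n => ‖coeff f n‖ ^ 2 * r ^ (2 * n))
      (Real.circleAverage (fun z => ‖ext f z‖ ^ 2) 0 r) := by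
  refine hasSum_sq_circleAverage hr (summable_norm_coeff hf hr hr1) fun z hz => ?_
  have hz' : z ∈ ball (0 : ℂ) 1 := by
    rw [mem_ball_zero_iff, mem_sphere_zero_iff_norm.mp hz]
    exact hr1
  have := hasSum_coeff hf ⟨z, hz'⟩
  rwa [← ext_coe f] at this

lemma continuous_ext_circleMap {f : Disc → ℂ} (hf : f ∈ Hol) {r : ℝ} (hr : 0 ≤ r) (hr1 : r < 1) :
    Continuous fun θ => ext f (circleMap 0 r θ) :=
  (DifferentiableOn.continuousOn hf).comp_continuous (by fun_prop) fun θ => by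
    rw [mem_ball_zero_iff, norm_circleMap_zero, abs_of_nonneg hr]
    exact hr1

/-- Parseval on a circle in `[0, ∞]`, over the angle interval of the polar coordinate chart;
periodicity moves it there from `(0, 2π)`. -/
lemma lintegral_angle {f : Disc → ℂ} (hf : f ∈ Hol) {r : ℝ} (hr : 0 ≤ r) (hr1 : r < 1) :
    ∫⁻ θ in Set.Ioo (-Real.pi) Real.pi, ‖ext f (circleMap 0 r θ)‖ₑ ^ 2 =
      ENNReal.ofReal (2 * Real.pi) * ∑' n, ‖coeff f n‖ₑ ^ 2 * ENNReal.ofReal (r ^ (2 * n)) := by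
  have hc : Continuous fun θ => ‖ext f (circleMap 0 r θ)‖ ^ 2 :=
    (continuous_ext_circleMap hf hr hr1).norm.pow 2
  have h1 : ∀ n, ‖coeff f n‖ₑ ^ 2 * ENNReal.ofReal (r ^ (2 * n)) =
      ENNReal.ofReal (‖coeff f n‖ ^ 2 * r ^ (2 * n)) := fun n => by
    rw [enorm_sq_eq_ofReal, ENNReal.ofReal_mul (sq_nonneg _)]
  have h2 := hasSum_sq_circleAverage_of_hol hf hr hr1
  simp_rw [h1]
  rw [← ENNReal.ofReal_tsum_of_nonneg (fun n => by positivity) h2.summable, h2.tsum_eq,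
    ← ENNReal.ofReal_mul (by positivity), Real.circleAverage_def, smul_eq_mul, ← mul_assoc,
    mul_inv_cancel₀ (by positivity), one_mul]
  have h3 : ∫ θ in (0 : ℝ)..2 * Real.pi, ‖ext f (circleMap 0 r θ)‖ ^ 2 =
      ∫ θ in Set.Ioo (-Real.pi) Real.pi, ‖ext f (circleMap 0 r θ)‖ ^ 2 := by
    have hp : (fun θ => ‖ext f (circleMap 0 r θ)‖ ^ 2).Periodic (2 * Real.pi) := fun θ => by
      simp only [periodic_circleMap 0 r θ]
    have h4 := hp.intervalIntegral_add_eq 0 (-Real.pi)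
    rw [zero_add, show -Real.pi + 2 * Real.pi = Real.pi by ring] at h4
    rw [h4, intervalIntegral.integral_of_le (by linarith [Real.pi_pos]), integral_Ioc_eq_integral_Ioo]
  rw [h3, ofReal_integral_eq_lintegral_ofReal]
  · exact lintegral_congr fun θ => enorm_sq_eq_ofReal _
  · exact (hc.integrableOn_Icc (a := -Real.pi) (b := Real.pi)).mono_set Set.Ioo_subset_Icc_self
  · exact Eventually.of_forall fun θ => sq_nonneg _

lemma lintegral_dA (g : ℂ → ℝ≥0∞) :
    ∫⁻ z : Disc, g z ∂dA = (ENNReal.ofReal Real.pi)⁻¹ * ∫⁻ z in ball (0 : ℂ) 1, g z := by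
  rw [dA, lintegral_smul_measure, lintegral_subtype_comap measurableSet_ball, smul_eq_mul]

lemma measurable_ext {f : Disc → ℂ} (hf : f ∈ Hol) : Measurable (ext f) := by
  classical
  have h : (ball (0 : ℂ) 1).piecewise (ext f) 0 = ext f := by
    funext z
    by_cases hz : z ∈ ball (0 : ℂ) 1
    · rw [Set.piecewise_eq_of_mem _ _ _ hz]
    · rw [Set.piecewise_eq_of_notMem _ _ _ hz, ext_of_notMem f hz, Pi.zero_apply]
  rw [← h]
  exact (DifferentiableOn.continuousOn hf).measurable_piecewise continuousOn_const
    measurableSet_ball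

/-- Integration of `|f|²` against a radial weight. -/
lemma lintegral_radial {f : Disc → ℂ} (hf : f ∈ Hol) {ρ : ℝ → ℝ≥0∞} (hρ : Measurable ρ) :
    ∫⁻ z : Disc, ‖f z‖ₑ ^ 2 * ρ ‖(z : ℂ)‖ ∂dA =
      ∑' n, ‖coeff f n‖ₑ ^ 2 *
        ∫⁻ r in Set.Ioo (0 : ℝ) 1, ENNReal.ofReal (2 * r ^ (2 * n + 1)) * ρ r := by
  have hπ0 : ENNReal.ofReal Real.pi ≠ 0 := by simp [Real.pi_pos]
  have hm : Measurable (ext f) := measurable_ext hf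
  set g : ℂ → ℝ≥0∞ := (ball (0 : ℂ) 1).indicator fun z => ‖ext f z‖ₑ ^ 2 * ρ ‖z‖ with hg
  have hgm : Measurable g :=
    ((hm.enorm.pow_const 2).mul (hρ.comp measurable_norm)).indicator measurableSet_ball
  have h1 : ∫⁻ z : Disc, ‖f z‖ₑ ^ 2 * ρ ‖(z : ℂ)‖ ∂dA =
      (ENNReal.ofReal Real.pi)⁻¹ * ∫⁻ z, g z := by
    rw [hg, lintegral_indicator measurableSet_ball, ← lintegral_dA]
    simp only [ext_coe]
  have h2 : ∫⁻ z, g z = ∫⁻ r in Set.Ioi (0 : ℝ), ∫⁻ θ in Set.Ioo (-Real.pi) Real.pi,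
      ENNReal.ofReal r * g (circleMap 0 r θ) := by
    rw [← Complex.lintegral_comp_polarCoord_symm, polarCoord_target, Measure.volume_eq_prod,
      setLIntegral_prod]
    · simp only [Complex.polarCoord_symm_apply, smul_eq_mul]
      refine lintegral_congr fun r => lintegral_congr fun θ => ?_
      rw [circleMap_zero, Complex.exp_mul_I, Complex.ofReal_cos, Complex.ofReal_sin]
    · refine Measurable.aemeasurable ?_
      simp only [Complex.polarCoord_symm_apply, smul_eq_mul]
      refine (ENNReal.measurable_ofReal.comp measurable_fst).mul (hgm.comp ?_)
      fun_prop
  -- The Jacobian `r` and the `r ^ (2 n)` of Parseval combine to `r ^ (2 n + 1)`. Of the factor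
  -- `2π`, the `2` stays in the moment and the `π` cancels against the normalization of `dA`.
  have h3 : ∫⁻ z, g z = ∫⁻ r in Set.Ioo (0 : ℝ) 1, ENNReal.ofReal Real.pi *
      ∑' n, ‖coeff f n‖ₑ ^ 2 * (ENNReal.ofReal (2 * r ^ (2 * n + 1)) * ρ r) := by
    rw [h2, ← lintegral_indicator measurableSet_Ioi, ← lintegral_indicator measurableSet_Ioo]
    refine lintegral_congr fun r => ?_
    by_cases hr : r ∈ Set.Ioo (0 : ℝ) 1
    · rw [Set.indicator_of_mem hr, Set.indicator_of_mem (show r ∈ Set.Ioi (0 : ℝ) from hr.1)]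
      have h4 : ∀ θ, g (circleMap 0 r θ) = ρ r * ‖ext f (circleMap 0 r θ)‖ₑ ^ 2 := by
        intro θ
        have hn : ‖circleMap 0 r θ‖ = r := by rw [norm_circleMap_zero, abs_of_pos hr.1]
        rw [hg, Set.indicator_of_mem, hn, mul_comm]
        rw [mem_ball_zero_iff, hn]
        exact hr.2
      simp_rw [h4, ← mul_assoc]
      rw [lintegral_const_mul _
        ((continuous_ext_circleMap hf hr.1.le hr.2).measurable.enorm.pow_const 2),
        lintegral_angle hf hr.1.le hr.2, ← ENNReal.tsum_mul_left, ← ENNReal.tsum_mul_left,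
        ← ENNReal.tsum_mul_left]
      refine tsum_congr fun n => ?_
      have e1 : ENNReal.ofReal (2 * Real.pi) = ENNReal.ofReal 2 * ENNReal.ofReal Real.pi :=
        ENNReal.ofReal_mul (by norm_num)
      have e2 : ENNReal.ofReal (2 * r ^ (2 * n + 1)) =
          ENNReal.ofReal 2 * (ENNReal.ofReal (r ^ (2 * n)) * ENNReal.ofReal r) := by
        rw [← ENNReal.ofReal_mul (by have := hr.1; positivity),
          ← ENNReal.ofReal_mul (by norm_num), pow_succ]
      rw [e1, e2]
      ring
    · rw [Set.indicator_of_notMem hr]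
      by_cases hr0 : r ∈ Set.Ioi (0 : ℝ)
      · rw [Set.indicator_of_mem hr0]
        have hr1 : 1 ≤ r := by
          by_contra h
          exact hr ⟨hr0, not_le.mp h⟩
        have h4 : ∀ θ, g (circleMap 0 r θ) = 0 := by
          intro θ
          rw [hg, Set.indicator_of_notMem]
          rw [mem_ball_zero_iff, norm_circleMap_zero]
          exact not_lt.mpr (hr1.trans (le_abs_self r))
        simp [h4]
      · rw [Set.indicator_of_notMem hr0]
  have hmn : ∀ n, Measurable fun r : ℝ => ENNReal.ofReal (2 * r ^ (2 * n + 1)) * ρ r := fun n =>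
    (ENNReal.measurable_ofReal.comp (by fun_prop)).mul hρ
  rw [h1, h3, lintegral_const_mul _ (Measurable.tsum fun n => (hmn n).const_mul _),
    ← mul_assoc, ENNReal.inv_mul_cancel hπ0 ENNReal.ofReal_ne_top, one_mul,
    lintegral_tsum fun n => ((hmn n).const_mul _).aemeasurable]
  exact tsum_congr fun n => lintegral_const_mul _ (hmn n)

/-! ### Moments of radial weights -/

/-- A nonnegative derivative of a function continuous on the closed interval is integrable, so no
integrability has to be checked. In `moment_log` the primitive is written with `r * log r` to make
its continuity at `0` visible. -/
lemma lintegral_Ioo_of_hasDerivAt {F g : ℝ → ℝ} (hc : ContinuousOn F (Set.Icc 0 1))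
    (hd : ∀ r ∈ Set.Ioo (0 : ℝ) 1, HasDerivAt F (g r) r)
    (hg : ∀ r ∈ Set.Ioo (0 : ℝ) 1, 0 ≤ g r) :
    ∫⁻ r in Set.Ioo (0 : ℝ) 1, ENNReal.ofReal (g r) = ENNReal.ofReal (F 1 - F 0) := by
  have hi : IntegrableOn g (Set.Ioc 0 1) :=
    intervalIntegral.integrableOn_deriv_of_nonneg hc hd hg
  have h1 := intervalIntegral.integral_eq_sub_of_hasDerivAt_of_le zero_le_one hc hd
    ((intervalIntegrable_iff_integrableOn_Ioc_of_le zero_le_one).mpr hi)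
  rw [← h1, intervalIntegral.integral_of_le zero_le_one, integral_Ioc_eq_integral_Ioo,
    ofReal_integral_eq_lintegral_ofReal (hi.mono_set Set.Ioo_subset_Ioc_self)]
  exact (ae_restrict_iff' measurableSet_Ioo).mpr (Eventually.of_forall hg)

lemma moment_one_sub_sq (n : ℕ) :
    ∫⁻ r in Set.Ioo (0 : ℝ) 1, ENNReal.ofReal (2 * r ^ (2 * n + 1)) * ENNReal.ofReal (1 - r ^ 2) =
      ENNReal.ofReal (1 / ((n + 1) * (n + 2))) := by
  have h1 : (n : ℝ) + 1 ≠ 0 := by positivity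
  have h2 : (n : ℝ) + 2 ≠ 0 := by positivity
  have h := lintegral_Ioo_of_hasDerivAt
    (F := fun r => r ^ (2 * n + 2) / (n + 1) - r ^ (2 * n + 4) / (n + 2))
    (g := fun r => 2 * r ^ (2 * n + 1) * (1 - r ^ 2)) (by fun_prop) ?_ ?_
  · rw [setLIntegral_congr_fun measurableSet_Ioo (fun r hr => ?_), h]
    · congr 1
      simp
      field_simp
      ring
    · exact (ENNReal.ofReal_mul (mul_nonneg zero_le_two (pow_nonneg hr.1.le _))).symm
  · intro r hr
    have := ((hasDerivAt_pow (2 * n + 2) r).div_const ((n : ℝ) + 1)).sub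
      ((hasDerivAt_pow (2 * n + 4) r).div_const ((n : ℝ) + 2))
    refine this.congr_deriv ?_
    simp only [show 2 * n + 2 - 1 = 2 * n + 1 by omega, show 2 * n + 4 - 1 = 2 * n + 3 by omega]
    push_cast
    field_simp
    ring
  · intro r hr
    have := hr.1
    have : 0 ≤ 1 - r ^ 2 := by nlinarith [hr.1, hr.2]
    positivity

/-- The weight `(1 - |z|²)³` is, up to a constant, the lower bound of `(1 - |z|²)² / V_μ` in
`le_weightE`. -/
lemma moment_one_sub_sq_cube (n : ℕ) :
    ∫⁻ r in Set.Ioo (0 : ℝ) 1,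
        ENNReal.ofReal (2 * r ^ (2 * n + 1)) * ENNReal.ofReal ((1 - r ^ 2) ^ 3) =
      ENNReal.ofReal (6 / ((n + 1) * (n + 2) * (n + 3) * (n + 4))) := by
  have h1 : (n : ℝ) + 1 ≠ 0 := by positivity
  have h2 : (n : ℝ) + 2 ≠ 0 := by positivity
  have h3 : (n : ℝ) + 3 ≠ 0 := by positivity
  have h4 : (n : ℝ) + 4 ≠ 0 := by positivity
  have h := lintegral_Ioo_of_hasDerivAt
    (F := fun r => r ^ (2 * n + 2) / (n + 1) - 3 * (r ^ (2 * n + 4) / (n + 2))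
      + 3 * (r ^ (2 * n + 6) / (n + 3)) - r ^ (2 * n + 8) / (n + 4))
    (g := fun r => 2 * r ^ (2 * n + 1) * (1 - r ^ 2) ^ 3) (by fun_prop) ?_ ?_
  · rw [setLIntegral_congr_fun measurableSet_Ioo (fun r hr => ?_), h]
    · congr 1
      simp
      field_simp
      ring
    · exact (ENNReal.ofReal_mul (mul_nonneg zero_le_two (pow_nonneg hr.1.le _))).symm
  · intro r hr
    have := ((((hasDerivAt_pow (2 * n + 2) r).div_const ((n : ℝ) + 1)).sub
      (((hasDerivAt_pow (2 * n + 4) r).div_const ((n : ℝ) + 2)).const_mul 3)).add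
      (((hasDerivAt_pow (2 * n + 6) r).div_const ((n : ℝ) + 3)).const_mul 3)).sub
      ((hasDerivAt_pow (2 * n + 8) r).div_const ((n : ℝ) + 4))
    refine this.congr_deriv ?_
    simp only [show 2 * n + 2 - 1 = 2 * n + 1 by omega, show 2 * n + 4 - 1 = 2 * n + 3 by omega,
      show 2 * n + 6 - 1 = 2 * n + 5 by omega, show 2 * n + 8 - 1 = 2 * n + 7 by omega]
    push_cast
    field_simp
    ring
  · intro r hr
    have := hr.1
    have : 0 ≤ 1 - r ^ 2 := by nlinarith [hr.1, hr.2]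
    positivity

/-- This moment cancels the factor `(n + 1)²` of the squared coefficients of a derivative exactly,
which is the Littlewood–Paley identity at the origin. -/
lemma moment_log (n : ℕ) :
    ∫⁻ r in Set.Ioo (0 : ℝ) 1,
        ENNReal.ofReal (2 * r ^ (2 * n + 1)) * ENNReal.ofReal (Real.log ((r ^ 2)⁻¹)) =
      ENNReal.ofReal (1 / (n + 1) ^ 2) := by
  have h1 : (n : ℝ) + 1 ≠ 0 := by positivity
  have h := lintegral_Ioo_of_hasDerivAt
    (F := fun r => r ^ (2 * n + 2) / (n + 1) ^ 2 -
      2 * r ^ (2 * n + 1) * (r * Real.log r) / (n + 1))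
    (g := fun r => 2 * r ^ (2 * n + 1) * Real.log ((r ^ 2)⁻¹))
    (by have := Real.continuous_mul_log; fun_prop) ?_ ?_
  · rw [setLIntegral_congr_fun measurableSet_Ioo (fun r hr => ?_), h]
    · congr 1
      simp
    · exact (ENNReal.ofReal_mul (mul_nonneg zero_le_two (pow_nonneg hr.1.le _))).symm
  · intro r hr
    have hr0 : r ≠ 0 := hr.1.ne'
    have := ((hasDerivAt_pow (2 * n + 2) r).div_const (((n : ℝ) + 1) ^ 2)).sub
      ((((hasDerivAt_pow (2 * n + 1) r).const_mul 2).mul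
        (Real.hasDerivAt_mul_log hr0)).div_const ((n : ℝ) + 1))
    refine this.congr_deriv ?_
    simp only [show 2 * n + 2 - 1 = 2 * n + 1 by omega, show 2 * n + 1 - 1 = 2 * n by omega,
      Real.log_inv, Real.log_pow]
    push_cast
    field_simp
    ring
  · intro r hr
    have := hr.1
    have : 0 ≤ Real.log ((r ^ 2)⁻¹) := by
      refine Real.log_nonneg ((one_le_inv₀ (by positivity)).mpr ?_)
      nlinarith [hr.1, hr.2]
    positivity

/-! ### An isometry between weighted sequence spaces -/

lemma sum_Ico_sub_succ {G : Type*} [AddCommGroup G] (f : ℕ → G) {m n : ℕ} (h : m ≤ n) :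
    ∑ k ∈ Finset.Ico m n, (f k - f (k + 1)) = f m - f n := by
  rw [← neg_sub (f n), ← Finset.sum_Ico_sub f h, ← Finset.sum_neg_distrib]
  exact Finset.sum_congr rfl fun k _ => (neg_sub _ _).symm

/-- If `F` is recovered from its Cesàro means `S`, and `S` tends to `0`, the `ℓ²` norm of `F` is a
weighted `ℓ²` norm of the differences of `S`. -/
lemma sqsum_eq_of_cesaro {S F : ℕ → ℂ} (hS : Tendsto S atTop (𝓝 0)) (h0 : F 0 = S 0)
    (h : ∀ n, F (n + 1) = (n + 2) * S (n + 1) - (n + 1) * S n) :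
    sqsum F = ∑' n, ENNReal.ofReal ((n + 1) * (n + 2) * ‖S n - S (n + 1)‖ ^ 2) := by
  set x : ℕ → ℝ := fun n => (n + 1) * (n + 2) * ‖S n - S (n + 1)‖ ^ 2 with hx
  have hx0 : ∀ n, 0 ≤ x n := fun n => by positivity
  -- An algebraic identity whose last two terms telescope; summed up, it leaves the single boundary
  -- term `(N + 1) ‖S N‖²`.
  have step : ∀ N : ℕ, ‖F (N + 1)‖ ^ 2 =
      x N + (N + 2) * ‖S (N + 1)‖ ^ 2 - (N + 1) * ‖S N‖ ^ 2 := by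
    intro N
    rw [h]
    simp only [hx, ← Complex.normSq_eq_norm_sq, Complex.normSq_apply, Complex.sub_re,
      Complex.sub_im, Complex.mul_re, Complex.mul_im, Complex.add_re, Complex.add_im,
      Complex.natCast_re, Complex.natCast_im, Complex.re_ofNat, Complex.im_ofNat, Complex.one_re,
      Complex.one_im]
    ring
  have partials : ∀ N : ℕ, ∑ n ∈ Finset.range (N + 1), ‖F n‖ ^ 2 =
      ∑ n ∈ Finset.range N, x n + (N + 1) * ‖S N‖ ^ 2 := by
    intro N
    induction N with
    | zero => simp [h0]
    | succ N ih =>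
      rw [Finset.sum_range_succ, ih, step, Finset.sum_range_succ]
      push_cast
      ring
  have hF : ∀ N, ∑ n ∈ Finset.range N, ‖F n‖ₑ ^ 2 =
      ENNReal.ofReal (∑ n ∈ Finset.range N, ‖F n‖ ^ 2) := fun N => by
    rw [ENNReal.ofReal_sum_of_nonneg fun n _ => sq_nonneg _]
    exact Finset.sum_congr rfl fun n _ => enorm_sq_eq_ofReal _
  have hxs : ∀ N, ∑ n ∈ Finset.range N, ENNReal.ofReal (x n) =
      ENNReal.ofReal (∑ n ∈ Finset.range N, x n) := fun N =>
    (ENNReal.ofReal_sum_of_nonneg fun n _ => hx0 n).symm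
  refine le_antisymm ?_ ?_
  · by_cases htop : ∑' n, ENNReal.ofReal (x n) = ∞
    · rw [htop]
      exact le_top
    have hsum : Summable x := by
      refine (ENNReal.summable_toReal htop).congr fun n => ?_
      rw [ENNReal.toReal_ofReal (hx0 n)]
    rw [← ENNReal.ofReal_tsum_of_nonneg hx0 hsum]
    refine ENNReal.tsum_le_of_sum_range_le fun N => ?_
    rw [hF]
    refine ENNReal.ofReal_le_ofReal ?_
    refine (Finset.sum_le_sum_of_subset_of_nonneg (Finset.range_mono N.le_succ)
      fun n _ _ => sq_nonneg _).trans ?_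
    rw [partials]
    -- Cauchy–Schwarz with weights `1 / ((k + 1)(k + 2))`, whose tail sums are at most `1 / (N +
    -- 1)`. Letting `M → ∞`, where `S M → 0`, bounds the boundary term by the tail of the series.
    have tail : ∀ M, N ≤ M → (N + 1) * ‖S N - S M‖ ^ 2 ≤
        ∑' n, x n - ∑ n ∈ Finset.range N, x n := by
      intro M hM
      have h1 : ‖S N - S M‖ ≤ ∑ k ∈ Finset.Ico N M, ‖S k - S (k + 1)‖ := by
        rw [← sum_Ico_sub_succ S hM]
        exact norm_sum_le _ _
      have h2 : ∑ k ∈ Finset.Ico N M, (1 / ((k + 1) * (k + 2)) : ℝ) ≤ 1 / (N + 1) := by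
        have h3 : ∀ k : ℕ, (1 / ((k + 1) * (k + 2)) : ℝ) = 1 / (k + 1) - 1 / ((k + 1 : ℕ) + 1) := by
          intro k
          push_cast
          field_simp
          ring
        simp_rw [h3]
        rw [sum_Ico_sub_succ (fun k : ℕ => (1 / ((k : ℝ) + 1))) hM]
        have : (0 : ℝ) ≤ 1 / (M + 1) := by positivity
        linarith
      have h4 : (∑ k ∈ Finset.Ico N M, ‖S k - S (k + 1)‖) ^ 2 ≤
          (∑ k ∈ Finset.Ico N M, (1 / ((k + 1) * (k + 2)) : ℝ)) * ∑ k ∈ Finset.Ico N M, x k := by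
        refine Finset.sum_sq_le_sum_mul_sum_of_sq_le_mul _ (fun k _ => by positivity)
          (fun k _ => hx0 k) fun k _ => ?_
        simp only [hx]
        refine le_of_eq ?_
        field_simp
      have h5 : ∑ k ∈ Finset.Ico N M, x k ≤ ∑' n, x n - ∑ n ∈ Finset.range N, x n := by
        rw [Finset.sum_Ico_eq_sub _ hM]
        exact sub_le_sub_right (hsum.sum_le_tsum _ fun n _ => hx0 n) _
      have h6 : 0 ≤ ∑ k ∈ Finset.Ico N M, x k := Finset.sum_nonneg fun k _ => hx0 k
      have h7 : ‖S N - S M‖ ^ 2 ≤ 1 / (N + 1) * ∑ k ∈ Finset.Ico N M, x k :=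
        (pow_le_pow_left₀ (norm_nonneg _) h1 2).trans
          (h4.trans (mul_le_mul_of_nonneg_right h2 h6))
      have h8 : (0 : ℝ) < N + 1 := by positivity
      have h9 := mul_le_mul_of_nonneg_left h7 h8.le
      rw [← mul_assoc, mul_one_div_cancel h8.ne', one_mul] at h9
      exact h9.trans h5
    have hlim : Tendsto (fun M => ((N : ℝ) + 1) * ‖S N - S M‖ ^ 2) atTop
        (𝓝 ((N + 1) * ‖S N - 0‖ ^ 2)) :=
      ((tendsto_const_nhds.sub hS).norm.pow 2).const_mul _
    have := le_of_tendsto hlim (eventually_atTop.mpr ⟨N, tail⟩)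
    rw [sub_zero] at this
    linarith
  · refine ENNReal.tsum_le_of_sum_range_le fun N => ?_
    rw [hxs]
    refine le_trans (ENNReal.ofReal_le_ofReal ?_) ((hF (N + 1)).symm.le.trans
      (ENNReal.sum_le_tsum _))
    rw [partials]
    have : 0 ≤ (N + 1) * ‖S N‖ ^ 2 := by positivity
    linarith

/-- This is the local identity at the boundary point `1`. The inner sum is the `n`-th coefficient of
`f' / (1 - z)` when `f' = ∑ (j + 1) b_j z^j`; summation by parts turns it into `(n + 1)(n + 2)(S n -
S (n + 1))` with `S` the Cesàro means of `F`. -/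
lemma sqsum_eq_of_differences {F b : ℕ → ℂ} (hF : sqsum F < ∞) (hb : ∀ n, b n = F n - F (n + 1)) :
    sqsum F = ∑' n : ℕ, ‖∑ j ∈ Finset.range (n + 1), (j + 1) * b j‖ₑ ^ 2 *
      ENNReal.ofReal (1 / ((n + 1) * (n + 2))) := by
  set S : ℕ → ℂ := fun n => (∑ k ∈ Finset.range (n + 1), F k) / (n + 1) with hSdef
  have hn : ∀ n : ℕ, (n + 1 : ℂ) ≠ 0 := fun n => by exact_mod_cast n.succ_ne_zero
  have hn2 : ∀ n : ℕ, (n + 2 : ℂ) ≠ 0 := fun n => by exact_mod_cast (n + 1).succ_ne_zero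
  have hF0 : Tendsto F atTop (𝓝 0) := by
    have h1 := (sqsum_lt_top_iff.mp hF).tendsto_atTop_zero.sqrt
    simp only [Real.sqrt_sq (norm_nonneg _), Real.sqrt_zero] at h1
    exact tendsto_zero_iff_norm_tendsto_zero.mpr h1
  have hS : Tendsto S atTop (𝓝 0) := by
    have h1 := (hF0.cesaro_smul).comp (tendsto_add_atTop_nat 1)
    refine h1.congr fun n => ?_
    simp only [Function.comp_apply, hSdef, Complex.real_smul]
    push_cast
    rw [div_eq_inv_mul]
  have hg : ∀ n : ℕ, ∑ j ∈ Finset.range (n + 1), (j + 1) * b j =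
      (n + 1) * (n + 2) * (S n - S (n + 1)) := by
    intro n
    have h1 : ∑ j ∈ Finset.range (n + 1), (j + 1) * b j =
        ∑ k ∈ Finset.range (n + 1), F k - (n + 1) * F (n + 1) := by
      induction n with
      | zero => simp [hb]
      | succ n ih =>
        rw [Finset.sum_range_succ, ih, Finset.sum_range_succ _ (n + 1), hb]
        push_cast
        ring
    rw [h1]
    simp only [hSdef]
    rw [Finset.sum_range_succ _ (n + 1)]
    have := hn n
    have := hn2 n
    push_cast
    rw [show (n : ℂ) + 1 + 1 = n + 2 by ring]
    field_simp
    ring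
  rw [sqsum_eq_of_cesaro hS]
  · refine tsum_congr fun n => ?_
    rw [hg, enorm_sq_eq_ofReal, ← ENNReal.ofReal_mul (sq_nonneg _)]
    congr 1
    have e : ‖(n + 1 : ℂ) * (n + 2)‖ = (n + 1) * (n + 2) := by
      rw [show (n + 1 : ℂ) * (n + 2) = (((n + 1) * (n + 2) : ℝ) : ℂ) by push_cast; ring,
        Complex.norm_real, Real.norm_eq_abs, abs_of_nonneg (by positivity)]
    rw [norm_mul, e]
    field_simp
  · simp [hSdef]
  · intro n
    simp only [hSdef]
    rw [Finset.sum_range_succ _ (n + 1)]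
    have := hn n
    have := hn2 n
    push_cast
    rw [show (n : ℂ) + 1 + 1 = n + 2 by ring]
    field_simp
    ring

/-- Reverses the previous computation: the differences of the Cesàro means are prescribed, they are
summable by Cauchy–Schwarz, and `S` is recovered from its tails because it has to tend to `0`. -/
lemma exists_differences {b : ℕ → ℂ}
    (h : ∑' n : ℕ, ‖∑ j ∈ Finset.range (n + 1), (j + 1) * b j‖ₑ ^ 2 *
      ENNReal.ofReal (1 / ((n + 1) * (n + 2))) < ∞) :
    ∃ F : ℕ → ℂ, sqsum F < ∞ ∧ ∀ n, b n = F n - F (n + 1) := by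
  set g : ℕ → ℂ := fun n => ∑ j ∈ Finset.range (n + 1), (j + 1) * b j with hg
  have hn : ∀ n : ℕ, (n + 1 : ℂ) ≠ 0 := fun n => by exact_mod_cast n.succ_ne_zero
  have hn2 : ∀ n : ℕ, (n + 2 : ℂ) ≠ 0 := fun n => by exact_mod_cast (n + 1).succ_ne_zero
  set q : ℕ → ℂ := fun n => g n / ((n + 1) * (n + 2)) with hq
  have hnorm : ∀ n : ℕ, ‖(n + 1 : ℂ) * (n + 2)‖ = (n + 1) * (n + 2) := fun n => by
    rw [show (n + 1 : ℂ) * (n + 2) = (((n + 1) * (n + 2) : ℝ) : ℂ) by push_cast; ring,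
      Complex.norm_real, Real.norm_eq_abs, abs_of_nonneg (by positivity)]
  have hs1 : Summable fun n : ℕ => ‖g n‖ ^ 2 * (1 / ((n + 1) * (n + 2))) := by
    refine (ENNReal.summable_toReal h.ne).congr fun n => ?_
    rw [enorm_sq_eq_ofReal, ← ENNReal.ofReal_mul (sq_nonneg _), ENNReal.toReal_ofReal]
    positivity
  have hs2 : Summable fun n : ℕ => (1 / ((n + 1) * (n + 2)) : ℝ) := by
    have h1 := (summable_nat_add_iff 1).mpr (Real.summable_one_div_nat_pow.mpr (one_lt_two))
    refine Summable.of_nonneg_of_le (fun n => by positivity) (fun n => ?_) h1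
    refine one_div_le_one_div_of_le (by positivity) ?_
    push_cast
    nlinarith [(Nat.cast_nonneg n : (0 : ℝ) ≤ n)]
  have hqs : Summable q := by
    refine Summable.of_norm_bounded (hs1.add hs2) fun n => ?_
    rw [hq, norm_div, hnorm]
    have h1 : (0 : ℝ) < 1 / ((n + 1) * (n + 2)) := by positivity
    have h2 : ‖g n‖ ≤ ‖g n‖ ^ 2 + 1 := by nlinarith [sq_nonneg (‖g n‖ - 1), norm_nonneg (g n)]
    rw [div_eq_mul_one_div]
    nlinarith [mul_le_mul_of_nonneg_right h2 h1.le]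
  set S : ℕ → ℂ := fun n => ∑' k, q (k + n) with hSd
  have hS : Tendsto S atTop (𝓝 0) := tendsto_sum_nat_add q
  have hSq : ∀ n, S n - S (n + 1) = q n := by
    intro n
    have h1 := ((summable_nat_add_iff n).mpr hqs).tsum_eq_zero_add
    simp only [zero_add] at h1
    have h2 : S (n + 1) = ∑' k, q (k + 1 + n) := tsum_congr fun k => by
      rw [show k + (n + 1) = k + 1 + n by ring]
    rw [h2, hSd]
    simp only [h1]
    ring
  -- The sequence whose Cesàro means are `S`.
  set F : ℕ → ℂ := fun n => Nat.casesOn n (S 0) fun n => (n + 2) * S (n + 1) - (n + 1) * S n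
    with hF
  refine ⟨F, ?_, ?_⟩
  · rw [sqsum_eq_of_cesaro (F := F) hS rfl fun n => rfl]
    refine lt_of_le_of_lt (le_of_eq ?_) h
    refine tsum_congr fun n => ?_
    rw [hSq, enorm_sq_eq_ofReal, ← ENNReal.ofReal_mul (sq_nonneg _), hq, norm_div, hnorm]
    congr 1
    field_simp
    rfl
  · have hgq : ∀ n : ℕ, g n = (n + 1) * (n + 2) * (S n - S (n + 1)) := fun n => by
      rw [hSq, hq, mul_div_cancel₀ _ (mul_ne_zero (hn n) (hn2 n))]
    intro n
    cases n with
    | zero =>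
      have h1 := hgq 0
      simp [hg] at h1
      rw [h1]
      simp [hF]
      ring
    | succ n =>
      have h1 : g (n + 1) = g n + (n + 2) * b (n + 1) := by
        simp only [hg]
        rw [Finset.sum_range_succ _ (n + 1)]
        push_cast
        ring
      rw [hgq, hgq] at h1
      have h2 := hn2 n
      refine mul_left_cancel₀ h2 ?_
      simp only [hF]
      push_cast at h1 ⊢
      linear_combination -h1

/-! ### The local Dirichlet integral at a boundary point -/

/-- The function `1 / (1 - conj w z)` for an arbitrary `w` in the plane. -/
noncomputable def cauchyKer (w : ℂ) (z : Disc) : ℂ := 1 / (1 - conj w * (z : ℂ))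

lemma hasSum_cauchyKer {w : ℂ} (hw : ‖w‖ ≤ 1) (z : Disc) :
    HasSum (fun n => conj w ^ n * (z : ℂ) ^ n) (cauchyKer w z) := by
  have : ‖conj w * (z : ℂ)‖ < 1 := by
    rw [norm_mul, RCLike.norm_conj]
    exact lt_of_le_of_lt (mul_le_of_le_one_left (norm_nonneg _) hw) z.norm_lt_one
  simpa only [mul_pow, cauchyKer, one_div] using hasSum_geometric_of_norm_lt_one this

lemma cauchyKer_mem_hol {w : ℂ} (hw : ‖w‖ ≤ 1) : cauchyKer w ∈ Hol :=
  hol_of_hasSum (hasSum_cauchyKer hw)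

lemma coeff_cauchyKer {w : ℂ} (hw : ‖w‖ ≤ 1) : coeff (cauchyKer w) = fun n => conj w ^ n :=
  coeff_of_hasSum (hasSum_cauchyKer hw)

lemma ClosedDisc.norm_le_one (w : ClosedDisc) : ‖(w : ℂ)‖ ≤ 1 := mem_closedBall_zero_iff.mp w.2

lemma poisson_eq (z : Disc) (w : ClosedDisc) :
    poisson z w = ‖cauchyKer w z‖ ^ 2 * (1 - ‖(z : ℂ)‖ ^ 2) := by
  rw [poisson, cauchyKer, norm_div, norm_one, div_pow, one_pow]
  ring

/-- Parseval's identity for the weight `1 - |z|²`. -/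
lemma lintegral_one_sub_sq {f : Disc → ℂ} (hf : f ∈ Hol) :
    ∫⁻ z : Disc, ‖f z‖ₑ ^ 2 * ENNReal.ofReal (1 - ‖(z : ℂ)‖ ^ 2) ∂dA =
      ∑' n : ℕ, ‖coeff f n‖ₑ ^ 2 * ENNReal.ofReal (1 / ((n + 1) * (n + 2))) := by
  rw [lintegral_radial hf (ρ := fun r => ENNReal.ofReal (1 - r ^ 2)) (by fun_prop)]
  exact tsum_congr fun n => by rw [moment_one_sub_sq]

/-- The Poisson kernel is `|1 - conj w z|⁻² (1 - |z|²)`, so the integral is a weighted Bergman norm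
of `f' / (1 - conj w z)`, read off from Taylor coefficients. -/
lemma lintegral_poisson_boundary {f : Disc → ℂ} (hf : f ∈ Hol) {w : ClosedDisc}
    (hw : ‖(w : ℂ)‖ = 1) :
    ∫⁻ z : Disc, ‖cderiv f z‖ₑ ^ 2 * ENNReal.ofReal (poisson z w) ∂dA =
      ∑' n : ℕ, ‖∑ j ∈ Finset.range (n + 1), (j + 1) * ((w : ℂ) ^ j * coeff f (j + 1))‖ₑ ^ 2 *
        ENNReal.ofReal (1 / ((n + 1) * (n + 2))) := by
  have hf' := cderiv_mem_hol hf
  have hk := cauchyKer_mem_hol w.norm_le_one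
  have h1 : ∀ z : Disc, ‖cderiv f z‖ₑ ^ 2 * ENNReal.ofReal (poisson z w) =
      ‖(cderiv f * cauchyKer w) z‖ₑ ^ 2 * ENNReal.ofReal (1 - ‖(z : ℂ)‖ ^ 2) := by
    intro z
    rw [poisson_eq, ENNReal.ofReal_mul (sq_nonneg _), ← enorm_sq_eq_ofReal, Pi.mul_apply,
      enorm_mul, mul_pow, mul_assoc]
  simp_rw [h1]
  rw [lintegral_one_sub_sq (mul_mem_hol hf' hk)]
  refine tsum_congr fun n => ?_
  congr 2
  rw [coeff_mul hf' hk, Finset.Nat.sum_antidiagonal_eq_sum_range_succ_mk, coeff_cauchyKer w.norm_le_one]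
  have h2 : (w : ℂ) * conj (w : ℂ) = 1 := by
    rw [Complex.mul_conj, Complex.normSq_eq_norm_sq, hw]
    simp
  have h3 : ‖(w : ℂ) ^ n‖ₑ = 1 := by
    rw [← ofReal_norm, norm_pow, hw, one_pow, ENNReal.ofReal_one]
  -- Multiplying by the unimodular `w ^ n` turns `conj w ^ (n - j)` into `w ^ j`, which rotates the
  -- boundary point to `1`.
  rw [← one_mul ‖_‖ₑ, ← h3, ← enorm_mul, Finset.mul_sum]
  congr 1
  refine Finset.sum_congr rfl fun j hj => ?_
  have hj' : j ≤ n := Nat.lt_succ_iff.mp (Finset.mem_range.mp hj)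
  rw [coeff_cderiv]
  have h4 : (w : ℂ) ^ n * conj (w : ℂ) ^ (n - j) = (w : ℂ) ^ j := by
    rw [← Nat.sub_add_cancel hj', pow_add, Nat.sub_add_cancel hj', mul_right_comm, ← mul_pow, h2,
      one_pow, one_mul]
  rw [← h4]
  ring

lemma sqsum_twist {w : ℂ} (hw : ‖w‖ = 1) (F : ℕ → ℂ) : sqsum (fun n => w ^ n * F n) = sqsum F :=
  tsum_congr fun n => by
    rw [enorm_mul, ← ofReal_norm (w ^ n), norm_pow, hw, one_pow, ENNReal.ofReal_one, one_mul]

lemma lintegral_poisson_boundary_eq {f : Disc → ℂ} (hf : f ∈ Hol) {w : ClosedDisc}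
    (hw : ‖(w : ℂ)‖ = 1) {F : ℕ → ℂ} (hF : sqsum F < ∞)
    (h : ∀ n, coeff f (n + 1) = F n - w * F (n + 1)) :
    ∫⁻ z : Disc, ‖cderiv f z‖ₑ ^ 2 * ENNReal.ofReal (poisson z w) ∂dA = sqsum F := by
  rw [lintegral_poisson_boundary hf hw, ← sqsum_twist hw F]
  refine (sqsum_eq_of_differences (by rwa [sqsum_twist hw]) fun n => ?_).symm
  rw [h]
  ring

/-- No boundary value `f(w)` is given in advance; finiteness of the integral is what makes the
quotient `(f - f(w)) / (z - w)` exist in `H²`. -/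
lemma exists_of_lintegral_poisson_boundary {f : Disc → ℂ} (hf : f ∈ Hol) {w : ClosedDisc}
    (hw : ‖(w : ℂ)‖ = 1)
    (h : ∫⁻ z : Disc, ‖cderiv f z‖ₑ ^ 2 * ENNReal.ofReal (poisson z w) ∂dA < ∞) :
    ∃ F : ℕ → ℂ, sqsum F < ∞ ∧ ∀ n, coeff f (n + 1) = F n - w * F (n + 1) := by
  rw [lintegral_poisson_boundary hf hw] at h
  obtain ⟨F, hF, hb⟩ := exists_differences h
  have hw' : ‖conj (w : ℂ)‖ = 1 := by rw [RCLike.norm_conj, hw]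
  have h2 : (w : ℂ) * conj (w : ℂ) = 1 := by
    rw [Complex.mul_conj, Complex.normSq_eq_norm_sq, hw]
    simp
  refine ⟨fun n => conj (w : ℂ) ^ n * F n, by rwa [sqsum_twist hw'], fun n => ?_⟩
  have h3 : conj (w : ℂ) ^ n * (w : ℂ) ^ n = 1 := by rw [← mul_pow, mul_comm, h2, one_pow]
  have h4 := congrArg (fun t => conj (w : ℂ) ^ n * t) (hb n)
  simp only [← mul_assoc, h3, one_mul] at h4
  rw [h4]
  simp only [pow_succ]
  linear_combination (conj (w : ℂ)) ^ n * F (n + 1) * h2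

/-! ### Lower semicontinuity of the `H²` norm -/

lemma sqsum_le_of_forall_lt {a : ℕ → ℂ} {C : ℝ≥0∞}
    (h : ∀ r : ℝ, 0 ≤ r → r < 1 → ∑' n, ‖a n‖ₑ ^ 2 * ENNReal.ofReal (r ^ (2 * n)) ≤ C) :
    sqsum a ≤ C := by
  refine ENNReal.tsum_le_of_sum_range_le fun N => ?_
  have h1 : Tendsto (fun r : ℝ => ∑ n ∈ Finset.range N, ‖a n‖ₑ ^ 2 * ENNReal.ofReal (r ^ (2 * n)))
      (𝓝[<] 1) (𝓝 (∑ n ∈ Finset.range N, ‖a n‖ₑ ^ 2 * ENNReal.ofReal (1 ^ (2 * n)))) := by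
    refine tendsto_finsetSum _ fun n _ => ?_
    refine ENNReal.Tendsto.const_mul ?_ (Or.inr (by simp))
    refine ENNReal.tendsto_ofReal (Tendsto.mono_left ?_ nhdsWithin_le_nhds)
    exact (continuous_pow (2 * n)).tendsto 1
  simp only [one_pow, ENNReal.ofReal_one, mul_one] at h1
  refine le_of_tendsto h1 ?_
  have : Set.Ioo (0 : ℝ) 1 ∈ 𝓝[<] (1 : ℝ) := Ioo_mem_nhdsLT one_pos
  filter_upwards [this] with r hr
  exact (ENNReal.sum_le_tsum _).trans (h r hr.1.le hr.2)

/-- Pointwise limits of holomorphic functions do not increase the `H²` norm. -/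
lemma sqsum_le_of_tendsto {f : ℕ → Disc → ℂ} {g : Disc → ℂ} (hf : ∀ k, f k ∈ Hol) (hg : g ∈ Hol)
    (hlim : ∀ z, Tendsto (fun k => f k z) atTop (𝓝 (g z))) {C : ℝ≥0∞}
    (hC : ∀ᶠ k in atTop, sqsum (coeff (f k)) ≤ C) : sqsum (coeff g) ≤ C := by
  refine sqsum_le_of_forall_lt fun r hr hr1 => ?_
  have hπ0 : ENNReal.ofReal (2 * Real.pi) ≠ 0 := by simp [Real.pi_pos]
  have hball : ∀ θ, circleMap 0 r θ ∈ ball (0 : ℂ) 1 := fun θ => by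
    rw [mem_ball_zero_iff, norm_circleMap_zero, abs_of_nonneg hr]
    exact hr1
  rw [← ENNReal.mul_le_mul_iff_right hπ0 ENNReal.ofReal_ne_top, ← lintegral_angle hg hr hr1]
  -- Fatou's lemma on each circle of radius `r < 1`, so pointwise convergence in the open disc
  -- suffices.
  have h1 : ∀ θ, ‖ext g (circleMap 0 r θ)‖ₑ ^ 2 =
      liminf (fun k => ‖ext (f k) (circleMap 0 r θ)‖ₑ ^ 2) atTop := by
    intro θ
    have h2 := hlim ⟨_, hball θ⟩
    simp only [← ext_coe] at h2
    exact (((ENNReal.continuous_pow 2).tendsto _).comp h2.enorm).liminf_eq.symm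
  simp_rw [h1]
  refine (lintegral_liminf_le fun k =>
    (continuous_ext_circleMap (hf k) hr hr1).measurable.enorm.pow_const 2).trans ?_
  refine liminf_le_of_frequently_le' (Eventually.frequently ?_)
  filter_upwards [hC] with k hk
  rw [lintegral_angle (hf k) hr hr1]
  refine mul_le_mul_right ?_ _
  refine le_trans (ENNReal.tsum_le_tsum fun n => ?_) hk
  refine mul_le_of_le_one_right' ?_
  rw [← ENNReal.ofReal_one]
  exact ENNReal.ofReal_le_ofReal (pow_le_one₀ hr hr1.le)

/-! ### Möbius transformations -/

lemma one_sub_conj_mul_ne_zero (w : Disc) {z : ℂ} (hz : ‖z‖ ≤ 1) : 1 - conj (w : ℂ) * z ≠ 0 := by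
  intro h
  have h1 : conj (w : ℂ) * z = 1 := (sub_eq_zero.mp h).symm
  have h2 : ‖(w : ℂ)‖ * ‖z‖ = 1 := by rw [← RCLike.norm_conj, ← norm_mul, h1, norm_one]
  nlinarith [w.norm_lt_one, norm_nonneg (w : ℂ), norm_nonneg z]

/-- The identity behind the Möbius invariance of the disc, the comparison of Green and Poisson
kernels and the Carleson estimate. -/
lemma norm_one_sub_conj_mul_sq (w z : ℂ) :
    ‖1 - conj w * z‖ ^ 2 - ‖w - z‖ ^ 2 = (1 - ‖w‖ ^ 2) * (1 - ‖z‖ ^ 2) := by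
  simp only [← Complex.normSq_eq_norm_sq, Complex.normSq_apply, Complex.sub_re, Complex.sub_im,
    Complex.mul_re, Complex.mul_im, Complex.one_re, Complex.one_im, Complex.conj_re,
    Complex.conj_im]
  ring

/-- The involutive Möbius transformation `z ↦ (w - z) / (1 - conj w z)`, on the plane. -/
noncomputable def mobC (w : Disc) (z : ℂ) : ℂ := (w - z) / (1 - conj (w : ℂ) * z)

lemma norm_mobC_sq (w : Disc) {z : ℂ} (hz : ‖z‖ ≤ 1) :
    1 - ‖mobC w z‖ ^ 2 = (1 - ‖(w : ℂ)‖ ^ 2) * (1 - ‖z‖ ^ 2) / ‖1 - conj (w : ℂ) * z‖ ^ 2 := by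
  have h := one_sub_conj_mul_ne_zero w hz
  rw [mobC, norm_div, div_pow, ← norm_one_sub_conj_mul_sq]
  have : ‖1 - conj (w : ℂ) * z‖ ^ 2 ≠ 0 := pow_ne_zero 2 (norm_ne_zero_iff.mpr h)
  rw [sub_div, div_self this]

lemma norm_mobC_lt_one (w : Disc) {z : ℂ} (hz : ‖z‖ < 1) : ‖mobC w z‖ < 1 := by
  have h := norm_mobC_sq w hz.le
  have h1 : 0 < ‖1 - conj (w : ℂ) * z‖ := norm_pos_iff.mpr (one_sub_conj_mul_ne_zero w hz.le)
  have h2 : 0 < 1 - ‖z‖ ^ 2 := by nlinarith [norm_nonneg z]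
  have h3 : 0 < 1 - ‖mobC w z‖ ^ 2 := by
    rw [h]
    have := one_sub_pos w
    positivity
  nlinarith [norm_nonneg (mobC w z)]

lemma norm_mobC_eq_one (w : Disc) {z : ℂ} (hz : ‖z‖ = 1) : ‖mobC w z‖ = 1 := by
  have h := norm_mobC_sq w hz.le
  rw [hz] at h
  simp only [one_pow, sub_self, mul_zero, zero_div] at h
  have h2 : ‖mobC w z‖ ^ 2 = 1 := by linarith
  nlinarith [norm_nonneg (mobC w z)]

/-- The involutive Möbius transformation of the disc. -/
noncomputable def mob (w z : Disc) : Disc :=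
  ⟨mobC w z, mem_ball_zero_iff.mpr (norm_mobC_lt_one w z.norm_lt_one)⟩

lemma mob_coe (w z : Disc) : (mob w z : ℂ) = mobC w z := rfl

lemma ofReal_one_sub_norm_sq (w : ℂ) : ((1 - ‖w‖ ^ 2 : ℝ) : ℂ) = 1 - conj w * w := by
  rw [Complex.conj_mul']
  push_cast
  rfl

lemma one_sub_conj_mul_mobC (w : Disc) {z : ℂ} (hz : ‖z‖ ≤ 1) :
    1 - conj (w : ℂ) * mobC w z = ((1 - ‖(w : ℂ)‖ ^ 2 : ℝ) : ℂ) / (1 - conj (w : ℂ) * z) := by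
  have h := one_sub_conj_mul_ne_zero w hz
  have h' := h
  rw [mul_comm] at h'
  rw [ofReal_one_sub_norm_sq, mobC]
  field_simp
  ring

lemma mobC_sub_self (w : Disc) {z : ℂ} (hz : ‖z‖ ≤ 1) :
    mobC w z - w = -z * (((1 - ‖(w : ℂ)‖ ^ 2 : ℝ) : ℂ) / (1 - conj (w : ℂ) * z)) := by
  have h := one_sub_conj_mul_ne_zero w hz
  have h' := h
  rw [mul_comm] at h'
  rw [ofReal_one_sub_norm_sq, mobC]
  field_simp
  ring

lemma one_sub_norm_sq_ne_zero (w : Disc) : ((1 - ‖(w : ℂ)‖ ^ 2 : ℝ) : ℂ) ≠ 0 := by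
  exact_mod_cast (one_sub_pos w).ne'

lemma mob_mob (w z : Disc) : mob w (mob w z) = z := by
  refine Subtype.ext ?_
  have h := one_sub_conj_mul_ne_zero w z.norm_lt_one.le
  have h1 := one_sub_norm_sq_ne_zero w
  rw [mob_coe, mobC, mob_coe, one_sub_conj_mul_mobC w z.norm_lt_one.le, ← neg_sub,
    mobC_sub_self w z.norm_lt_one.le]
  rw [mul_comm] at h
  field_simp

lemma hasDerivAt_mobC (w : Disc) {z : ℂ} (hz : ‖z‖ ≤ 1) :
    HasDerivAt (mobC w) (-((1 - ‖(w : ℂ)‖ ^ 2 : ℝ) : ℂ) / (1 - conj (w : ℂ) * z) ^ 2) z := by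
  have h := one_sub_conj_mul_ne_zero w hz
  have h1 := ((hasDerivAt_id z).const_sub (w : ℂ)).div
    (((hasDerivAt_id z).const_mul (conj (w : ℂ))).const_sub 1) h
  refine h1.congr_deriv ?_
  rw [ofReal_one_sub_norm_sq]
  simp only [id]
  ring

lemma comp_mob_mem_hol {f : Disc → ℂ} (hf : f ∈ Hol) (w : Disc) : (fun z => f (mob w z)) ∈ Hol := by
  refine hol_of_differentiableOn (F := fun z => ext f (mobC w z)) (fun u => ?_) ?_
  · rw [← mob_coe, ext_coe]
  · refine DifferentiableOn.comp (t := ball 0 1) hf ?_ ?_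
    · intro z hz
      exact (hasDerivAt_mobC w (mem_ball_zero_iff.mp hz).le).differentiableAt.differentiableWithinAt
    · intro z hz
      exact mem_ball_zero_iff.mpr (norm_mobC_lt_one w (mem_ball_zero_iff.mp hz))

lemma cderiv_comp_mob {f : Disc → ℂ} (hf : f ∈ Hol) (w z : Disc) :
    cderiv (fun z => f (mob w z)) z =
      cderiv f (mob w z) * (-((1 - ‖(w : ℂ)‖ ^ 2 : ℝ) : ℂ) / (1 - conj (w : ℂ) * z) ^ 2) := by
  refine cderiv_eq_of_hasDerivAt (F := fun z => ext f (mobC w z)) z (fun u => ?_) ?_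
  · rw [← mob_coe, ext_coe]
  · exact HasDerivAt.comp (z : ℂ) (Hol.differentiableAt hf (mob w z)).hasDerivAt
      (hasDerivAt_mobC w z.norm_lt_one.le)

/-- Change of variables by a Möbius transformation. -/
lemma lintegral_comp_mob (w : Disc) (g : Disc → ℝ≥0∞) :
    ∫⁻ z, g z ∂dA = ∫⁻ z : Disc,
      ‖-((1 - ‖(w : ℂ)‖ ^ 2 : ℝ) : ℂ) / (1 - conj (w : ℂ) * z) ^ 2‖ₑ ^ 2 * g (mob w z) ∂dA := by
  set G : ℂ → ℝ≥0∞ := Function.extend Subtype.val g 0 with hG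
  have hGc : ∀ z : Disc, G z = g z := fun z => Subtype.val_injective.extend_apply g 0 z
  have h1 : mobC w '' ball (0 : ℂ) 1 = ball (0 : ℂ) 1 := by
    refine Set.Subset.antisymm ?_ ?_
    · rintro _ ⟨z, hz, rfl⟩
      exact mem_ball_zero_iff.mpr (norm_mobC_lt_one w (mem_ball_zero_iff.mp hz))
    · intro z hz
      refine ⟨mob w ⟨z, hz⟩, (mob w ⟨z, hz⟩).2, ?_⟩
      rw [← mob_coe, mob_mob]
  have hinj : Set.InjOn (mobC w) (ball 0 1) := by
    intro x hx y hy hxy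
    have h2 : mob w ⟨x, hx⟩ = mob w ⟨y, hy⟩ := Subtype.ext hxy
    have h3 := congrArg (mob w) h2
    rw [mob_mob, mob_mob] at h3
    exact congrArg Subtype.val h3
  set d : ℂ → ℂ := fun z => -((1 - ‖(w : ℂ)‖ ^ 2 : ℝ) : ℂ) / (1 - conj (w : ℂ) * z) ^ 2 with hd
  have hfd : ∀ x ∈ ball (0 : ℂ) 1, HasFDerivWithinAt (mobC w)
      ((ContinuousLinearMap.toSpanSingleton ℂ (d x)).restrictScalars ℝ) (ball 0 1) x := by
    intro x hx
    exact ((hasDerivAt_mobC w (mem_ball_zero_iff.mp hx).le).hasFDerivAt.restrictScalars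
      ℝ).hasFDerivWithinAt
  have h2 := lintegral_image_eq_lintegral_abs_det_fderiv_mul volume measurableSet_ball hfd hinj G
  -- The real determinant of multiplication by a complex number is the algebra norm of that number
  -- over the reals, its squared modulus.
  have hdet : ∀ x, ENNReal.ofReal |((ContinuousLinearMap.toSpanSingleton ℂ
      (d x)).restrictScalars ℝ : ℂ →L[ℝ] ℂ).det| = ‖d x‖ₑ ^ 2 := by
    intro x
    have : ((ContinuousLinearMap.toSpanSingleton ℂ (d x)).restrictScalars ℝ : ℂ →L[ℝ] ℂ).det =
        ‖d x‖ ^ 2 := by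
      have e : (((ContinuousLinearMap.toSpanSingleton ℂ (d x)).restrictScalars ℝ : ℂ →L[ℝ] ℂ) :
          ℂ →ₗ[ℝ] ℂ) = LinearMap.mul ℝ ℂ (d x) := by
        refine LinearMap.ext fun y => ?_
        simp [mul_comm]
      rw [ContinuousLinearMap.det, e, ← Complex.normSq_eq_norm_sq, ← Algebra.norm_complex_apply]
      rfl
    rw [this, abs_of_nonneg (sq_nonneg _), enorm_sq_eq_ofReal]
  rw [h1] at h2
  simp_rw [hdet] at h2
  have h3 := lintegral_dA G
  have h4 := lintegral_dA (fun x => ‖d x‖ₑ ^ 2 * G (mobC w x))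
  rw [h2, ← h4] at h3
  simp only [hGc, ← mob_coe] at h3
  exact h3

/-! ### The weighted composition operator of a Möbius transformation on `H²` -/

lemma continuousOn_mobC (w : Disc) : ContinuousOn (mobC w) (closedBall 0 1) := fun _ hz =>
  (hasDerivAt_mobC w (mem_closedBall_zero_iff.mp hz)).continuousAt.continuousWithinAt

/-- The Möbius map carries the Poisson measure at `w` to arc length. Instead of a boundary change of
variables, one coefficient is peeled off at a time: on the circle `|a₀ + u H(u)|² = |H(u)|² + |a₀|²
+ 2 Re (conj a₀ u H(u))` with `u = mobC w z`, and the Poisson integral of the cross term is its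
value at `z = w`, where `u = 0`. -/
lemma circleAverage_poisson_mob (w : Disc) (N : ℕ) (a : ℕ → ℂ) :
    Real.circleAverage (fun z => poissonKernel 0 (w : ℂ) z *
      ‖∑ n ∈ Finset.range N, a n * mobC w z ^ n‖ ^ 2) 0 1 =
      ∑ n ∈ Finset.range N, ‖a n‖ ^ 2 := by
  induction N generalizing a with
  | zero => simp [Real.circleAverage_const]
  | succ N ih =>
    have hP : ContinuousOn (poissonKernel 0 (w : ℂ)) (sphere 0 1) := by
      have : ∀ z ∈ sphere (0 : ℂ) 1, ‖z - 0 - (w - 0)‖ ^ 2 ≠ 0 := by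
        intro z hz h
        rw [sub_zero, sub_zero, sq_eq_zero_iff, norm_eq_zero, sub_eq_zero] at h
        rw [h, mem_sphere_zero_iff_norm] at hz
        exact w.norm_lt_one.ne hz
      exact ContinuousOn.div (by fun_prop) (by fun_prop) this
    have hm : ContinuousOn (mobC w) (sphere 0 1) :=
      (continuousOn_mobC w).mono sphere_subset_closedBall
    set H : ℂ → ℂ := fun u => ∑ n ∈ Finset.range N, a (n + 1) * u ^ n with hH
    have hHc : Continuous H := by fun_prop
    set g : ℂ → ℂ := fun z => (conj (a 0)) * (mobC w z * H (mobC w z)) with hg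
    have hgd : DiffContOnCl ℂ g (ball 0 1) := by
      refine DifferentiableOn.diffContOnCl ?_
      rw [closure_ball _ one_ne_zero]
      have hd : DifferentiableOn ℂ (mobC w) (closedBall 0 1) := fun z hz =>
        (hasDerivAt_mobC w (mem_closedBall_zero_iff.mp hz)).differentiableAt.differentiableWithinAt
      have hHd : Differentiable ℂ H := by fun_prop
      exact (hd.mul (hHd.comp_differentiableOn hd)).const_mul _
    have h0 := hgd.circleAverage_poissonKernel_smul w.2
    have hgw : g w = 0 := by simp [hg, mobC]
    rw [hgw] at h0
    have hgc : ContinuousOn g (sphere 0 1) := by fun_prop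
    have hi1 : CircleIntegrable (fun z => poissonKernel 0 (w : ℂ) z * ‖H (mobC w z)‖ ^ 2) 0 1 :=
      ContinuousOn.circleIntegrable zero_le_one
        (hP.mul ((hHc.comp_continuousOn hm).norm.pow 2))
    have hi2 : CircleIntegrable (fun z => poissonKernel 0 (w : ℂ) z * ‖a 0‖ ^ 2) 0 1 :=
      ContinuousOn.circleIntegrable zero_le_one (hP.mul continuousOn_const)
    have hi3 : CircleIntegrable (fun z => 2 * (poissonKernel 0 (w : ℂ) z * (g z).re)) 0 1 :=
      ContinuousOn.circleIntegrable zero_le_one (continuousOn_const.mul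
        (hP.mul (Complex.continuous_re.comp_continuousOn hgc)))
    have h1 : Real.circleAverage (fun z => poissonKernel 0 (w : ℂ) z *
        ‖∑ n ∈ Finset.range (N + 1), a n * mobC w z ^ n‖ ^ 2) 0 1 =
        Real.circleAverage (fun z => (poissonKernel 0 (w : ℂ) z * ‖H (mobC w z)‖ ^ 2 +
          poissonKernel 0 (w : ℂ) z * ‖a 0‖ ^ 2) + 2 * (poissonKernel 0 (w : ℂ) z * (g z).re))
          0 1 := by
      refine Real.circleAverage_congr_sphere fun z hz => ?_
      rw [abs_one, mem_sphere_zero_iff_norm] at hz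
      have h2 : ∑ n ∈ Finset.range (N + 1), a n * mobC w z ^ n =
          a 0 + mobC w z * H (mobC w z) := by
        rw [Finset.sum_range_succ', add_comm, hH, Finset.mul_sum]
        simp only [pow_zero, mul_one, pow_succ]
        congr 1
        exact Finset.sum_congr rfl fun n _ => by ring
      have h3 : ‖mobC w z * H (mobC w z)‖ = ‖H (mobC w z)‖ := by
        rw [norm_mul, norm_mobC_eq_one w hz, one_mul]
      have h4 : ‖a 0 + mobC w z * H (mobC w z)‖ ^ 2 =
          ‖H (mobC w z)‖ ^ 2 + ‖a 0‖ ^ 2 + 2 * (g z).re := by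
        rw [← h3, hg]
        simp only [← Complex.normSq_eq_norm_sq, Complex.normSq_apply, Complex.add_re,
          Complex.add_im, Complex.mul_re (conj (a 0)), Complex.conj_re, Complex.conj_im]
        ring
      simp only [h2, h4]
      ring
    have h5 : Real.circleAverage (fun z => 2 * (poissonKernel 0 (w : ℂ) z * (g z).re)) 0 1 = 0 := by
      have h6 := congrArg Complex.re h0
      have hi4 : CircleIntegrable (poissonKernel 0 (w : ℂ) • g) 0 1 :=
        ContinuousOn.circleIntegrable zero_le_one (hP.smul hgc)
      have h7 := Complex.reCLM.circleAverage_comp_comm hi4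
      simp only [Complex.reCLM_apply] at h7
      rw [Complex.zero_re] at h6
      have h8 := Real.circleAverage_fun_smul (a := (2 : ℝ)) (c := (0 : ℂ)) (R := 1)
        (f := fun z => poissonKernel 0 (w : ℂ) z * (g z).re)
      simp only [smul_eq_mul] at h8
      rw [h8]
      have h9 : (Complex.reCLM ∘ (poissonKernel 0 (w : ℂ) • g)) =
          fun z => poissonKernel 0 (w : ℂ) z * (g z).re := by
        funext z
        simp
      rw [h9, h6] at h7
      rw [h7, mul_zero]
    have h10 : Real.circleAverage (fun z => poissonKernel 0 (w : ℂ) z * ‖a 0‖ ^ 2) 0 1 =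
        ‖a 0‖ ^ 2 := by
      have hc : DiffContOnCl ℂ (fun _ : ℂ => (1 : ℂ)) (ball 0 1) := diffContOnCl_const
      have h11 := congrArg Complex.re (hc.circleAverage_poissonKernel_smul w.2)
      have hi4 : CircleIntegrable (poissonKernel 0 (w : ℂ) • fun _ : ℂ => (1 : ℂ)) 0 1 :=
        ContinuousOn.circleIntegrable zero_le_one (hP.smul continuousOn_const)
      have h7 := Complex.reCLM.circleAverage_comp_comm hi4
      simp only [Complex.reCLM_apply] at h7
      rw [h11] at h7
      have h9 : (Complex.reCLM ∘ (poissonKernel 0 (w : ℂ) • fun _ : ℂ => (1 : ℂ))) =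
          fun z => poissonKernel 0 (w : ℂ) z := by
        funext z
        simp
      rw [h9] at h7
      have h8 := Real.circleAverage_fun_smul (a := ‖a 0‖ ^ 2) (c := (0 : ℂ)) (R := 1)
        (f := fun z => poissonKernel 0 (w : ℂ) z)
      simp only [smul_eq_mul, mul_comm (‖a 0‖ ^ 2)] at h8
      rw [h8, h7, Complex.one_re, one_mul]
    have hi12 : CircleIntegrable (fun z => poissonKernel 0 (w : ℂ) z * ‖H (mobC w z)‖ ^ 2 +
        poissonKernel 0 (w : ℂ) z * ‖a 0‖ ^ 2) 0 1 := hi1.add hi2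
    rw [h1, Real.circleAverage_fun_add hi12 hi3, Real.circleAverage_fun_add hi1 hi2, h5,
      h10, hH, ih, add_zero, Finset.sum_range_succ']

/-- The weighted composition operator `f ↦ (f ∘ φ) / (1 - conj w z)` of the Möbius
transformation `φ` that exchanges `0` and `w`. -/
noncomputable def mobOp (w : Disc) (f : Disc → ℂ) (z : Disc) : ℂ := cauchyKer w z * f (mob w z)

lemma mobOp_mem_hol (w : Disc) {f : Disc → ℂ} (hf : f ∈ Hol) : mobOp w f ∈ Hol :=
  mul_mem_hol (cauchyKer_mem_hol w.norm_lt_one.le) (comp_mob_mem_hol hf w)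

/-- Up to the scalar `√(1 - |w|²)` the operator is an involution; this turns the norm inequality
`sqsum_mobOp_le` into an equality. -/
lemma mobOp_mobOp (w : Disc) (f : Disc → ℂ) :
    mobOp w (mobOp w f) = (((1 - ‖(w : ℂ)‖ ^ 2 : ℝ) : ℂ)⁻¹) • f := by
  funext z
  have h := one_sub_conj_mul_ne_zero w z.norm_lt_one.le
  have h1 := one_sub_norm_sq_ne_zero w
  simp only [mobOp, mob_mob, cauchyKer, mob_coe, Pi.smul_apply, smul_eq_mul]
  rw [one_sub_conj_mul_mobC w z.norm_lt_one.le]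
  field_simp

lemma sqsum_smul (c : ℂ) (a : ℕ → ℂ) : sqsum (c • a) = ‖c‖ₑ ^ 2 * sqsum a := by
  rw [sqsum, sqsum, ← ENNReal.tsum_mul_left]
  exact tsum_congr fun n => by rw [Pi.smul_apply, smul_eq_mul, enorm_mul, mul_pow]

lemma hasSum_partial (a : ℕ → ℂ) (N : ℕ) (z : ℂ) :
    HasSum (fun n => (if n < N then a n else 0) * z ^ n) (∑ n ∈ Finset.range N, a n * z ^ n) := by
  have h : HasSum (fun n => (if n < N then a n else 0) * z ^ n)
      (∑ n ∈ Finset.range N, (if n < N then a n else 0) * z ^ n) :=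
    hasSum_sum_of_ne_finset_zero fun n hn => by
      rw [if_neg (fun h => hn (Finset.mem_range.mpr h)), zero_mul]
  rwa [Finset.sum_congr rfl fun n hn => by rw [if_pos (Finset.mem_range.mp hn)]] at h

/-- The Taylor polynomials, as functions on the disc. -/
noncomputable def partialSum (a : ℕ → ℂ) (N : ℕ) (z : Disc) : ℂ :=
  ∑ n ∈ Finset.range N, a n * (z : ℂ) ^ n

lemma partialSum_mem_hol (a : ℕ → ℂ) (N : ℕ) : partialSum a N ∈ Hol :=
  hol_of_hasSum fun z => hasSum_partial a N z

lemma coeff_partialSum (a : ℕ → ℂ) (N : ℕ) :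
    coeff (partialSum a N) = fun n => if n < N then a n else 0 :=
  coeff_of_hasSum fun z => hasSum_partial a N z

lemma sqsum_partial (a : ℕ → ℂ) (N : ℕ) :
    sqsum (fun n => if n < N then a n else 0) = ∑ n ∈ Finset.range N, ‖a n‖ₑ ^ 2 := by
  rw [sqsum, tsum_eq_sum (s := Finset.range N) fun n hn => by
    rw [if_neg (fun h => hn (Finset.mem_range.mpr h))]; simp]
  exact Finset.sum_congr rfl fun n hn => by rw [if_pos (Finset.mem_range.mp hn)]

/-- For a polynomial the image extends continuously to the closed disc, and on the circle `(1 -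
|w|²) / |1 - conj w z|²` is the Poisson kernel at `w`, so the circle average is known. -/
lemma sqsum_mobOp_partialSum_le (w : Disc) (a : ℕ → ℂ) (N : ℕ) :
    ENNReal.ofReal (1 - ‖(w : ℂ)‖ ^ 2) * sqsum (coeff (mobOp w (partialSum a N))) ≤
      ∑ n ∈ Finset.range N, ‖a n‖ₑ ^ 2 := by
  set f := mobOp w (partialSum a N) with hf
  have hfh : f ∈ Hol := mobOp_mem_hol w (partialSum_mem_hol a N)
  set F : ℂ → ℂ := fun z => 1 / (1 - conj (w : ℂ) * z) *
    ∑ n ∈ Finset.range N, a n * mobC w z ^ n with hF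
  have hFf : ∀ z : Disc, F z = f z := fun z => rfl
  have hFc : ContinuousOn F (closedBall 0 1) := by
    have h1 := continuousOn_mobC w
    refine ContinuousOn.mul (ContinuousOn.div continuousOn_const (by fun_prop) fun z hz =>
      one_sub_conj_mul_ne_zero w (mem_closedBall_zero_iff.mp hz)) (by fun_prop)
  have hFc2 : ContinuousOn (Real.circleAverage (fun z => ‖F z‖ ^ 2) 0) (Set.Icc 0 1) := by
    refine Real.ContinuousOn.circleAverage ?_ fun r hr => hr.1
    refine (hFc.norm.pow 2).mono fun z hz => ?_
    rw [mem_closedBall_zero_iff]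
    have : ‖z - 0‖ ∈ Set.Icc (0 : ℝ) 1 := hz
    rw [sub_zero] at this
    exact this.2
  have h1 : (1 - ‖(w : ℂ)‖ ^ 2) * Real.circleAverage (fun z => ‖F z‖ ^ 2) 0 1 =
      ∑ n ∈ Finset.range N, ‖a n‖ ^ 2 := by
    rw [← circleAverage_poisson_mob w N a]
    have h2 := Real.circleAverage_fun_smul (a := 1 - ‖(w : ℂ)‖ ^ 2) (c := (0 : ℂ)) (R := 1)
      (f := fun z => ‖F z‖ ^ 2)
    simp only [smul_eq_mul] at h2
    rw [← h2]
    refine Real.circleAverage_congr_sphere fun z hz => ?_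
    rw [abs_one, mem_sphere_zero_iff_norm] at hz
    have h3 : ‖1 - conj (w : ℂ) * z‖ ^ 2 = ‖z - w‖ ^ 2 := by
      have := norm_one_sub_conj_mul_sq (w : ℂ) z
      rw [hz, one_pow, sub_self, mul_zero] at this
      rw [norm_sub_rev z]
      linarith
    simp only [hF, norm_mul, norm_div, norm_one, mul_pow, div_pow, one_pow, h3, poissonKernel_def,
      sub_zero, hz]
    ring
  -- Parseval holds at radii `r < 1`; circle averages are continuous up to `r = 1`.
  have h2 : ∀ M, ∑ n ∈ Finset.range M, ‖coeff f n‖ ^ 2 ≤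
      Real.circleAverage (fun z => ‖F z‖ ^ 2) 0 1 := by
    intro M
    have hl : Tendsto (fun r : ℝ => ∑ n ∈ Finset.range M, ‖coeff f n‖ ^ 2 * r ^ (2 * n))
        (𝓝[Set.Ioo 0 1] 1) (𝓝 (∑ n ∈ Finset.range M, ‖coeff f n‖ ^ 2 * 1 ^ (2 * n))) := by
      refine Tendsto.mono_left ?_ nhdsWithin_le_nhds
      refine Continuous.tendsto (by fun_prop) _
    have hr : Tendsto (Real.circleAverage (fun z => ‖F z‖ ^ 2) 0) (𝓝[Set.Ioo 0 1] 1)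
        (𝓝 (Real.circleAverage (fun z => ‖F z‖ ^ 2) 0 1)) :=
      (hFc2 1 ⟨zero_le_one, le_rfl⟩).mono_left (nhdsWithin_mono _ Set.Ioo_subset_Icc_self)
    simp only [one_pow, mul_one] at hl
    have : (𝓝[Set.Ioo (0 : ℝ) 1] 1).NeBot := by
      rw [← mem_closure_iff_nhdsWithin_neBot, closure_Ioo zero_ne_one]
      exact ⟨zero_le_one, le_rfl⟩
    refine le_of_tendsto_of_tendsto hl hr ?_
    filter_upwards [self_mem_nhdsWithin] with r hr
    have h3 := hasSum_sq_circleAverage_of_hol hfh hr.1.le hr.2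
    have h4 : Real.circleAverage (fun z => ‖ext f z‖ ^ 2) 0 r =
        Real.circleAverage (fun z => ‖F z‖ ^ 2) 0 r := by
      refine Real.circleAverage_congr_sphere fun z hz => ?_
      have hz' : z ∈ ball (0 : ℂ) 1 := by
        rw [mem_ball_zero_iff, mem_sphere_zero_iff_norm.mp hz, abs_of_pos hr.1]
        exact hr.2
      lift z to Disc using hz'
      simp only [ext_coe, hFf]
    rw [h4] at h3
    exact sum_le_hasSum _ (fun n _ => by have := hr.1; positivity) h3
  have h3 : sqsum (coeff f) ≤ ENNReal.ofReal (Real.circleAverage (fun z => ‖F z‖ ^ 2) 0 1) := by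
    refine ENNReal.tsum_le_of_sum_range_le fun M => ?_
    simp_rw [enorm_sq_eq_ofReal]
    rw [← ENNReal.ofReal_sum_of_nonneg fun n _ => sq_nonneg _]
    exact ENNReal.ofReal_le_ofReal (h2 M)
  refine (mul_le_mul_right h3 _).trans ?_
  rw [← ENNReal.ofReal_mul (one_sub_pos w).le, h1, ENNReal.ofReal_sum_of_nonneg fun n _ => sq_nonneg _]
  simp_rw [enorm_sq_eq_ofReal]
  exact le_rfl

lemma sqsum_mobOp_le (w : Disc) {f : Disc → ℂ} (hf : f ∈ Hol) :
    ENNReal.ofReal (1 - ‖(w : ℂ)‖ ^ 2) * sqsum (coeff (mobOp w f)) ≤ sqsum (coeff f) := by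
  have h0 : ENNReal.ofReal (1 - ‖(w : ℂ)‖ ^ 2) ≠ 0 := by simpa using one_sub_pos w
  rw [mul_comm, ← ENNReal.le_div_iff_mul_le (Or.inl h0) (Or.inl ENNReal.ofReal_ne_top)]
  refine sqsum_le_of_tendsto (f := fun N => mobOp w (partialSum (coeff f) N))
    (fun N => mobOp_mem_hol w (partialSum_mem_hol _ N)) (mobOp_mem_hol w hf) ?_
    (Eventually.of_forall fun N => ?_)
  · intro z
    exact ((hasSum_coeff hf (mob w z)).tendsto_sum_nat).const_mul _
  · rw [ENNReal.le_div_iff_mul_le (Or.inl h0) (Or.inl ENNReal.ofReal_ne_top), mul_comm]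
    exact (sqsum_mobOp_partialSum_le w _ N).trans (ENNReal.sum_le_tsum _)

lemma sqsum_mobOp (w : Disc) {f : Disc → ℂ} (hf : f ∈ Hol) :
    ENNReal.ofReal (1 - ‖(w : ℂ)‖ ^ 2) * sqsum (coeff (mobOp w f)) = sqsum (coeff f) := by
  refine le_antisymm (sqsum_mobOp_le w hf) ?_
  have h0 : ENNReal.ofReal (1 - ‖(w : ℂ)‖ ^ 2) ≠ 0 := by simpa using one_sub_pos w
  have ht : ENNReal.ofReal (1 - ‖(w : ℂ)‖ ^ 2) ≠ ∞ := ENNReal.ofReal_ne_top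
  have h := sqsum_mobOp_le w (mobOp_mem_hol w hf)
  have h1 : ‖((1 - ‖(w : ℂ)‖ ^ 2 : ℝ) : ℂ)⁻¹‖ₑ = (ENNReal.ofReal (1 - ‖(w : ℂ)‖ ^ 2))⁻¹ := by
    rw [← ofReal_norm, norm_inv, Complex.norm_real, Real.norm_eq_abs, abs_of_pos (one_sub_pos w),
      ENNReal.ofReal_inv_of_pos (one_sub_pos w)]
  rw [mobOp_mobOp, coeff_smul _ hf, sqsum_smul, h1] at h
  generalize ENNReal.ofReal (1 - ‖(w : ℂ)‖ ^ 2) = t at *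
  rw [sq, mul_assoc, ← mul_assoc,
    ENNReal.mul_inv_cancel h0 ht, one_mul, ENNReal.inv_mul_le_iff h0 ht] at h
  exact h

/-! ### The local Dirichlet integral -/

/-- The kernel whose superposition is the weight `U_μ`. -/
noncomputable def locKernel (z : Disc) (w : ClosedDisc) : ℝ≥0∞ :=
  if ‖(w : ℂ)‖ < 1 then greenKernel z w else ENNReal.ofReal (poisson z w)

/-- The local Dirichlet integral at a point of the closed disc. -/
noncomputable def locDir (w : ClosedDisc) (f : Disc → ℂ) : ℝ≥0∞ :=
  ∫⁻ z, ‖cderiv f z‖ₑ ^ 2 * locKernel z w ∂dA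

lemma norm_le_of_sqsum_lt_top {F : ℕ → ℂ} (hF : sqsum F < ∞) : ∃ C : ℝ, ∀ n, ‖F n‖ ≤ C := by
  have h := sqsum_lt_top_iff.mp hF
  refine ⟨1 + ∑' n, ‖F n‖ ^ 2, fun n => ?_⟩
  have := h.le_tsum n fun m _ => sq_nonneg _
  nlinarith [sq_nonneg (‖F n‖ - 1), norm_nonneg (F n)]

lemma hasSum_ofCoeff {F : ℕ → ℂ} (hF : sqsum F < ∞) (z : Disc) :
    HasSum (fun n => F n * (z : ℂ) ^ n) (ofCoeff F z) := by
  obtain ⟨C, hC⟩ := norm_le_of_sqsum_lt_top hF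
  refine (summable_mul_pow_of_bound (C := C) (fun n => ?_) z).hasSum
  have h0 : 0 ≤ C := (norm_nonneg _).trans (hC 0)
  have : (0 : ℝ) ≤ n := Nat.cast_nonneg n
  nlinarith [hC n]

lemma ofCoeff_mem_hol {F : ℕ → ℂ} (hF : sqsum F < ∞) : ofCoeff F ∈ Hol :=
  hol_of_hasSum (hasSum_ofCoeff hF)

lemma coeff_ofCoeff {F : ℕ → ℂ} (hF : sqsum F < ∞) : coeff (ofCoeff F) = F :=
  coeff_of_hasSum (hasSum_ofCoeff hF)

lemma ae_ne_origin : ∀ᵐ z ∂dA, z ≠ origin := by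
  have h : dA {origin} = 0 := by
    rw [dA, Measure.smul_apply, (MeasurableEmbedding.subtype_coe measurableSet_ball).comap_apply,
      Set.image_singleton, measure_singleton, smul_zero]
  rw [ae_iff]
  simpa using h

/-- The local Dirichlet integral at an interior point. -/
lemma locDir_interior (w : Disc) {f F : Disc → ℂ} (hf : f ∈ Hol) (hF : F ∈ Hol) {c : ℂ}
    (h : ∀ z : Disc, f z = c + (z - w) * F z) (w' : ClosedDisc) (hw' : (w' : ℂ) = w) :
    locDir w' f = sqsum (coeff F) := by
  set s : ℝ := 1 - ‖(w : ℂ)‖ ^ 2 with hs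
  have hs0 : 0 < s := one_sub_pos w
  have hsC : (s : ℂ) ≠ 0 := by exact_mod_cast hs0.ne'
  set g : Disc → ℂ := fun z => f (mob w z) with hg
  have hgh : g ∈ Hol := comp_mob_mem_hol hf w
  have hW : mobOp w F ∈ Hol := mobOp_mem_hol w hF
  -- Since `mobC w z - w = -s z / (1 - conj w z)`, the substitution gives `g = c - s z (mobOp w F)`:
  -- the quotient of `f` at `w` becomes the quotient of `g` at the origin.
  have h1 : ∀ n, coeff g (n + 1) = -s * coeff (mobOp w F) n := by
    set b : ℕ → ℂ := fun n => Nat.casesOn n c fun n => -s * coeff (mobOp w F) n with hb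
    have hb' : coeff g = b := by
      refine coeff_of_hasSum fun z => ?_
      have h2 := hasSum_const_add_coordSub_mul (b := b) (F := -(s : ℂ) • coeff (mobOp w F)) (w := 0)
        (c := c) (z := z) (s := -s * mobOp w F z) (fun n => by simp [hb]) (by simp [hb])
        (by simpa [mul_assoc] using (hasSum_coeff hW z).mul_left (-(s : ℂ)))
      have h3 : g z = c + (z - 0) * (-s * mobOp w F z) := by
        simp only [hg]
        rw [h, mob_coe, mobC_sub_self w z.norm_lt_one.le, mobOp, cauchyKer, hs]
        ring
      rw [h3]
      exact h2
    intro n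
    rw [hb']
  -- After the change of variables the Green kernel at `w` becomes the one at the origin, and the
  -- Jacobian is absorbed by the chain rule. The value `∞` of the kernel is met only at `u = 0`, a
  -- null set.
  have h4 : locDir w' f = ∫⁻ u : Disc, ENNReal.ofReal s⁻¹ * (‖cderiv g u‖ₑ ^ 2 *
      ENNReal.ofReal (Real.log ((‖(u : ℂ)‖ ^ 2)⁻¹))) ∂dA := by
    rw [locDir, lintegral_comp_mob w]
    refine lintegral_congr_ae ?_
    filter_upwards [ae_ne_origin] with u hu
    have hu0 : (u : ℂ) ≠ 0 := fun h => hu (Subtype.ext h)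
    have hd := one_sub_conj_mul_ne_zero w u.norm_lt_one.le
    have hne : (w' : ℂ) ≠ mob w u := by
      rw [hw', mob_coe]
      intro h
      have h5 := mobC_sub_self w u.norm_lt_one.le
      rw [← h, sub_self] at h5
      have h6 : -(u : ℂ) * ((s : ℂ) / (1 - conj (w : ℂ) * u)) ≠ 0 :=
        mul_ne_zero (neg_ne_zero.mpr hu0) (div_ne_zero hsC hd)
      exact h6 h5.symm
    have hlt : ‖(w' : ℂ)‖ < 1 := by rw [hw']; exact w.norm_lt_one
    have hq : (1 - conj (w : ℂ) * (mob w u : ℂ)) / ((mob w u : ℂ) - w) = -(u : ℂ)⁻¹ := by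
      rw [mob_coe, one_sub_conj_mul_mobC w u.norm_lt_one.le, mobC_sub_self w u.norm_lt_one.le]
      have hA : ((1 - ‖(w : ℂ)‖ ^ 2 : ℝ) : ℂ) / (1 - conj (w : ℂ) * u) ≠ 0 :=
        div_ne_zero (one_sub_norm_sq_ne_zero w) hd
      generalize ((1 - ‖(w : ℂ)‖ ^ 2 : ℝ) : ℂ) / (1 - conj (w : ℂ) * u) = A at hA
      field_simp
    rw [locKernel, if_pos hlt, greenKernel, if_neg hne, hw', hq, cderiv_comp_mob hf, enorm_mul,
      mul_pow, norm_neg, norm_inv, inv_pow, ← hs, div_eq_inv_mul (Real.log _) s,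
      ENNReal.ofReal_mul (inv_nonneg.mpr hs0.le)]
    ring
  -- Littlewood–Paley at the origin. With the factor `s⁻¹` from before, `s² · s⁻¹ = s` is the
  -- normalization under which `mobOp w` is isometric.
  have h5 : ∫⁻ u : Disc, (‖cderiv g u‖ₑ ^ 2 *
      ENNReal.ofReal (Real.log ((‖(u : ℂ)‖ ^ 2)⁻¹))) ∂dA =
      ENNReal.ofReal (s ^ 2) * sqsum (coeff (mobOp w F)) := by
    rw [lintegral_radial (cderiv_mem_hol hgh)
      (ρ := fun r => ENNReal.ofReal (Real.log ((r ^ 2)⁻¹))) (by fun_prop), sqsum,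
      ← ENNReal.tsum_mul_left]
    refine tsum_congr fun n => ?_
    rw [moment_log, coeff_cderiv, h1, enorm_sq_eq_ofReal, enorm_sq_eq_ofReal,
      ← ENNReal.ofReal_mul (sq_nonneg _), ← ENNReal.ofReal_mul (sq_nonneg _)]
    congr 1
    have e : ‖(n + 1 : ℂ)‖ = n + 1 := by exact_mod_cast Complex.norm_natCast (n + 1)
    rw [norm_mul, e, norm_mul, norm_neg, Complex.norm_real, Real.norm_eq_abs, abs_of_pos hs0]
    field_simp
  rw [h4, lintegral_const_mul', h5, ← sqsum_mobOp w hF, ← mul_assoc,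
    ← ENNReal.ofReal_mul (inv_nonneg.mpr hs0.le)]
  · congr 2
    field_simp
    rfl
  · exact ENNReal.ofReal_ne_top

/-- The coefficient relation says `f = c + (z - w) ∑ F_n z^n` for a constant `c`; in this form
interior and boundary points need no distinction. -/
lemma locDir_eq (w : ClosedDisc) {f : Disc → ℂ} (hf : f ∈ Hol) {F : ℕ → ℂ} (hF : sqsum F < ∞)
    (h : ∀ n, coeff f (n + 1) = F n - w * F (n + 1)) : locDir w f = sqsum F := by
  by_cases hw : ‖(w : ℂ)‖ < 1
  · have h1 := locDir_interior ⟨w, mem_ball_zero_iff.mpr hw⟩ hf (ofCoeff_mem_hol hF)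
      (c := coeff f 0 + w * F 0) (fun z => ?_) w rfl
    · rwa [coeff_ofCoeff hF] at h1
    · exact (hasSum_coeff hf z).unique
        (hasSum_const_add_coordSub_mul h (by ring) (hasSum_ofCoeff hF z))
  · have hw1 : ‖(w : ℂ)‖ = 1 := le_antisymm w.norm_le_one (not_lt.mp hw)
    rw [locDir, ← lintegral_poisson_boundary_eq hf hw1 hF h]
    simp only [locKernel, if_neg hw]

lemma exists_of_locDir_lt_top (w : ClosedDisc) {f : Disc → ℂ} (hf : f ∈ Hol)
    (h : locDir w f < ∞) :
    ∃ F : ℕ → ℂ, sqsum F < ∞ ∧ ∀ n, coeff f (n + 1) = F n - w * F (n + 1) := by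
  by_cases hw : ‖(w : ℂ)‖ < 1
  · have hwb : (w : ℂ) ∈ ball (0 : ℂ) 1 := mem_ball_zero_iff.mpr hw
    -- At an interior point the difference quotient is holomorphic with no assumption, and
    -- finiteness only serves to put it in `H²`.
    set F : Disc → ℂ := fun z => dslope (ext f) w z with hF
    have hFh : F ∈ Hol := by
      refine hol_of_differentiableOn (F := dslope (ext f) w) (fun _ => rfl) ?_
      exact (Complex.differentiableOn_dslope (isOpen_ball.mem_nhds hwb)).mpr hf
    have hfF : ∀ z : Disc, f z = f ⟨w, hwb⟩ + (z - w) * F z := by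
      intro z
      have h1 := sub_smul_dslope (ext f) (w : ℂ) z
      rw [smul_eq_mul] at h1
      have h2 : ext f (w : ℂ) = f ⟨w, hwb⟩ := ext_coe f ⟨w, hwb⟩
      simp only [hF]
      rw [h1, h2, ext_coe]
      ring
    refine ⟨coeff F, ?_, ?_⟩
    · rw [← locDir_interior ⟨w, hwb⟩ hf hFh hfF w rfl]
      exact h
    · set b : ℕ → ℂ := fun n => Nat.casesOn n (f ⟨w, hwb⟩ - w * coeff F 0)
        fun n => coeff F n - w * coeff F (n + 1) with hb
      have hb' : coeff f = b := by
        refine coeff_of_hasSum fun z => ?_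
        rw [hfF]
        exact hasSum_const_add_coordSub_mul (fun n => rfl) rfl (hasSum_coeff hFh z)
      intro n
      rw [hb']
  · have hw1 : ‖(w : ℂ)‖ = 1 := le_antisymm w.norm_le_one (not_lt.mp hw)
    refine exists_of_lintegral_poisson_boundary hf hw1 ?_
    rw [locDir] at h
    simpa only [locKernel, if_neg hw] using h

lemma measurable_locKernel : Measurable fun p : Disc × ClosedDisc => locKernel p.1 p.2 := by
  unfold locKernel greenKernel
  have hw : Measurable fun p : Disc × ClosedDisc => (p.2 : ℂ) :=
    measurable_subtype_coe.comp measurable_snd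
  have hz : Measurable fun p : Disc × ClosedDisc => (p.1 : ℂ) :=
    measurable_subtype_coe.comp measurable_fst
  have hcw : Measurable fun p : Disc × ClosedDisc => conj (p.2 : ℂ) :=
    Complex.continuous_conj.measurable.comp hw
  refine Measurable.ite (measurableSet_lt hw.norm measurable_const) ?_ ?_
  · refine Measurable.ite (measurableSet_eq_fun hw hz) measurable_const ?_
    refine ENNReal.measurable_ofReal.comp (Measurable.div (Real.measurable_log.comp ?_) ?_)
    · exact (((measurable_const.sub (hcw.mul hz)).div (hz.sub hw)).norm).pow_const 2
    · exact measurable_const.sub (hw.norm.pow_const 2)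
  · exact ENNReal.measurable_ofReal.comp continuous_poisson.measurable

lemma weightU_eq (μ : Measure ClosedDisc) (z : Disc) :
    weightU μ z = ∫⁻ w, locKernel z w ∂μ := by
  have hm : MeasurableSet {w : ClosedDisc | ‖(w : ℂ)‖ < 1} :=
    measurableSet_lt (by fun_prop) measurable_const
  rw [weightU, ← lintegral_add_compl (fun w => locKernel z w) hm]
  congr 1
  · refine setLIntegral_congr_fun hm fun w hw => ?_
    exact (if_pos (c := ‖(w : ℂ)‖ < 1) hw).symm
  · have : {w : ClosedDisc | ‖(w : ℂ)‖ = 1} = {w : ClosedDisc | ‖(w : ℂ)‖ < 1}ᶜ := by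
      refine Set.ext fun w => ?_
      simp only [Set.mem_ofPred_eq, Set.mem_compl_iff, not_lt]
      exact ⟨fun h => h.ge, fun h => le_antisymm w.norm_le_one h⟩
    rw [this]
    refine setLIntegral_congr_fun hm.compl fun w hw => ?_
    exact (if_neg (c := ‖(w : ℂ)‖ < 1) hw).symm

lemma measurable_weightU (μ : Measure ClosedDisc) [IsFiniteMeasure μ] :
    Measurable (weightU μ) := by
  have : weightU μ = fun z => ∫⁻ w, locKernel z w ∂μ := funext (weightU_eq μ)
  rw [this]
  exact measurable_locKernel.lintegral_prod_right'

lemma measurable_cderiv {f : Disc → ℂ} (hf : f ∈ Hol) : Measurable (cderiv f) :=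
  (continuous_cderiv hf).measurable

instance : IsFiniteMeasure dA where
  measure_univ_lt_top := by
    have h := lintegral_dA fun _ => 1
    rw [lintegral_one, setLIntegral_one] at h
    rw [h]
    refine ENNReal.mul_lt_top (ENNReal.inv_lt_top.mpr (by simp [Real.pi_pos])) ?_
    exact measure_ball_lt_top

/-- The Dirichlet integral is a superposition of local Dirichlet integrals. -/
lemma lintegral_weightU (μ : Measure ClosedDisc) [IsFiniteMeasure μ] {f : Disc → ℂ} (hf : f ∈ Hol) :
    ∫⁻ z, ‖cderiv f z‖ₑ ^ 2 * weightU μ z ∂dA = ∫⁻ w, locDir w f ∂μ := by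
  simp only [locDir, weightU_eq]
  rw [lintegral_lintegral_swap]
  · refine lintegral_congr fun z => ?_
    rw [lintegral_const_mul]
    exact measurable_locKernel.comp measurable_prodMk_left
  · refine Measurable.aemeasurable ?_
    exact (((measurable_cderiv hf).comp measurable_snd).enorm.pow_const 2).mul
      (measurable_locKernel.comp measurable_swap)

/-- From `log x ≥ 1 - 1 / x` at `x = |(1 - conj w z) / (z - w)|²`. Integrated over `μ` this becomes
`V_μ ≤ U_μ`. -/
lemma poisson_le_locKernel (z : Disc) (w : ClosedDisc) :
    ENNReal.ofReal (poisson z w) ≤ locKernel z w := by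
  rw [locKernel]
  split_ifs with hw
  · rw [greenKernel]
    split_ifs with h
    · exact le_top
    · refine ENNReal.ofReal_le_ofReal ?_
      have hd := denom_pos z w
      have hzw : 0 < ‖(z : ℂ) - w‖ := norm_pos_iff.mpr (sub_ne_zero.mpr (Ne.symm h))
      have hw1 : 0 < 1 - ‖(w : ℂ)‖ ^ 2 := by nlinarith [norm_nonneg (w : ℂ)]
      rw [norm_div, div_pow, le_div_iff₀ hw1]
      refine le_trans (le_of_eq ?_) (Real.one_sub_inv_le_log_of_pos (by positivity))
      rw [poisson, inv_div, div_mul_eq_mul_div, mul_comm, ← norm_one_sub_conj_mul_sq,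
        norm_sub_rev (w : ℂ), sub_div, div_self (by positivity)]
  · exact le_rfl

/-! ### Consequences for the Hardy space -/

/-- The easy half of the Littlewood–Paley formula. -/
lemma lintegral_cderiv_one_sub_sq_le {f : Disc → ℂ} (hf : f ∈ Hol) :
    ∫⁻ z : Disc, ‖cderiv f z‖ₑ ^ 2 * ENNReal.ofReal (1 - ‖(z : ℂ)‖ ^ 2) ∂dA ≤
      sqsum (coeff f) := by
  rw [lintegral_one_sub_sq (cderiv_mem_hol hf)]
  refine le_trans (ENNReal.tsum_le_tsum fun n => ?_)
    (ENNReal.tsum_comp_le_tsum_of_injective (add_left_injective 1) fun n => ‖coeff f n‖ₑ ^ 2)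
  rw [coeff_cderiv, enorm_mul, mul_pow, mul_right_comm]
  refine mul_le_of_le_one_left' ?_
  have e : ‖(n + 1 : ℂ)‖ = n + 1 := by exact_mod_cast Complex.norm_natCast (n + 1)
  rw [enorm_sq_eq_ofReal, e, ← ENNReal.ofReal_mul (sq_nonneg _), ← ENNReal.ofReal_one]
  refine ENNReal.ofReal_le_ofReal ?_
  rw [mul_one_div, div_le_one (by positivity)]
  nlinarith [(Nat.cast_nonneg n : (0 : ℝ) ≤ n)]

lemma enorm_add_sq_le (a b : ℂ) : ‖a + b‖ₑ ^ 2 ≤ 2 * ‖a‖ₑ ^ 2 + 2 * ‖b‖ₑ ^ 2 := by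
  simp only [enorm_sq_eq_ofReal]
  have e : (2 : ℝ≥0∞) = ENNReal.ofReal 2 := by simp
  rw [e, ← ENNReal.ofReal_mul zero_le_two, ← ENNReal.ofReal_mul zero_le_two,
    ← ENNReal.ofReal_add (by positivity) (by positivity)]
  refine ENNReal.ofReal_le_ofReal ?_
  have h1 := norm_add_le a b
  nlinarith [sq_nonneg (‖a‖ - ‖b‖), norm_nonneg (a + b)]

/-- The measures `(1 - |z|²) / |1 - conj w z|² dA` are Carleson measures, uniformly in `w`. -/
lemma lintegral_poisson_le (w : ClosedDisc) {f : Disc → ℂ} (hf : f ∈ Hol)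
    (hs : sqsum (coeff f) < ∞) :
    ∫⁻ z : Disc, ‖f z‖ₑ ^ 2 * ENNReal.ofReal (poisson z w) ∂dA ≤ 4 * sqsum (coeff f) := by
  have hc := coordSub_mem_hol w
  have hg : coordSub w * f ∈ Hol := mul_mem_hol hc hf
  -- The quotient of `(z - w) f` at `w` is `f` itself, so the local Dirichlet integral of `(z - w)
  -- f` is the squared `H²` norm of `f`.
  have hcoef : ∀ n, coeff (coordSub w * f) (n + 1) = coeff f n - w * coeff f (n + 1) := by
    set b : ℕ → ℂ := fun n => Nat.casesOn n (0 - w * coeff f 0)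
        fun n => coeff f n - w * coeff f (n + 1) with hb
    have hb' : coeff (coordSub w * f) = b := by
      refine coeff_of_hasSum fun z => ?_
      have := hasSum_const_add_coordSub_mul (b := b) (w := w) (c := 0) (fun n => rfl) rfl
        (hasSum_coeff hf z)
      simpa [coordSub] using this
    intro n
    rw [hb']
  have h1 := locDir_eq w hg hs hcoef
  -- Write `f = ((z - w) f)' - (z - w) f'`. The first term is controlled by the local Dirichlet
  -- integral, and in the second `|z - w|²` times the Poisson kernel is at most `1 - |z|²`.
  have h2 : ∀ z : Disc, ‖f z‖ₑ ^ 2 * ENNReal.ofReal (poisson z w) ≤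
      2 * (‖cderiv (coordSub w * f) z‖ₑ ^ 2 * locKernel z w) +
        2 * (‖cderiv f z‖ₑ ^ 2 * ENNReal.ofReal (1 - ‖(z : ℂ)‖ ^ 2)) := by
    intro z
    have h3 : f z = cderiv (coordSub w * f) z + -(((z : ℂ) - w) * cderiv f z) := by
      rw [cderiv_mul hc hf, cderiv_coordSub, coordSub]
      ring
    have h4 : ‖(z : ℂ) - w‖ₑ ^ 2 * ENNReal.ofReal (poisson z w) ≤
        ENNReal.ofReal (1 - ‖(z : ℂ)‖ ^ 2) := by
      rw [enorm_sq_eq_ofReal, ← ENNReal.ofReal_mul (sq_nonneg _)]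
      refine ENNReal.ofReal_le_ofReal ?_
      have hd := denom_pos z w
      rw [poisson, mul_div_assoc', div_le_iff₀ (by positivity), mul_comm]
      refine mul_le_mul_of_nonneg_left ?_ (one_sub_pos z).le
      have h5 := norm_one_sub_conj_mul_sq (w : ℂ) z
      have h6 : 0 ≤ 1 - ‖(w : ℂ)‖ ^ 2 := by nlinarith [norm_nonneg (w : ℂ), w.norm_le_one]
      rw [norm_sub_rev (z : ℂ)]
      nlinarith [mul_nonneg h6 (one_sub_pos z).le]
    calc ‖f z‖ₑ ^ 2 * ENNReal.ofReal (poisson z w)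
        ≤ (2 * ‖cderiv (coordSub w * f) z‖ₑ ^ 2 + 2 * ‖-(((z : ℂ) - w) * cderiv f z)‖ₑ ^ 2) *
            ENNReal.ofReal (poisson z w) := by
          refine mul_le_mul_left ?_ _
          exact (congrArg (fun t : ℂ => ‖t‖ₑ ^ 2) h3).le.trans (enorm_add_sq_le _ _)
      _ = 2 * (‖cderiv (coordSub w * f) z‖ₑ ^ 2 * ENNReal.ofReal (poisson z w)) +
            2 * (‖cderiv f z‖ₑ ^ 2 * (‖(z : ℂ) - w‖ₑ ^ 2 * ENNReal.ofReal (poisson z w))) := by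
          rw [enorm_neg, enorm_mul]
          ring
      _ ≤ _ := by
          gcongr
          exact poisson_le_locKernel z w
  refine (lintegral_mono h2).trans ?_
  rw [lintegral_add_right, lintegral_const_mul', lintegral_const_mul']
  · have h5 := lintegral_cderiv_one_sub_sq_le hf
    have h6 : ∫⁻ z, ‖cderiv (coordSub w * f) z‖ₑ ^ 2 * locKernel z w ∂dA = sqsum (coeff f) := h1
    rw [h6]
    calc 2 * sqsum (coeff f) + 2 * _ ≤ 2 * sqsum (coeff f) + 2 * sqsum (coeff f) := by gcongr
      _ = 4 * sqsum (coeff f) := by ring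
  · simp
  · simp
  · exact (((measurable_cderiv hf).enorm.pow_const 2).mul (by fun_prop)).const_mul 2

/-- The local Dirichlet integral of the coordinate function, whose quotient at every `w` is the
constant `1`. -/
lemma lintegral_locKernel (w : ClosedDisc) : ∫⁻ z, locKernel z w ∂dA = 1 := by
  have hs : sqsum (fun n => if n = 0 then 1 else 0) = 1 := by
    rw [sqsum, tsum_eq_single 0]
    · simp
    · intro n hn
      simp [hn]
  have hc : coeff (coordSub 0) = fun n => if n = 1 then 1 else 0 := by
    refine coeff_of_hasSum fun z => ?_
    have := hasSum_ite_eq 1 (z : ℂ)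
    simp only [coordSub, sub_zero]
    refine this.congr_fun fun n => ?_
    split_ifs with h
    · simp [h]
    · simp
  have h := locDir_eq w (coordSub_mem_hol 0) (F := fun n => if n = 0 then 1 else 0)
    (by rw [hs]; exact ENNReal.one_lt_top) (fun n => by simp [hc])
  rw [hs, locDir] at h
  simpa [cderiv_coordSub] using h

lemma locDir_le_of_bound (w : ClosedDisc) {f : Disc → ℂ} {C : ℝ≥0∞}
    (h : ∀ z, ‖cderiv f z‖ₑ ^ 2 ≤ C) : locDir w f ≤ C := by
  calc locDir w f ≤ ∫⁻ z, C * locKernel z w ∂dA :=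
        lintegral_mono fun z => mul_le_mul_left (h z) _
    _ = C := by
      rw [lintegral_const_mul, lintegral_locKernel, mul_one]
      exact measurable_locKernel.comp measurable_prodMk_right

/-! ### Convergence of holomorphic functions and completeness -/

/-- Convergence of holomorphic functions, of their derivatives and of their Taylor coefficients. -/
structure HolTendsto (g : ℕ → Disc → ℂ) (h : Disc → ℂ) : Prop where
  hol : ∀ k, g k ∈ Hol
  hol_limit : h ∈ Hol
  coeff : ∀ n, Tendsto (fun k => coeff (g k) n) atTop (𝓝 (coeff h n))
  val : ∀ z, Tendsto (fun k => g k z) atTop (𝓝 (h z))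
  deriv : ∀ z, Tendsto (fun k => cderiv (g k) z) atTop (𝓝 (cderiv h z))

lemma summable_sq_mul_pow (z : Disc) (B : ℝ) :
    Summable fun n : ℕ => B * ((n : ℝ) + 1) ^ 2 * ‖(z : ℂ)‖ ^ n := by
  have hz : ‖(‖(z : ℂ)‖)‖ < 1 := by simpa using z.norm_lt_one
  have h1 := summable_pow_mul_geometric_of_norm_lt_one (R := ℝ) 2 hz
  have h2 := summable_pow_mul_geometric_of_norm_lt_one (R := ℝ) 1 hz
  have h3 := summable_geometric_of_lt_one (norm_nonneg _) z.norm_lt_one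
  refine (((h1.add (h2.mul_left 2)).add h3).mul_left B).congr fun n => ?_
  ring

lemma tendsto_of_tendsto_coeff {f : ℕ → Disc → ℂ} {g : Disc → ℂ} (hf : ∀ k, f k ∈ Hol)
    (hg : g ∈ Hol) (h : ∀ n, Tendsto (fun k => coeff (f k) n) atTop (𝓝 (coeff g n))) {B : ℝ}
    (hB : ∀ k n, ‖coeff (f k) n‖ ≤ B * ((n : ℝ) + 1) ^ 2) (z : Disc) :
    Tendsto (fun k => f k z) atTop (𝓝 (g z)) := by
  rw [← (hasSum_coeff hg z).tsum_eq]
  have : ∀ k, f k z = ∑' n, coeff (f k) n * (z : ℂ) ^ n := fun k =>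
    (hasSum_coeff (hf k) z).tsum_eq.symm
  simp_rw [this]
  refine tendsto_tsum_of_dominated_convergence (summable_sq_mul_pow z B)
    (fun n => (h n).mul_const _) (Eventually.of_forall fun k n => ?_)
  rw [norm_mul, norm_pow]
  exact mul_le_mul_of_nonneg_right (hB k n) (by positivity)

lemma holTendsto_of_coeff {f : ℕ → Disc → ℂ} {g : Disc → ℂ} (hf : ∀ k, f k ∈ Hol)
    (hg : g ∈ Hol) (h : ∀ n, Tendsto (fun k => coeff (f k) n) atTop (𝓝 (coeff g n))) {B : ℝ}
    (hB : ∀ k n, ‖coeff (f k) n‖ ≤ B * ((n : ℝ) + 1)) : HolTendsto f g where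
  hol := hf
  hol_limit := hg
  coeff := h
  val := by
    have hB0 : 0 ≤ B := by simpa using (norm_nonneg _).trans (hB 0 0)
    refine tendsto_of_tendsto_coeff hf hg h (B := B) fun k n => (hB k n).trans ?_
    have : (0 : ℝ) ≤ n := Nat.cast_nonneg n
    refine mul_le_mul_of_nonneg_left ?_ hB0
    nlinarith
  deriv := by
    have hB0 : 0 ≤ B := by simpa using (norm_nonneg _).trans (hB 0 0)
    -- Differentiation raises linear growth of the coefficients to quadratic growth, the order
    -- allowed in `tendsto_of_tendsto_coeff`.
    refine tendsto_of_tendsto_coeff (B := B * 2) (fun k => cderiv_mem_hol (hf k))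
      (cderiv_mem_hol hg) (fun n => ?_) fun k n => ?_
    · simp_rw [coeff_cderiv]
      exact (h (n + 1)).const_mul _
    · have e : ‖(n + 1 : ℂ)‖ = n + 1 := by exact_mod_cast Complex.norm_natCast (n + 1)
      have h1 := hB k (n + 1)
      push_cast at h1
      rw [coeff_cderiv, norm_mul, e]
      have hn : (0 : ℝ) ≤ n := Nat.cast_nonneg n
      calc ((n : ℝ) + 1) * ‖DirichletType.coeff (f k) (n + 1)‖
          ≤ ((n : ℝ) + 1) * (B * (n + 1 + 1)) := mul_le_mul_of_nonneg_left h1 (by positivity)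
        _ ≤ B * 2 * ((n : ℝ) + 1) ^ 2 := by nlinarith [mul_nonneg hB0 hn]

lemma HolTendsto.sub_const {g : ℕ → Disc → ℂ} {h u : Disc → ℂ} (H : HolTendsto g h) (hu : u ∈ Hol) :
    HolTendsto (fun k => g k - u) (h - u) where
  hol k := Hol.sub_mem (H.hol k) hu
  hol_limit := Hol.sub_mem H.hol_limit hu
  coeff n := by
    simp_rw [coeff_sub (H.hol _) hu, coeff_sub H.hol_limit hu]
    exact (H.coeff n).sub_const _
  val z := (H.val z).sub_const _
  deriv z := by
    simp_rw [cderiv_sub (H.hol _) hu, cderiv_sub H.hol_limit hu]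
    exact (H.deriv z).sub_const _

/-- Fatou's lemma. Finiteness of the weight matters because multiplication by `∞` is not continuous
at `0`. -/
lemma lintegral_cderiv_le_liminf {W : Disc → ℝ≥0∞} (hW : Measurable W) (hW' : ∀ᵐ z ∂dA, W z ≠ ∞)
    {g : ℕ → Disc → ℂ} {h : Disc → ℂ} (H : HolTendsto g h) :
    ∫⁻ z, ‖cderiv h z‖ₑ ^ 2 * W z ∂dA ≤
      liminf (fun k => ∫⁻ z, ‖cderiv (g k) z‖ₑ ^ 2 * W z ∂dA) atTop := by
  refine le_trans (le_of_eq (lintegral_congr_ae ?_)) (lintegral_liminf_le fun k =>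
    ((measurable_cderiv (H.hol k)).enorm.pow_const 2).mul hW)
  filter_upwards [hW'] with z hz
  refine (Tendsto.liminf_eq ?_).symm
  exact ENNReal.Tendsto.mul_const (((ENNReal.continuous_pow 2).tendsto _).comp (H.deriv z).enorm)
    (Or.inr hz)

lemma sqsum_le_liminf {a : ℕ → ℕ → ℂ} {b : ℕ → ℂ}
    (h : ∀ n, Tendsto (fun k => a k n) atTop (𝓝 (b n))) :
    sqsum b ≤ liminf (fun k => sqsum (a k)) atTop := by
  simp only [sqsum, ← lintegral_count]
  refine le_trans (le_of_eq (lintegral_congr fun n => ?_)) (lintegral_liminf_le fun k => by fun_prop)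
  exact (((ENNReal.continuous_pow 2).tendsto _).comp (h n).enorm).liminf_eq.symm

/-- Completeness of a space of holomorphic functions, from lower semicontinuity of its norm. -/
lemma completeSpace_of_lsc {X : Type*} [NormedAddCommGroup X] [NormedSpace ℂ X]
    (T : X →ₗ[ℂ] (Disc → ℂ)) {Q : (Disc → ℂ) → ℝ≥0∞} {C : ℝ} (hT : ∀ x, T x ∈ Hol)
    (hQ : ∀ x, Q (T x) = ENNReal.ofReal (‖x‖ ^ 2)) (hex : ∀ f ∈ Hol, Q f < ∞ → ∃ x, T x = f)
    (hC : ∀ x n, ‖coeff (T x) n‖ ≤ C * (n + 1) * ‖x‖)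
    (hlsc : ∀ g h, HolTendsto g h → Q h ≤ liminf (fun k => Q (g k)) atTop) : CompleteSpace X := by
  refine Metric.complete_of_cauchySeq_tendsto fun u hu => ?_
  have hC0 : ∀ x : X, x ≠ 0 → 0 ≤ C := by
    intro x hx
    have h1 := (norm_nonneg _).trans (hC x 0)
    simp only [Nat.cast_zero, zero_add, mul_one] at h1
    exact nonneg_of_mul_nonneg_left h1 (norm_pos_iff.mpr hx)
  have hdiff : ∀ x y n, coeff (T x) n - coeff (T y) n = coeff (T (x - y)) n := fun x y n => by
    rw [map_sub, coeff_sub (hT x) (hT y), Pi.sub_apply]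
  have hcau : ∀ n, CauchySeq fun k => coeff (T (u k)) n := by
    intro n
    have hl : LipschitzWith (Real.toNNReal (C * (n + 1))) fun x => coeff (T x) n := by
      refine LipschitzWith.of_dist_le_mul fun x y => ?_
      rw [dist_eq_norm, dist_eq_norm, hdiff]
      refine (hC _ n).trans (mul_le_mul_of_nonneg_right (Real.le_coe_toNNReal _) (norm_nonneg _))
    exact hl.uniformContinuous.comp_cauchySeq hu
  choose a ha using fun n => cauchySeq_tendsto_of_complete (hcau n)
  obtain ⟨R, hR0, hR⟩ := cauchySeq_bdd hu
  have hB : ∀ k, ‖u k‖ ≤ R + ‖u 0‖ := fun k => by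
    have h1 := (hR k 0).le
    rw [dist_eq_norm] at h1
    linarith [norm_le_norm_sub_add (u k) (u 0)]
  have hcb : ∀ k n, ‖coeff (T (u k)) n‖ ≤ |C| * (R + ‖u 0‖) * ((n : ℝ) + 1) := by
    intro k n
    refine (hC _ n).trans ?_
    calc C * (n + 1) * ‖u k‖ ≤ |C| * (n + 1) * (R + ‖u 0‖) := by
          gcongr
          · exact le_abs_self C
          · exact hB k
      _ = _ := by ring
  have hab : ∀ n, ‖a n‖ ≤ |C| * (R + ‖u 0‖) * ((n : ℝ) + 1) := fun n =>
    le_of_tendsto (ha n).norm (Eventually.of_forall fun k => hcb k n)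
  have hfs : ∀ z : Disc, HasSum (fun n => a n * (z : ℂ) ^ n) (ofCoeff a z) := fun z =>
    (summable_mul_pow_of_bound hab z).hasSum
  have H : HolTendsto (fun k => T (u k)) (ofCoeff a) := by
    refine holTendsto_of_coeff (fun k => hT _) (hol_of_hasSum hfs) (fun n => ?_) hcb
    rw [coeff_of_hasSum hfs]
    exact ha n
  -- Lower semicontinuity along `u m - u n` as `m → ∞`, with `n` fixed.
  have hlim : ∀ ε > 0, ∃ N, ∀ n ≥ N, Q (ofCoeff a - T (u n)) ≤ ENNReal.ofReal (ε ^ 2) := by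
    intro ε hε
    obtain ⟨N, hN⟩ := Metric.cauchySeq_iff.mp hu ε hε
    refine ⟨N, fun n hn => ?_⟩
    refine (hlsc _ _ (H.sub_const (hT (u n)))).trans ?_
    refine liminf_le_of_frequently_le' (Eventually.frequently ?_)
    filter_upwards [eventually_ge_atTop N] with m hm
    rw [← map_sub, hQ]
    have := (hN m hm n hn).le
    rw [dist_eq_norm] at this
    exact ENNReal.ofReal_le_ofReal (pow_le_pow_left₀ (norm_nonneg _) this 2)
  -- The limit differs from some `T (u N)` by a function with finite `Q`, hence lies in the range of
  -- `T`.
  obtain ⟨N, hN⟩ := hlim 1 one_pos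
  obtain ⟨y, hy⟩ := hex _ (Hol.sub_mem H.hol_limit (hT (u N)))
    (lt_of_le_of_lt (hN N le_rfl) ENNReal.ofReal_lt_top)
  have hx : T (y + u N) = ofCoeff a := by rw [map_add, hy, sub_add_cancel]
  refine ⟨y + u N, Metric.tendsto_atTop'.mpr fun ε hε => ?_⟩
  obtain ⟨M, hM⟩ := hlim (ε / 2) (by positivity)
  refine ⟨M, fun n hn => ?_⟩
  have h1 := hM n hn.le
  rw [← hx, ← map_sub, hQ, ENNReal.ofReal_le_ofReal_iff (by positivity)] at h1
  have h2 := le_of_sq_le_sq h1 (by positivity)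
  rw [dist_comm, dist_eq_norm]
  linarith

/-! ### The space `L²_{a,μ}` -/

section Weighted

variable (μ : Measure ClosedDisc) [IsFiniteMeasure μ]

/-- The total mass of a measure, as a real number. -/
noncomputable def mass (μ : Measure ClosedDisc) : ℝ := μ.real Set.univ

lemma poisson_le (z : Disc) (w : ClosedDisc) : poisson z w ≤ 4 / (1 - ‖(z : ℂ)‖ ^ 2) := by
  have h1 := denom_lower z w
  have h2 := z.norm_lt_one
  have h3 := one_sub_pos z
  have h4 := denom_pos z w
  have h0 := norm_nonneg (z : ℂ)
  rw [poisson, div_le_div_iff₀ (by positivity) h3]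
  have h5 : (1 - ‖(z : ℂ)‖) ^ 2 ≤ ‖1 - conj (w : ℂ) * (z : ℂ)‖ ^ 2 :=
    pow_le_pow_left₀ (by linarith) h1 2
  have h6 : (1 - ‖(z : ℂ)‖ ^ 2) * (1 - ‖(z : ℂ)‖ ^ 2) =
      (1 - ‖(z : ℂ)‖) ^ 2 * (1 + ‖(z : ℂ)‖) ^ 2 := by ring
  rw [h6]
  nlinarith [sq_nonneg (1 - ‖(z : ℂ)‖)]

lemma le_poisson (z : Disc) (w : ClosedDisc) : (1 - ‖(z : ℂ)‖ ^ 2) / 4 ≤ poisson z w := by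
  have h3 := one_sub_pos z
  have h4 := denom_pos z w
  rw [poisson]
  refine div_le_div_of_nonneg_left h3.le (by positivity) ?_
  have h5 : ‖1 - conj (w : ℂ) * (z : ℂ)‖ ≤ 2 := by
    refine (norm_sub_le _ _).trans ?_
    rw [norm_one, norm_mul, RCLike.norm_conj]
    nlinarith [z.norm_lt_one, w.norm_le_one, norm_nonneg (z : ℂ), norm_nonneg (w : ℂ)]
  nlinarith

lemma mass_pos [NeZero μ] : 0 < mass μ :=
  ENNReal.toReal_pos (Measure.measure_univ_ne_zero.mpr (NeZero.ne μ)) (measure_ne_top μ _)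

lemma weightV_le (z : Disc) : weightV μ z ≤ mass μ * (4 / (1 - ‖(z : ℂ)‖ ^ 2)) := by
  have h := integral_mono (μ := μ) (integrable_poisson μ z) (integrable_const _) (poisson_le z)
  rwa [integral_const, smul_eq_mul] at h

lemma le_weightV (z : Disc) : mass μ * ((1 - ‖(z : ℂ)‖ ^ 2) / 4) ≤ weightV μ z := by
  have h := integral_mono (μ := μ) (integrable_const _) (integrable_poisson μ z) (le_poisson z)
  rwa [integral_const, smul_eq_mul] at h

/-- Together with `le_weightE` this squeezes the weight between multiples of `(1 - |z|²)³` and `1 -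
|z|²`, which is why `L²_{a,μ}` contains `H²` and lies in the Bergman space. -/
lemma weightE_le [NeZero μ] (z : Disc) : weightE μ z ≤ 4 / mass μ * (1 - ‖(z : ℂ)‖ ^ 2) := by
  have h1 := le_weightV μ z
  have h2 := one_sub_pos z
  have h3 := mass_pos μ
  rw [weightE, div_le_iff₀ (weightV_pos μ z)]
  calc (1 - ‖(z : ℂ)‖ ^ 2) ^ 2 = 4 / mass μ * (1 - ‖(z : ℂ)‖ ^ 2) *
        (mass μ * ((1 - ‖(z : ℂ)‖ ^ 2) / 4)) := by field_simp
    _ ≤ _ := mul_le_mul_of_nonneg_left h1 (by positivity)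

lemma le_weightE [NeZero μ] (z : Disc) : 1 / (4 * mass μ) * (1 - ‖(z : ℂ)‖ ^ 2) ^ 3 ≤ weightE μ z := by
  have h1 := weightV_le μ z
  have h2 := one_sub_pos z
  have h3 := mass_pos μ
  rw [weightE, le_div_iff₀ (weightV_pos μ z)]
  calc 1 / (4 * mass μ) * (1 - ‖(z : ℂ)‖ ^ 2) ^ 3 * weightV μ z ≤
        1 / (4 * mass μ) * (1 - ‖(z : ℂ)‖ ^ 2) ^ 3 * (mass μ * (4 / (1 - ‖(z : ℂ)‖ ^ 2))) :=
        mul_le_mul_of_nonneg_left h1 (by positivity)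
    _ = _ := by field_simp

/-- The square of the norm of `L²_{a,μ}`, with value in `[0, ∞]`. -/
noncomputable def weightedNormSq (f : Disc → ℂ) : ℝ≥0∞ :=
  ‖f origin‖ₑ ^ 2 + ∫⁻ z, ‖cderiv f z‖ₑ ^ 2 * ENNReal.ofReal (weightE μ z) ∂dA

lemma WeightedSpace.toFun_mem_hol (x : WeightedSpace μ) : WeightedSpace.toFun μ x ∈ Hol := x.2.1

lemma WeightedSpace.toFun_injective : Function.Injective (WeightedSpace.toFun μ) :=
  Subtype.val_injective

lemma enorm_sq_mul_ofReal (c : ℂ) (t : ℝ) :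
    ‖c‖ₑ ^ 2 * ENNReal.ofReal t = ENNReal.ofReal (‖c‖ ^ 2 * t) := by
  rw [enorm_sq_eq_ofReal, ENNReal.ofReal_mul (sq_nonneg _)]

lemma weightedNormSq_toFun [NeZero μ] (x : WeightedSpace μ) :
    weightedNormSq μ (WeightedSpace.toFun μ x) = ENNReal.ofReal (‖x‖ ^ 2) := by
  have h0 : ∀ z, 0 ≤ ‖cderiv (WeightedSpace.toFun μ x) z‖ ^ 2 * weightE μ z := fun z =>
    mul_nonneg (sq_nonneg _) (weightE_nonneg μ z)
  rw [WeightedSpace.norm_sq, ENNReal.ofReal_add (sq_nonneg _) (integral_nonneg h0),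
    ofReal_integral_eq_lintegral_ofReal (f := fun z => ‖cderiv (WeightedSpace.toFun μ x) z‖ ^ 2 *
      weightE μ z) x.2.2 (Eventually.of_forall h0), weightedNormSq,
    enorm_sq_eq_ofReal]
  simp_rw [enorm_sq_mul_ofReal]

lemma exists_weightedSpace {f : Disc → ℂ} (hf : f ∈ Hol) (h : weightedNormSq μ f < ∞) :
    ∃ x : WeightedSpace μ, WeightedSpace.toFun μ x = f := by
  refine ⟨⟨f, hf, ?_, ?_⟩, rfl⟩
  · exact (((measurable_cderiv hf).norm.pow_const 2).mul
      (measurable_weightE μ)).aestronglyMeasurable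
  · rw [hasFiniteIntegral_iff_enorm]
    have h1 : ∫⁻ z, ‖cderiv f z‖ₑ ^ 2 * ENNReal.ofReal (weightE μ z) ∂dA < ∞ :=
      lt_of_le_of_lt le_add_self h
    refine lt_of_le_of_lt (le_of_eq (lintegral_congr fun z => ?_)) h1
    rw [enorm_sq_mul_ofReal, ← ofReal_norm, Real.norm_eq_abs,
      abs_of_nonneg (mul_nonneg (sq_nonneg _) (weightE_nonneg μ z))]

lemma weightedNormSq_le [NeZero μ] {f : Disc → ℂ} (hf : f ∈ Hol) :
    weightedNormSq μ f ≤ ENNReal.ofReal (1 + 4 / mass μ) * sqsum (coeff f) := by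
  have hm := mass_pos μ
  rw [ENNReal.ofReal_add zero_le_one (by positivity), add_mul, ENNReal.ofReal_one, one_mul,
    weightedNormSq, ← coeff_zero_eq f]
  refine add_le_add (ENNReal.le_tsum 0) ?_
  refine le_trans (lintegral_mono fun z => ?_) (le_trans (le_of_eq (lintegral_const_mul'
    (ENNReal.ofReal (4 / mass μ))
    (fun z : Disc => ‖cderiv f z‖ₑ ^ 2 * ENNReal.ofReal (1 - ‖(z : ℂ)‖ ^ 2)) ENNReal.ofReal_ne_top))
    (mul_le_mul_right (lintegral_cderiv_one_sub_sq_le hf) _))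
  rw [mul_left_comm, ← ENNReal.ofReal_mul (by positivity)]
  exact mul_le_mul_right (ENNReal.ofReal_le_ofReal (weightE_le μ z)) _

/-- The left side is the squared norm in `L²_a((1 - |z|²) dA)`. By the lower bound for the weight it
suffices to compare it with `∫ |f'|² (1 - |z|²)³ dA`, which is done coefficient by coefficient and
reduces to `n + 4 ≤ 6 (n + 1)`. -/
lemma tsum_le_weightedNormSq [NeZero μ] {f : Disc → ℂ} (hf : f ∈ Hol) :
    ∑' n : ℕ, ‖coeff f n‖ₑ ^ 2 * ENNReal.ofReal (1 / ((n + 1) * (n + 2))) ≤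
      ENNReal.ofReal (1 + 4 * mass μ) * weightedNormSq μ f := by
  have hm := mass_pos μ
  have h1 : ∫⁻ z : Disc, ‖cderiv f z‖ₑ ^ 2 * ENNReal.ofReal ((1 - ‖(z : ℂ)‖ ^ 2) ^ 3) ∂dA ≤
      ENNReal.ofReal (4 * mass μ) *
        ∫⁻ z, ‖cderiv f z‖ₑ ^ 2 * ENNReal.ofReal (weightE μ z) ∂dA := by
    rw [← lintegral_const_mul' _ _ ENNReal.ofReal_ne_top]
    refine lintegral_mono fun z => ?_
    rw [mul_left_comm, ← ENNReal.ofReal_mul (by positivity)]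
    refine mul_le_mul_right (ENNReal.ofReal_le_ofReal ?_) _
    have := mul_le_mul_of_nonneg_left (le_weightE μ z) (by positivity : 0 ≤ 4 * mass μ)
    refine le_trans (le_of_eq ?_) this
    field_simp
  rw [lintegral_radial (cderiv_mem_hol hf) (ρ := fun r => ENNReal.ofReal ((1 - r ^ 2) ^ 3))
    (by fun_prop)] at h1
  rw [tsum_eq_zero_add' ENNReal.summable, weightedNormSq, mul_add (ENNReal.ofReal (1 + 4 * mass μ))]
  refine add_le_add ?_ ?_
  · rw [← coeff_zero_eq f, mul_comm]
    refine mul_le_mul_left (ENNReal.ofReal_le_ofReal ?_) _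
    norm_num
    linarith
  · have h2 : ENNReal.ofReal (4 * mass μ) ≤ ENNReal.ofReal (1 + 4 * mass μ) :=
      ENNReal.ofReal_le_ofReal (by linarith)
    refine le_trans ?_ (h1.trans (mul_le_mul_left h2 _))
    refine ENNReal.tsum_le_tsum fun n => ?_
    rw [moment_one_sub_sq_cube, coeff_cderiv, enorm_mul, mul_pow, mul_comm (_ ^ 2) (_ ^ 2), mul_assoc]
    refine mul_le_mul_right ?_ _
    have e : ‖(n + 1 : ℂ)‖ = n + 1 := by exact_mod_cast Complex.norm_natCast (n + 1)
    rw [enorm_sq_mul_ofReal, e]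
    refine ENNReal.ofReal_le_ofReal ?_
    push_cast
    have hn : (0 : ℝ) ≤ n := Nat.cast_nonneg n
    rw [mul_div_assoc', div_le_div_iff₀ (by positivity) (by positivity)]
    have : 0 ≤ ((n : ℝ) + 1) * (n + 2) * (n + 3) := by positivity
    nlinarith [mul_nonneg this hn]

/-- The estimate that yields both completeness and continuity of point evaluations. -/
lemma WeightedSpace.norm_coeff_le [NeZero μ] (x : WeightedSpace μ) (n : ℕ) :
    ‖coeff (WeightedSpace.toFun μ x) n‖ ≤ (2 + 4 * mass μ) * (n + 1) * ‖x‖ := by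
  have hm := mass_pos μ
  have h1 := (ENNReal.le_tsum n).trans (tsum_le_weightedNormSq μ x.2.1)
  have h2 : weightedNormSq μ x.1 = ENNReal.ofReal (‖x‖ ^ 2) := weightedNormSq_toFun μ x
  rw [h2, enorm_sq_mul_ofReal, ← ENNReal.ofReal_mul (by positivity),
    ENNReal.ofReal_le_ofReal_iff (by positivity), mul_one_div, div_le_iff₀ (by positivity)] at h1
  have hn : (0 : ℝ) ≤ n := Nat.cast_nonneg n
  refine le_of_sq_le_sq ?_ (by positivity)
  refine h1.trans ?_
  have h3 : (1 + 4 * mass μ) * (((n : ℝ) + 1) * (n + 2)) ≤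
      ((2 + 4 * mass μ) * (n + 1)) ^ 2 := by
    have : ((n : ℝ) + 1) * (n + 2) ≤ 2 * (n + 1) ^ 2 := by nlinarith
    nlinarith [mul_le_mul_of_nonneg_left this (by positivity : 0 ≤ 1 + 4 * mass μ),
      sq_nonneg ((n : ℝ) + 1), mul_nonneg hm.le (sq_nonneg ((n : ℝ) + 1)),
      mul_nonneg (mul_nonneg hm.le hm.le) (sq_nonneg ((n : ℝ) + 1))]
  nlinarith [mul_le_mul_of_nonneg_right h3 (sq_nonneg ‖x‖)]

lemma add_le_liminf {u v : ℕ → ℝ≥0∞} {a b : ℝ≥0∞} (ha : a ≤ liminf u atTop)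
    (hb : b ≤ liminf v atTop) : a + b ≤ liminf (fun k => u k + v k) atTop := by
  refine (add_le_add ha hb).trans ?_
  simp only [liminf_eq_iSup_iInf_of_nat']
  have hmono : ∀ w : ℕ → ℝ≥0∞, Monotone fun n => ⨅ i, w (i + n) := fun w m n hmn =>
    le_iInf fun i => iInf_le_of_le (i + (n - m)) (le_of_eq (by congr 1; omega))
  rw [ENNReal.iSup_add_iSup_of_monotone (hmono u) (hmono v)]
  exact iSup_mono fun n => le_iInf fun i => add_le_add (iInf_le _ i) (iInf_le _ i)

lemma weightedNormSq_le_liminf {g : ℕ → Disc → ℂ} {h : Disc → ℂ} (H : HolTendsto g h) :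
    weightedNormSq μ h ≤ liminf (fun k => weightedNormSq μ (g k)) atTop := by
  refine add_le_liminf ?_ (lintegral_cderiv_le_liminf
    (ENNReal.measurable_ofReal.comp (measurable_weightE μ))
    (Eventually.of_forall fun z => ENNReal.ofReal_ne_top) H)
  exact (((ENNReal.continuous_pow 2).tendsto _).comp (H.val origin).enorm).liminf_eq.ge

instance [NeZero μ] : CompleteSpace (WeightedSpace μ) :=
  completeSpace_of_lsc (WeightedSpace.toFun μ) (Q := weightedNormSq μ)
    (WeightedSpace.toFun_mem_hol μ) (weightedNormSq_toFun μ)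
    (fun _ hf h => exists_weightedSpace μ hf h) (WeightedSpace.norm_coeff_le μ)
    (fun _ _ H => weightedNormSq_le_liminf μ H)

end Weighted

/-! ### The space `E(μ)` -/

section SpaceE

variable (μ : Measure ClosedDisc) [IsFiniteMeasure μ] [NeZero μ]

lemma WeightedSpace.norm_toFun_le (x : WeightedSpace μ) (z : Disc) :
    ‖WeightedSpace.toFun μ x z‖ ≤
      (∑' n : ℕ, (2 + 4 * mass μ) * ((n : ℝ) + 1) ^ 2 * ‖(z : ℂ)‖ ^ n) * ‖x‖ := by
  have hm := mass_pos μ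
  rw [← tsum_mul_right]
  have hs := (summable_sq_mul_pow z (2 + 4 * mass μ)).mul_right ‖x‖
  rw [← (hasSum_coeff (WeightedSpace.toFun_mem_hol μ x) z).tsum_eq]
  refine tsum_of_norm_bounded hs.hasSum fun n => ?_
  rw [norm_mul, norm_pow]
  have h1 := WeightedSpace.norm_coeff_le μ x n
  have hn : (0 : ℝ) ≤ n := Nat.cast_nonneg n
  calc ‖coeff (WeightedSpace.toFun μ x) n‖ * ‖(z : ℂ)‖ ^ n
      ≤ ((2 + 4 * mass μ) * (n + 1) * ‖x‖) * ‖(z : ℂ)‖ ^ n := by gcongr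
    _ ≤ ((2 + 4 * mass μ) * ((n : ℝ) + 1) ^ 2 * ‖x‖) * ‖(z : ℂ)‖ ^ n := by
        gcongr
        nlinarith
    _ = _ := by ring

/-- Point evaluation on `L²_{a,μ}`. -/
noncomputable def WeightedSpace.evalCLM (z : Disc) : WeightedSpace μ →L[ℂ] ℂ :=
  (LinearMap.proj z ∘ₗ WeightedSpace.toFun μ).mkContinuous _
    fun x => WeightedSpace.norm_toFun_le μ x z

lemma WeightedSpace.evalCLM_apply (z : Disc) (x : WeightedSpace μ) :
    WeightedSpace.evalCLM μ z x = WeightedSpace.toFun μ x z := rfl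

/-- The polynomials, as a subspace of `L²_{a,μ}`. -/
def polyE : Submodule ℂ (WeightedSpace μ) := polynomials.comap (WeightedSpace.toFun μ)

lemma mem_E_of_mem_polyE {x : WeightedSpace μ} (hx : x ∈ polyE μ) : x ∈ E μ :=
  Submodule.le_topologicalClosure _ hx

lemma partialSum_mem_polynomials (a : ℕ → ℂ) (N : ℕ) : partialSum a N ∈ polynomials :=
  ⟨∑ n ∈ Finset.range N, Polynomial.C (a n) * Polynomial.X ^ n, fun z => by
    simp [partialSum, Polynomial.eval_finsetSum]⟩

lemma exists_partialSum_of_mem_polynomials {f : Disc → ℂ} (hf : f ∈ polynomials) :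
    ∃ (a : ℕ → ℂ) (N : ℕ), f = partialSum a N := by
  obtain ⟨p, hp⟩ := hf
  refine ⟨p.coeff, p.natDegree + 1, funext fun z => ?_⟩
  rw [hp, Polynomial.eval_eq_sum_range]
  rfl

lemma isClosed_E : IsClosed (E μ : Set (WeightedSpace μ)) :=
  Submodule.isClosed_topologicalClosure _

instance : CompleteSpace (E μ) := (isClosed_E μ).completeSpace_coe

/-- The evaluations make `E(μ)` a reproducing kernel Hilbert space. -/
@[reducible]
noncomputable def rkhsE : RKHS ℂ (E μ) Disc ℂ where
  coeCLM := ContinuousLinearMap.pi fun z => (WeightedSpace.evalCLM μ z).comp (E μ).subtypeL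
  coeCLM_injective _ _ h := Subtype.ext (WeightedSpace.toFun_injective μ h)

lemma tendsto_sqsum_sub_partialSum {f : Disc → ℂ} (hf : f ∈ Hol) (h : sqsum (coeff f) < ∞) :
    Tendsto (fun N => sqsum (coeff (f - partialSum (coeff f) N))) atTop (𝓝 0) := by
  have h1 := ENNReal.tendsto_sum_nat_add (fun n => ‖coeff f n‖ₑ ^ 2) h.ne
  refine h1.congr fun N => ?_
  have h2 : sqsum (coeff (f - partialSum (coeff f) N)) =
      ∑' n, if n < N then 0 else ‖coeff f n‖ₑ ^ 2 := by
    rw [coeff_sub hf (partialSum_mem_hol _ _), coeff_partialSum]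
    refine tsum_congr fun n => ?_
    by_cases hn : n < N <;> simp [hn]
  rw [h2, ← Summable.sum_add_tsum_nat_add' (f := fun n => if n < N then 0 else ‖coeff f n‖ₑ ^ 2)
    (k := N) ENNReal.summable, Finset.sum_eq_zero fun n hn => if_pos (Finset.mem_range.mp hn),
    zero_add]
  exact tsum_congr fun n => (if_neg (by omega)).symm

/-- Taylor polynomials converge in `H²`, whose norm dominates that of `L²_{a,μ}`, so `H²` lies in
the closure of the polynomials. -/
lemma hardyTwo_subset_carrierE : hardyTwo ⊆ carrierE μ := by
  rintro f ⟨hf, hs⟩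
  have hs' : sqsum (coeff f) < ∞ := sqsum_lt_top_iff.mpr hs
  have hfin : ∀ g ∈ Hol, sqsum (coeff g) < ∞ → ∃ x : WeightedSpace μ, WeightedSpace.toFun μ x = g :=
    fun g hg h => exists_weightedSpace μ hg (lt_of_le_of_lt (weightedNormSq_le μ hg)
      (ENNReal.mul_lt_top ENNReal.ofReal_lt_top h))
  obtain ⟨x, hx⟩ := hfin f hf hs'
  have hp : ∀ N, sqsum (coeff (partialSum (coeff f) N)) < ∞ := fun N => by
    rw [coeff_partialSum, sqsum_partial]
    exact ENNReal.sum_lt_top.mpr fun n _ => by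
      rw [enorm_sq_eq_ofReal]; exact ENNReal.ofReal_lt_top
  choose y hy using fun N => hfin _ (partialSum_mem_hol (coeff f) N) (hp N)
  refine ⟨x, ?_, hx⟩
  refine (isClosed_E μ).mem_of_tendsto (f := y) (b := atTop) ?_ (Eventually.of_forall fun N => ?_)
  · have h1 : Tendsto (fun N => ENNReal.ofReal (‖y N - x‖ ^ 2)) atTop (𝓝 0) := by
      have h2 := ENNReal.Tendsto.const_mul (a := ENNReal.ofReal (1 + 4 / mass μ))
        (tendsto_sqsum_sub_partialSum hf hs') (Or.inr ENNReal.ofReal_ne_top)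
      rw [mul_zero] at h2
      refine tendsto_of_tendsto_of_tendsto_of_le_of_le tendsto_const_nhds h2 (fun _ => zero_le)
        fun N => ?_
      have h3 := weightedNormSq_le μ (Hol.sub_mem hf (partialSum_mem_hol (coeff f) N))
      have e : f - partialSum (coeff f) N = WeightedSpace.toFun μ (x - y N) := by
        rw [map_sub, hx, hy]
      rw [norm_sub_rev, ← weightedNormSq_toFun, ← e]
      exact h3
    have h2 := (ENNReal.tendsto_toReal ENNReal.zero_ne_top).comp h1
    rw [tendsto_iff_norm_sub_tendsto_zero]
    have h3 := (Real.continuous_sqrt.tendsto _).comp h2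
    simp only [Function.comp_def, ENNReal.toReal_zero, Real.sqrt_zero] at h3
    refine h3.congr fun N => ?_
    rw [ENNReal.toReal_ofReal (sq_nonneg _), Real.sqrt_sq (norm_nonneg _)]
  · refine mem_E_of_mem_polyE μ ?_
    change WeightedSpace.toFun μ (y N) ∈ polynomials
    rw [hy]
    exact partialSum_mem_polynomials _ _

lemma carrierE_subset_bergman : carrierE μ ⊆ bergman := by
  rintro _ ⟨x, -, rfl⟩
  have hf := WeightedSpace.toFun_mem_hol μ x
  refine ⟨hf, ?_, ?_⟩
  · have := continuous_hol hf
    exact Continuous.aestronglyMeasurable (by fun_prop)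
  · rw [hasFiniteIntegral_iff_enorm]
    have h1 := tsum_le_weightedNormSq μ hf
    rw [← lintegral_one_sub_sq hf, weightedNormSq_toFun, ← ENNReal.ofReal_mul (by
      have := mass_pos μ; positivity)] at h1
    refine lt_of_le_of_lt (le_of_eq (lintegral_congr fun z => ?_))
      (lt_of_le_of_lt h1 ENNReal.ofReal_lt_top)
    rw [enorm_sq_mul_ofReal, ← ofReal_norm, Real.norm_eq_abs,
      abs_of_nonneg (mul_nonneg (sq_nonneg _) (one_sub_pos z).le)]

end SpaceE

/-! ### The Hilbert space `D(μ)` -/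

/-- The Dirichlet integral `∫ |f'|² U_μ dA`. -/
noncomputable def energy (μ : Measure ClosedDisc) (f : Disc → ℂ) : ℝ≥0∞ :=
  ∫⁻ z, ‖cderiv f z‖ₑ ^ 2 * weightU μ z ∂dA

lemma dirichletNormSq_eq (μ : Measure ClosedDisc) (f : Disc → ℂ) :
    dirichletNormSq μ f = sqsum (coeff f) + energy μ f := rfl

section Basic

variable (μ : Measure ClosedDisc) [IsFiniteMeasure μ]

/-- `U_μ` can be infinite, for instance at atoms of `μ` in the disc. Its integral is the energy of
the coordinate function, at most the mass of `μ`. -/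
lemma ae_weightU_ne_top : ∀ᵐ z ∂dA, weightU μ z ≠ ∞ := by
  suffices h : ∫⁻ z, weightU μ z ∂dA ≠ ∞ from
    (ae_lt_top (measurable_weightU μ) h).mono fun _ hz => hz.ne
  have hf : coordSub 0 ∈ Hol := coordSub_mem_hol 0
  have h1 := lintegral_weightU μ hf
  simp only [cderiv_coordSub, enorm_one, one_pow, one_mul] at h1
  rw [h1]
  refine ne_top_of_le_ne_top (measure_ne_top μ Set.univ) ?_
  refine (lintegral_mono fun w => locDir_le_of_bound w (f := coordSub 0) (C := 1) fun z => ?_).trans ?_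
  · simp [cderiv_coordSub]
  · simp

lemma energy_eq_lintegral_locDir {f : Disc → ℂ} (hf : f ∈ Hol) :
    energy μ f = ∫⁻ w, locDir w f ∂μ := lintegral_weightU μ hf

lemma le_weightU (z : Disc) : ENNReal.ofReal (mass μ * ((1 - ‖(z : ℂ)‖ ^ 2) / 4)) ≤ weightU μ z := by
  rw [weightU_eq]
  refine le_trans ?_ (lintegral_mono fun w => (ENNReal.ofReal_le_ofReal (le_poisson z w)).trans
    (poisson_le_locKernel z w))
  rw [lintegral_const, mul_comm (mass μ), ENNReal.ofReal_mul (by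
    have := one_sub_pos z; positivity), mass, ofReal_measureReal]

/-- The inclusion of `D(μ)` in `H²`: `U_μ ≥ V_μ` dominates a multiple of `1 - |z|²`, and `∫ |f'|² (1
- |z|²) dA` controls the coefficients past the first because `2 (n + 1) ≥ n + 2`. -/
lemma sqsum_coeff_le [NeZero μ] {f : Disc → ℂ} (hf : f ∈ Hol) :
    sqsum (coeff f) ≤ ‖f origin‖ₑ ^ 2 + ENNReal.ofReal (8 / mass μ) * energy μ f := by
  have hm := mass_pos μ
  have h1 : ∫⁻ z : Disc, ‖cderiv f z‖ₑ ^ 2 * ENNReal.ofReal (1 - ‖(z : ℂ)‖ ^ 2) ∂dA ≤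
      ENNReal.ofReal (4 / mass μ) * energy μ f := by
    rw [energy, ← lintegral_const_mul' _ _ ENNReal.ofReal_ne_top]
    refine lintegral_mono fun z => ?_
    rw [mul_left_comm]
    refine mul_le_mul_right ?_ _
    refine le_trans (le_of_eq ?_) (mul_le_mul_right (le_weightU μ z) _)
    rw [← ENNReal.ofReal_mul (by positivity)]
    congr 1
    field_simp
  rw [lintegral_one_sub_sq (cderiv_mem_hol hf)] at h1
  rw [sqsum, tsum_eq_zero_add' ENNReal.summable, coeff_zero_eq f]
  refine add_le_add le_rfl ?_
  have h2 : ENNReal.ofReal (8 / mass μ) = 2 * ENNReal.ofReal (4 / mass μ) := by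
    rw [← ENNReal.ofReal_ofNat 2, ← ENNReal.ofReal_mul zero_le_two]
    congr 1
    ring
  rw [h2, mul_assoc]
  refine le_trans ?_ (mul_le_mul_right h1 _)
  rw [← ENNReal.tsum_mul_left]
  refine ENNReal.tsum_le_tsum fun n => ?_
  have e : ‖(n + 1 : ℂ)‖ = n + 1 := by exact_mod_cast Complex.norm_natCast (n + 1)
  have hn : (0 : ℝ) ≤ n := Nat.cast_nonneg n
  rw [coeff_cderiv, enorm_sq_mul_ofReal, enorm_sq_eq_ofReal, ← ENNReal.ofReal_ofNat 2,
    ← ENNReal.ofReal_mul zero_le_two, norm_mul, e]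
  refine ENNReal.ofReal_le_ofReal ?_
  have h3 : 2 * ((((n : ℝ) + 1) * ‖coeff f (n + 1)‖) ^ 2 * (1 / (((n : ℝ) + 1) * (n + 2)))) =
      (2 * ((n : ℝ) + 1) / (n + 2)) * ‖coeff f (n + 1)‖ ^ 2 := by field_simp
  rw [h3]
  refine le_mul_of_one_le_left (sq_nonneg _) ?_
  rw [le_div_iff₀ (by positivity)]
  linarith

lemma sqsum_coeff_lt_top [NeZero μ] {f : Disc → ℂ} (hf : f ∈ Hol) (h : energy μ f < ∞) :
    sqsum (coeff f) < ∞ :=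
  lt_of_le_of_lt (sqsum_coeff_le μ hf) (ENNReal.add_lt_top.mpr
    ⟨by rw [enorm_sq_eq_ofReal]; exact ENNReal.ofReal_lt_top,
      ENNReal.mul_lt_top ENNReal.ofReal_lt_top h⟩)

lemma dirichletNormSq_lt_top [NeZero μ] {f : Disc → ℂ} (hf : f ∈ Hol) (h : energy μ f < ∞) :
    dirichletNormSq μ f < ∞ := by
  rw [dirichletNormSq_eq]
  exact ENNReal.add_lt_top.mpr ⟨sqsum_coeff_lt_top μ hf h, h⟩

lemma ofReal_mul_toReal_weightU (f : Disc → ℂ) : ∀ᵐ z ∂dA,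
    ENNReal.ofReal (‖cderiv f z‖ ^ 2 * (weightU μ z).toReal) =
      ‖cderiv f z‖ₑ ^ 2 * weightU μ z := by
  filter_upwards [ae_weightU_ne_top μ] with z hz
  rw [← enorm_sq_mul_ofReal, ENNReal.ofReal_toReal hz]

lemma integrable_energy {f : Disc → ℂ} (hf : f ∈ Hol) (h : energy μ f < ∞) :
    Integrable (fun z => ‖cderiv f z‖ ^ 2 * (weightU μ z).toReal) dA := by
  refine ⟨(((measurable_cderiv hf).norm.pow_const 2).mul
      (measurable_weightU μ).ennreal_toReal).aestronglyMeasurable, ?_⟩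
  rw [hasFiniteIntegral_iff_enorm]
  refine lt_of_le_of_lt (le_of_eq (lintegral_congr_ae ?_)) h
  filter_upwards [ofReal_mul_toReal_weightU μ f] with z hz
  rw [← hz, ← ofReal_norm, Real.norm_eq_abs,
    abs_of_nonneg (mul_nonneg (sq_nonneg _) ENNReal.toReal_nonneg)]

lemma energy_eq_ofReal {f : Disc → ℂ} (hf : f ∈ Hol) (h : energy μ f < ∞) :
    energy μ f = ENNReal.ofReal (∫ z, ‖cderiv f z‖ ^ 2 * (weightU μ z).toReal ∂dA) := by
  rw [ofReal_integral_eq_lintegral_ofReal (integrable_energy μ hf h)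
    (Eventually.of_forall fun z => mul_nonneg (sq_nonneg _) ENNReal.toReal_nonneg)]
  exact lintegral_congr_ae ((ofReal_mul_toReal_weightU μ f).mono fun z hz => hz.symm)

lemma integrable_energy_mul {f g : Disc → ℂ} (hf : f ∈ Hol) (hg : g ∈ Hol) (h : energy μ f < ∞)
    (h' : energy μ g < ∞) :
    Integrable (fun z => cderiv f z * conj (cderiv g z) * ((weightU μ z).toReal : ℂ)) dA := by
  refine ((integrable_energy μ hf h).add (integrable_energy μ hg h')).mono' ?_
    (Eventually.of_forall fun z => ?_)
  · refine Measurable.aestronglyMeasurable ?_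
    exact ((measurable_cderiv hf).mul (Complex.continuous_conj.measurable.comp
      (measurable_cderiv hg))).mul
      (Complex.measurable_ofReal.comp (measurable_weightU μ).ennreal_toReal)
  · have h0 : 0 ≤ (weightU μ z).toReal := ENNReal.toReal_nonneg
    simp only [norm_mul, RCLike.norm_conj, Complex.norm_real, Real.norm_eq_abs, abs_of_nonneg h0,
      Pi.add_apply]
    nlinarith [mul_nonneg (sq_nonneg (‖cderiv f z‖ - ‖cderiv g z‖)) h0,
      mul_nonneg (mul_nonneg (norm_nonneg (cderiv f z)) (norm_nonneg (cderiv g z))) h0]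

lemma summable_mul_conj {a b : ℕ → ℂ} (ha : sqsum a < ∞) (hb : sqsum b < ∞) :
    Summable fun n => a n * conj (b n) := by
  refine Summable.of_norm_bounded ((sqsum_lt_top_iff.mp ha).add (sqsum_lt_top_iff.mp hb))
    fun n => ?_
  rw [norm_mul, RCLike.norm_conj]
  nlinarith [sq_nonneg (‖a n‖ - ‖b n‖), norm_nonneg (a n), norm_nonneg (b n)]

lemma dirichletInner_self [NeZero μ] {f : Disc → ℂ} (hf : f ∈ Hol) (h : energy μ f < ∞) :
    dirichletInner μ f f = ((dirichletNormSq μ f).toReal : ℂ) := by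
  have hs := sqsum_coeff_lt_top μ hf h
  rw [dirichletNormSq_eq, ENNReal.toReal_add hs.ne h.ne, energy_eq_ofReal μ hf h,
    sqsum_eq_ofReal (sqsum_lt_top_iff.mp hs), ENNReal.toReal_ofReal (tsum_nonneg fun n => sq_nonneg _),
    ENNReal.toReal_ofReal (integral_nonneg fun z => mul_nonneg (sq_nonneg _) ENNReal.toReal_nonneg),
    dirichletInner]
  push_cast
  rw [← integral_complex_ofReal]
  simp only [Complex.mul_conj']
  push_cast
  rfl

/-- `D(μ)` as a linear space. -/
def dirichletSubmodule : Submodule ℂ (Disc → ℂ) where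
  carrier := dirichletSpace μ
  zero_mem' := by
    refine ⟨Hol.zero_mem, ?_⟩
    have : ∀ z, cderiv 0 z = 0 := fun z => by simp [cderiv, ext_zero]
    simp [this]
  add_mem' := by
    rintro f g ⟨hf, hf2⟩ ⟨hg, hg2⟩
    refine ⟨Hol.add_mem hf hg, ?_⟩
    have h1 : ∫⁻ z, ‖cderiv (f + g) z‖ₑ ^ 2 * weightU μ z ∂dA ≤
        2 * ∫⁻ z, ‖cderiv f z‖ₑ ^ 2 * weightU μ z ∂dA +
          2 * ∫⁻ z, ‖cderiv g z‖ₑ ^ 2 * weightU μ z ∂dA := by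
      rw [← lintegral_const_mul' _ _ ENNReal.ofNat_ne_top,
        ← lintegral_const_mul' _ _ ENNReal.ofNat_ne_top, ← lintegral_add_left]
      · refine lintegral_mono fun z => ?_
        rw [cderiv_add hf hg, ← mul_assoc, ← mul_assoc, ← add_mul]
        exact mul_le_mul_left (enorm_add_sq_le _ _) _
      · exact (((measurable_cderiv hf).enorm.pow_const 2).mul (measurable_weightU μ)).const_mul 2
    exact lt_of_le_of_lt h1 (ENNReal.add_lt_top.mpr
      ⟨ENNReal.mul_lt_top ENNReal.ofNat_lt_top hf2, ENNReal.mul_lt_top ENNReal.ofNat_lt_top hg2⟩)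
  smul_mem' := by
    rintro c f ⟨hf, hf2⟩
    refine ⟨Hol.smul_mem c hf, ?_⟩
    simp only [cderiv_smul c hf, enorm_mul, mul_pow, mul_assoc]
    rw [lintegral_const_mul' _ _ (by rw [enorm_sq_eq_ofReal]; exact ENNReal.ofReal_ne_top)]
    exact ENNReal.mul_lt_top (by rw [enorm_sq_eq_ofReal]; exact ENNReal.ofReal_lt_top) hf2

/-- `D(μ)` as a type. -/
def DSpace : Type := dirichletSubmodule μ

instance : AddCommGroup (DSpace μ) := inferInstanceAs (AddCommGroup (dirichletSubmodule μ))

instance : Module ℂ (DSpace μ) := inferInstanceAs (Module ℂ (dirichletSubmodule μ))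

/-- The elements of `D(μ)` as functions on the disc. -/
def DSpace.toFun : DSpace μ →ₗ[ℂ] (Disc → ℂ) := (dirichletSubmodule μ).subtype

lemma DSpace.mem_hol (x : DSpace μ) : DSpace.toFun μ x ∈ Hol := x.2.1

lemma DSpace.energy_lt_top (x : DSpace μ) : energy μ (DSpace.toFun μ x) < ∞ := x.2.2

lemma exists_dSpace {f : Disc → ℂ} (hf : f ∈ Hol) (h : dirichletNormSq μ f < ∞) :
    ∃ x : DSpace μ, DSpace.toFun μ x = f :=
  ⟨⟨f, hf, lt_of_le_of_lt le_add_self h⟩, rfl⟩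

lemma dirichletNormSq_le_liminf {g : ℕ → Disc → ℂ} {h : Disc → ℂ} (H : HolTendsto g h) :
    dirichletNormSq μ h ≤ liminf (fun k => dirichletNormSq μ (g k)) atTop :=
  add_le_liminf (sqsum_le_liminf H.coeff)
    (lintegral_cderiv_le_liminf (measurable_weightU μ) (ae_weightU_ne_top μ) H)

variable [NeZero μ]

lemma DSpace.sqsum_lt_top (x : DSpace μ) : sqsum (coeff (DSpace.toFun μ x)) < ∞ :=
  sqsum_coeff_lt_top μ x.2.1 x.2.2

/-- The inner product of `D(μ)`, conjugate linear in the first variable. -/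
@[reducible]
noncomputable def DSpace.core : InnerProductSpace.Core ℂ (DSpace μ) where
  inner f g := dirichletInner μ (DSpace.toFun μ g) (DSpace.toFun μ f)
  conj_inner_symm f g := by
    simp only [dirichletInner, map_add, ← integral_conj, Complex.conj_tsum, map_mul,
      Complex.conj_conj, Complex.conj_ofReal]
    congr 1
    · exact tsum_congr fun n => mul_comm _ _
    · congr 1
      funext z
      ring
  re_inner_nonneg f := by
    rw [dirichletInner_self μ (DSpace.mem_hol μ f) (DSpace.energy_lt_top μ f)]
    exact ENNReal.toReal_nonneg
  add_left f g h := by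
    have hf := DSpace.mem_hol μ f
    have hg := DSpace.mem_hol μ g
    have hh := DSpace.mem_hol μ h
    rw [map_add]
    simp only [dirichletInner, coeff_add hf hg, cderiv_add hf hg, Pi.add_apply, map_add, mul_add,
      add_mul]
    rw [integral_add (integrable_energy_mul μ hh hf (DSpace.energy_lt_top μ h)
      (DSpace.energy_lt_top μ f)) (integrable_energy_mul μ hh hg (DSpace.energy_lt_top μ h)
      (DSpace.energy_lt_top μ g)), (summable_mul_conj (DSpace.sqsum_lt_top μ h)
      (DSpace.sqsum_lt_top μ f)).tsum_add (summable_mul_conj (DSpace.sqsum_lt_top μ h)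
      (DSpace.sqsum_lt_top μ g))]
    ring
  smul_left f g c := by
    have hf := DSpace.mem_hol μ f
    rw [map_smul]
    simp only [dirichletInner, coeff_smul c hf, cderiv_smul c hf, Pi.smul_apply, smul_eq_mul,
      map_mul, mul_add]
    rw [← tsum_mul_left, ← integral_const_mul]
    congr 1
    · exact tsum_congr fun n => by ring
    · congr 1
      funext z
      ring
  definite f hf := by
    have hd := dirichletInner_self μ (DSpace.mem_hol μ f) (DSpace.energy_lt_top μ f)
    rw [hd] at hf
    have h1 : (dirichletNormSq μ (DSpace.toFun μ f)).toReal = 0 := by exact_mod_cast hf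
    rw [ENNReal.toReal_eq_zero_iff, dirichletNormSq_eq] at h1
    have h2 : sqsum (coeff (DSpace.toFun μ f)) = 0 := by
      rcases h1 with h1 | h1
      · exact (add_eq_zero.mp h1).1
      · exact absurd h1 (dirichletNormSq_lt_top μ f.2.1 f.2.2).ne
    rw [sqsum, ENNReal.tsum_eq_zero] at h2
    refine Subtype.ext (eq_of_coeff_eq f.2.1 Hol.zero_mem (funext fun n => ?_))
    have h3 := h2 n
    have h4 : coeff 0 n = 0 := by
      have := congrFun (coeff_smul 0 Hol.zero_mem) n
      simpa using this
    rw [pow_eq_zero_iff two_ne_zero, enorm_eq_zero] at h3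
    exact h3.trans h4.symm

noncomputable instance : NormedAddCommGroup (DSpace μ) := (DSpace.core μ).toNormedAddCommGroup

noncomputable instance : InnerProductSpace ℂ (DSpace μ) :=
  InnerProductSpace.ofCore (DSpace.core μ).toCore

lemma DSpace.inner_eq (f g : DSpace μ) :
    inner ℂ f g = dirichletInner μ (DSpace.toFun μ g) (DSpace.toFun μ f) := rfl

lemma DSpace.normSq_eq (f : DSpace μ) :
    dirichletNormSq μ (DSpace.toFun μ f) = ENNReal.ofReal (‖f‖ ^ 2) := by
  have h1 : ((‖f‖ ^ 2 : ℝ) : ℂ) = inner ℂ f f := by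
    rw [inner_self_eq_norm_sq_to_K]
    push_cast
    rfl
  rw [DSpace.inner_eq, dirichletInner_self μ (DSpace.mem_hol μ f) (DSpace.energy_lt_top μ f)] at h1
  have h2 : ‖f‖ ^ 2 = (dirichletNormSq μ (DSpace.toFun μ f)).toReal := by exact_mod_cast h1
  rw [h2, ENNReal.ofReal_toReal (dirichletNormSq_lt_top μ (DSpace.mem_hol μ f)
    (DSpace.energy_lt_top μ f)).ne]

lemma DSpace.norm_coeff_le (x : DSpace μ) (n : ℕ) : ‖coeff (DSpace.toFun μ x) n‖ ≤ ‖x‖ := by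
  have h1 : ‖coeff (DSpace.toFun μ x) n‖ₑ ^ 2 ≤ dirichletNormSq μ (DSpace.toFun μ x) :=
    (ENNReal.le_tsum n).trans le_self_add
  rw [DSpace.normSq_eq, enorm_sq_eq_ofReal, ENNReal.ofReal_le_ofReal_iff (by positivity)] at h1
  exact le_of_sq_le_sq h1 (norm_nonneg _)

instance : CompleteSpace (DSpace μ) :=
  completeSpace_of_lsc (DSpace.toFun μ) (Q := dirichletNormSq μ) (C := 1)
    (DSpace.mem_hol μ) (DSpace.normSq_eq μ) (fun _ hf h => exists_dSpace μ hf h)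
    (fun x n => (DSpace.norm_coeff_le μ x n).trans (by
      have hn : (0 : ℝ) ≤ n := Nat.cast_nonneg n
      nlinarith [mul_nonneg hn (norm_nonneg x)]))
    (fun _ _ H => dirichletNormSq_le_liminf μ H)

end Basic

/-! ### Density of the polynomials in `D(μ)` -/

lemma lintegral_mul_sq_le {α : Type*} [MeasurableSpace α] (ν : Measure α) {f g : α → ℝ≥0∞}
    (hf : AEMeasurable f ν) (hg : AEMeasurable g ν) :
    (∫⁻ x, f x * g x ∂ν) ^ 2 ≤ (∫⁻ x, f x ^ 2 ∂ν) * ∫⁻ x, g x ^ 2 ∂ν := by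
  have h := ENNReal.lintegral_mul_le_Lp_mul_Lq ν Real.HolderConjugate.two_two hf hg
  have e : ∀ t : ℝ≥0∞, (t ^ (1 / 2 : ℝ)) ^ 2 = t := fun t => by
    rw [← ENNReal.rpow_natCast, ← ENNReal.rpow_mul]
    norm_num
  have h2 := pow_le_pow_left₀ zero_le h 2
  rw [mul_pow, e, e] at h2
  simpa using h2

/-- Cauchy–Schwarz against the constant `1`, for counting measure with density `u`. -/
lemma tsum_mul_sq_le (u a : ℕ → ℝ≥0∞) :
    (∑' j, u j * a j) ^ 2 ≤ (∑' j, u j) * ∑' j, u j * a j ^ 2 := by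
  have hm : ∀ v : ℕ → ℝ≥0∞, Measurable v := fun v => measurable_from_nat
  have h := lintegral_mul_sq_le (Measure.count.withDensity u) (f := fun _ => 1) (g := a)
    (hm _).aemeasurable (hm _).aemeasurable
  rw [lintegral_withDensity_eq_lintegral_mul _ (hm u) (hm _),
    lintegral_withDensity_eq_lintegral_mul _ (hm u) (hm _),
    lintegral_withDensity_eq_lintegral_mul _ (hm u) (hm _)] at h
  simpa [lintegral_count] using h

/-- The tails `∑_{j ≥ 1} (r w)^j F_{n+j}`. -/
noncomputable def dilTail (w : ℂ) (r : ℝ) (F : ℕ → ℂ) (n : ℕ) : ℂ :=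
  ∑' j : ℕ, ((r : ℂ) * w) ^ (j + 1) * F (n + j + 1)

lemma summable_dilTail {w : ℂ} (hw : ‖w‖ ≤ 1) {r : ℝ} (hr0 : 0 ≤ r) (hr1 : r < 1) {F : ℕ → ℂ}
    (hF : sqsum F < ∞) (n : ℕ) : Summable fun j : ℕ => ((r : ℂ) * w) ^ (j + 1) * F (n + j + 1) := by
  obtain ⟨C, hC⟩ := norm_le_of_sqsum_lt_top hF
  have hC0 : 0 ≤ C := (norm_nonneg _).trans (hC 0)
  refine Summable.of_norm_bounded ((summable_geometric_of_lt_one hr0 hr1).mul_right C) fun j => ?_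
  rw [norm_mul, norm_pow, norm_mul, Complex.norm_real, Real.norm_eq_abs, abs_of_nonneg hr0]
  refine mul_le_mul ?_ (hC _) (norm_nonneg _) (by positivity)
  have h1 : r * ‖w‖ ≤ r := mul_le_of_le_one_right hr0 hw
  refine (pow_le_pow_left₀ (by positivity) h1 _).trans ?_
  exact pow_le_pow_of_le_one hr0 hr1.le (by omega)

lemma dilTail_eq {w : ℂ} (hw : ‖w‖ ≤ 1) {r : ℝ} (hr0 : 0 ≤ r) (hr1 : r < 1) {F : ℕ → ℂ}
    (hF : sqsum F < ∞) (n : ℕ) :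
    dilTail w r F n = r * w * F (n + 1) + r * w * dilTail w r F (n + 1) := by
  rw [dilTail, (summable_dilTail hw hr0 hr1 hF n).tsum_eq_zero_add, dilTail, ← tsum_mul_left]
  congr 1
  · simp
  · refine tsum_congr fun j => ?_
    rw [show n + (j + 1) + 1 = n + 1 + j + 1 by ring]
    ring

/-- The operator `F ↦ ∑ (r w)^j S^j F`, with `S` the backward shift, has norm at most `∑ r^j = 1 /
(1 - r)` on `ℓ²`. -/
lemma sqsum_dilTail_le {w : ℂ} (hw : ‖w‖ ≤ 1) {r : ℝ} (hr0 : 0 ≤ r) (hr1 : r < 1) (F : ℕ → ℂ) :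
    ENNReal.ofReal (1 - r) ^ 2 * sqsum (dilTail w r F) ≤ sqsum F := by
  set t : ℝ≥0∞ := ENNReal.ofReal r with ht
  have ht1 : 1 - t = ENNReal.ofReal (1 - r) := by
    rw [ENNReal.ofReal_sub _ hr0, ENNReal.ofReal_one]
  have hterm : ∀ n, ‖dilTail w r F n‖ₑ ^ 2 ≤ (1 - t)⁻¹ * ∑' j, t ^ j * ‖F (n + j + 1)‖ₑ ^ 2 := by
    intro n
    rw [← ENNReal.tsum_geometric]
    refine le_trans (pow_le_pow_left₀ zero_le ?_ 2) (tsum_mul_sq_le (fun j => t ^ j)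
      fun j => ‖F (n + j + 1)‖ₑ)
    refine (enorm_tsum_le_tsum_enorm).trans (ENNReal.tsum_le_tsum fun j => ?_)
    rw [enorm_mul, enorm_pow, enorm_mul]
    refine mul_le_mul_left ?_ _
    have h1 : ‖(r : ℂ)‖ₑ * ‖w‖ₑ ≤ t := by
      have h2 : ‖(r : ℂ)‖ₑ = t := by
        rw [← ofReal_norm, Complex.norm_real, Real.norm_eq_abs, abs_of_nonneg hr0]
      have h3 : ‖w‖ₑ ≤ 1 := by
        rw [← ofReal_norm]
        exact ENNReal.ofReal_le_one.mpr hw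
      rw [h2]
      exact mul_le_of_le_one_right' h3
    refine (pow_le_pow_left₀ zero_le h1 _).trans ?_
    exact pow_le_pow_of_le_one zero_le (ENNReal.ofReal_le_one.mpr hr1.le) (by omega)
  have hsum : sqsum (dilTail w r F) ≤ (1 - t)⁻¹ * ((1 - t)⁻¹ * sqsum F) := by
    refine (ENNReal.tsum_le_tsum hterm).trans ?_
    rw [ENNReal.tsum_mul_left, ENNReal.tsum_comm]
    refine mul_le_mul_right ?_ _
    rw [← ENNReal.tsum_geometric, ← ENNReal.tsum_mul_right]
    refine ENNReal.tsum_le_tsum fun j => ?_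
    rw [ENNReal.tsum_mul_left]
    refine mul_le_mul_right ?_ _
    simp_rw [add_assoc]
    exact ENNReal.tsum_comp_le_tsum_of_injective (add_left_injective (j + 1))
      fun n => ‖F n‖ₑ ^ 2
  rw [← ht1]
  refine (mul_le_mul_right hsum _).trans (le_of_eq ?_)
  have h0 : 1 - t ≠ 0 := by
    rw [ht1]
    simpa using hr1
  have h1 : 1 - t ≠ ∞ := by
    rw [ht1]
    exact ENNReal.ofReal_ne_top
  rw [sq, mul_assoc, ← mul_assoc (1 - t) (1 - t)⁻¹, ENNReal.mul_inv_cancel h0 h1, one_mul,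
    ← mul_assoc, ENNReal.mul_inv_cancel h0 h1, one_mul]

/-- The quotient of `f(r z)` at `w` is written explicitly in terms of the quotient `F` of `f`. The
constant is uniform in `r` and `w`, so it survives integration over `μ`. -/
lemma locDir_dilation_le (w : ClosedDisc) {f g : Disc → ℂ} (hf : f ∈ Hol) (hg : g ∈ Hol) {r : ℝ}
    (hr0 : 0 ≤ r) (hr1 : r < 1) (h : ∀ n, coeff g n = r ^ n * coeff f n) :
    locDir w g ≤ 4 * locDir w f := by
  rcases eq_or_ne (locDir w f) ∞ with h' | h'
  · rw [h', ENNReal.mul_top (by norm_num)]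
    exact le_top
  obtain ⟨F, hF, hfF⟩ := exists_of_locDir_lt_top w hf (lt_top_iff_ne_top.mpr h')
  rw [locDir_eq w hf hF hfF]
  have hw := w.norm_le_one
  -- Solves `r^(n+1) (F n - w F (n+1)) = G n - w G (n+1)`. The factor `1 - r` in front of the tails
  -- compensates their norm `1 / (1 - r)`, so both summands are bounded by `F` and the total
  -- constant is `2 + 2`.
  set G : ℕ → ℂ := fun n => (r : ℂ) ^ (n + 1) * F n +
    -((1 - r : ℝ) : ℂ) * (r : ℂ) ^ n * dilTail w r F n with hG
  have hre : ‖(r : ℂ)‖ₑ ≤ 1 := by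
    rw [← ofReal_norm, Complex.norm_real, Real.norm_eq_abs, abs_of_nonneg hr0]
    exact ENNReal.ofReal_le_one.mpr hr1.le
  have hr' : ‖((1 - r : ℝ) : ℂ)‖ₑ = ENNReal.ofReal (1 - r) := by
    rw [← ofReal_norm, Complex.norm_real, Real.norm_eq_abs, abs_of_nonneg (by linarith)]
  have hGs : sqsum G ≤ 4 * sqsum F := by
    have h1 : ∀ n, ‖G n‖ₑ ^ 2 ≤ 2 * ‖F n‖ₑ ^ 2 +
        2 * (ENNReal.ofReal (1 - r) ^ 2 * ‖dilTail w r F n‖ₑ ^ 2) := by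
      intro n
      refine (enorm_add_sq_le _ _).trans (add_le_add (mul_le_mul_right ?_ _)
        (mul_le_mul_right ?_ _))
      · rw [enorm_mul, enorm_pow]
        exact pow_le_pow_left₀ zero_le (mul_le_of_le_one_left' (pow_le_one₀ zero_le hre)) 2
      · rw [enorm_mul, enorm_mul, enorm_neg, hr', enorm_pow, ← mul_pow]
        refine pow_le_pow_left₀ zero_le (mul_le_mul_left ?_ _) 2
        exact mul_le_of_le_one_right' (pow_le_one₀ zero_le hre)
    refine (ENNReal.tsum_le_tsum h1).trans ?_
    rw [ENNReal.tsum_add, ENNReal.tsum_mul_left, ENNReal.tsum_mul_left, ENNReal.tsum_mul_left]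
    have h2 := sqsum_dilTail_le hw hr0 hr1 F
    have h3 : (4 : ℝ≥0∞) * sqsum F = 2 * sqsum F + 2 * sqsum F := by
      rw [← add_mul]
      norm_num
    rw [h3]
    exact add_le_add le_rfl (mul_le_mul_right h2 _)
  refine le_trans (le_of_eq ?_) hGs
  refine locDir_eq w hg (lt_of_le_of_lt hGs (ENNReal.mul_lt_top (by norm_num) hF)) fun n => ?_
  simp only [hG]
  rw [h, hfF, dilTail_eq hw hr0 hr1 hF n]
  push_cast
  ring

/-- The monomial `z ^ n`. -/
def monomial (n : ℕ) (z : Disc) : ℂ := (z : ℂ) ^ n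

lemma hasSum_monomial (n : ℕ) (z : Disc) :
    HasSum (fun k => (Pi.single n 1 : ℕ → ℂ) k * (z : ℂ) ^ k) (monomial n z) := by
  have h := hasSum_single (f := fun k => (Pi.single n 1 : ℕ → ℂ) k * (z : ℂ) ^ k) n
    fun k hk => by simp [Pi.single_eq_of_ne hk]
  simpa [monomial] using h

lemma monomial_mem_hol (n : ℕ) : monomial n ∈ Hol := hol_of_hasSum (hasSum_monomial n)

lemma coeff_monomial (n : ℕ) : coeff (monomial n) = Pi.single n 1 :=
  coeff_of_hasSum (hasSum_monomial n)

lemma cderiv_monomial (n : ℕ) (z : Disc) : cderiv (monomial n) z = n * (z : ℂ) ^ (n - 1) :=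
  cderiv_eq_of_hasDerivAt z (fun _ => rfl) (hasDerivAt_pow n (z : ℂ))

/-! ### Monomials, Taylor coefficient functionals and dense subspaces of `D(μ)`. -/

section DSpaceDense

variable (μ : Measure ClosedDisc) [IsFiniteMeasure μ]

/-- The derivative of `z^n` is bounded by `n` on the disc and each local kernel has total mass one.
-/
lemma dirichletNormSq_monomial_le (n : ℕ) :
    dirichletNormSq μ (monomial n) ≤ ENNReal.ofReal (1 + n ^ 2 * mass μ) := by
  have hm : 0 ≤ mass μ := measureReal_nonneg
  rw [dirichletNormSq_eq, energy_eq_lintegral_locDir μ (monomial_mem_hol n), coeff_monomial,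
    ENNReal.ofReal_add zero_le_one (by positivity), ENNReal.ofReal_one]
  refine add_le_add (le_of_eq ?_) ?_
  · rw [sqsum, tsum_eq_single n fun k hk => by simp [Pi.single_eq_of_ne hk]]
    simp
  · have h1 : ∀ w, locDir w (monomial n) ≤ ENNReal.ofReal (n ^ 2) := fun w =>
      locDir_le_of_bound w fun z => by
        rw [cderiv_monomial, enorm_sq_eq_ofReal]
        refine ENNReal.ofReal_le_ofReal ?_
        rw [norm_mul, norm_pow, Complex.norm_natCast]
        refine pow_le_pow_left₀ (by positivity) (mul_le_of_le_one_right (by positivity)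
          (pow_le_one₀ (norm_nonneg _) z.norm_lt_one.le)) 2
    refine (lintegral_mono h1).trans ?_
    rw [lintegral_const, ENNReal.ofReal_mul (by positivity), mass, ofReal_measureReal]

/-- The monomials, as elements of `D(μ)`. -/
noncomputable def DSpace.mono (n : ℕ) : DSpace μ :=
  (exists_dSpace μ (monomial_mem_hol n)
    (lt_of_le_of_lt (dirichletNormSq_monomial_le μ n) ENNReal.ofReal_lt_top)).choose

lemma DSpace.toFun_mono (n : ℕ) : DSpace.toFun μ (DSpace.mono μ n) = monomial n :=
  (exists_dSpace μ (monomial_mem_hol n)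
    (lt_of_le_of_lt (dirichletNormSq_monomial_le μ n) ENNReal.ofReal_lt_top)).choose_spec

/-- The polynomials, as a subspace of `D(μ)`. -/
noncomputable def polyD : Submodule ℂ (DSpace μ) := Submodule.span ℂ (Set.range (DSpace.mono μ))

lemma DSpace.mono_mem_polyD (n : ℕ) : DSpace.mono μ n ∈ polyD μ :=
  Submodule.subset_span ⟨n, rfl⟩

variable [NeZero μ]

lemma DSpace.norm_mono_le (n : ℕ) : ‖DSpace.mono μ n‖ ≤ (1 + mass μ) * (n + 1) := by
  have hm := mass_pos μ
  have h := dirichletNormSq_monomial_le μ n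
  rw [← DSpace.toFun_mono μ, DSpace.normSq_eq, ENNReal.ofReal_le_ofReal_iff (by positivity)] at h
  have hn : (0 : ℝ) ≤ n := Nat.cast_nonneg n
  refine le_of_sq_le_sq (h.trans ?_) (by positivity)
  nlinarith [mul_nonneg hm.le hn, mul_nonneg (mul_nonneg hm.le hm.le) hn,
    mul_nonneg hm.le (sq_nonneg (n : ℝ)), mul_nonneg (mul_nonneg hm.le hm.le) (sq_nonneg (n : ℝ))]

/-- The Taylor coefficients as continuous functionals on `D(μ)`. -/
noncomputable def DSpace.coeffCLM (n : ℕ) : DSpace μ →L[ℂ] ℂ :=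
  LinearMap.mkContinuous
    { toFun := fun x => coeff (DSpace.toFun μ x) n
      map_add' := fun x y => by
        rw [map_add, coeff_add (DSpace.mem_hol μ x) (DSpace.mem_hol μ y), Pi.add_apply]
      map_smul' := fun c x => by
        rw [map_smul, coeff_smul c (DSpace.mem_hol μ x)]
        rfl } 1
    fun x => by
      rw [one_mul]
      exact DSpace.norm_coeff_le μ x n

lemma DSpace.coeffCLM_apply (n : ℕ) (x : DSpace μ) :
    DSpace.coeffCLM μ n x = coeff (DSpace.toFun μ x) n := rfl

lemma DSpace.coeffCLM_mono (n k : ℕ) :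
    DSpace.coeffCLM μ n (DSpace.mono μ k) = if n = k then 1 else 0 := by
  rw [DSpace.coeffCLM_apply, DSpace.toFun_mono, coeff_monomial, Pi.single_apply]

lemma DSpace.ext_coeff {x y : DSpace μ} (h : ∀ n, DSpace.coeffCLM μ n x = DSpace.coeffCLM μ n y) :
    x = y :=
  Subtype.ext (eq_of_coeff_eq x.2.1 y.2.1 (funext h))

lemma DSpace.exists_hasSum {a : ℕ → ℂ} (h : Summable fun n : ℕ => ‖a n‖ * (n + 1)) :
    ∃ x : DSpace μ, HasSum (fun n => a n • DSpace.mono μ n) x ∧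
      ∀ n, DSpace.coeffCLM μ n x = a n := by
  have hs : Summable fun n => a n • DSpace.mono μ n := by
    refine Summable.of_norm_bounded (h.mul_left (1 + mass μ)) fun n => ?_
    rw [norm_smul]
    refine (mul_le_mul_of_nonneg_left (DSpace.norm_mono_le μ n) (norm_nonneg _)).trans (le_of_eq ?_)
    ring
  obtain ⟨x, hx⟩ := hs
  refine ⟨x, hx, fun n => ?_⟩
  have h1 := (DSpace.coeffCLM μ n).hasSum hx
  refine h1.unique ?_
  have h2 := hasSum_single (f := fun k => DSpace.coeffCLM μ n (a k • DSpace.mono μ k)) n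
    fun k hk => by simp [DSpace.coeffCLM_mono, hk.symm]
  simpa [DSpace.coeffCLM_mono] using h2

lemma mem_topologicalClosure_of_hasSum {a : ℕ → ℂ} {x : DSpace μ}
    (h : HasSum (fun n => a n • DSpace.mono μ n) x) : x ∈ (polyD μ).topologicalClosure := by
  refine (Submodule.isClosed_topologicalClosure (polyD μ)).mem_of_tendsto h
    (Eventually.of_forall fun s => Submodule.le_topologicalClosure _ ?_)
  exact Submodule.sum_mem _ fun n _ => Submodule.smul_mem _ _ (DSpace.mono_mem_polyD μ n)

/-- The dilation `f(r z)` is a norm convergent series of monomials, since their norms grow only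
linearly; the factor `2` is the square root of the `4` in `locDir_dilation_le`. -/
lemma DSpace.exists_dilation (x : DSpace μ) {r : ℝ} (hr0 : 0 ≤ r) (hr1 : r < 1) :
    ∃ y ∈ (polyD μ).topologicalClosure, ‖y‖ ≤ 2 * ‖x‖ ∧
      ∀ n, DSpace.coeffCLM μ n y = r ^ n * DSpace.coeffCLM μ n x := by
  have hs : Summable fun n : ℕ => ‖(r : ℂ) ^ n * DSpace.coeffCLM μ n x‖ * (n + 1) := by
    have hr : ‖r‖ < 1 := by rwa [Real.norm_eq_abs, abs_of_nonneg hr0]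
    have h1 := summable_pow_mul_geometric_of_norm_lt_one (R := ℝ) 1 hr
    have h2 := summable_geometric_of_lt_one hr0 hr1
    refine Summable.of_nonneg_of_le (fun n => by positivity) (fun n => ?_)
      ((h1.add h2).mul_right ‖x‖)
    rw [norm_mul, norm_pow, Complex.norm_real, Real.norm_eq_abs, abs_of_nonneg hr0, pow_one]
    have h3 := DSpace.norm_coeff_le μ x n
    rw [← DSpace.coeffCLM_apply] at h3
    calc r ^ n * ‖DSpace.coeffCLM μ n x‖ * (n + 1) ≤ r ^ n * ‖x‖ * (n + 1) := by gcongr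
      _ = _ := by ring
  obtain ⟨y, hy, hc⟩ := DSpace.exists_hasSum μ hs
  refine ⟨y, mem_topologicalClosure_of_hasSum μ hy, ?_, hc⟩
  have hx0 := DSpace.mem_hol μ x
  have hy0 := DSpace.mem_hol μ y
  have h1 : dirichletNormSq μ (DSpace.toFun μ y) ≤ 4 * dirichletNormSq μ (DSpace.toFun μ x) := by
    rw [dirichletNormSq_eq, dirichletNormSq_eq, mul_add, energy_eq_lintegral_locDir μ hx0,
      energy_eq_lintegral_locDir μ hy0, ← lintegral_const_mul' _ _ (by norm_num)]
    refine add_le_add ?_ (lintegral_mono fun w => locDir_dilation_le w hx0 hy0 hr0 hr1 hc)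
    refine le_trans (ENNReal.tsum_le_tsum fun n => ?_)
      (le_mul_of_one_le_left' (by norm_num : (1 : ℝ≥0∞) ≤ 4))
    rw [← DSpace.coeffCLM_apply, hc, DSpace.coeffCLM_apply, enorm_mul, mul_pow, enorm_sq_eq_ofReal]
    refine mul_le_of_le_one_left' (ENNReal.ofReal_le_one.mpr ?_)
    rw [norm_pow, Complex.norm_real, Real.norm_eq_abs, abs_of_nonneg hr0]
    exact pow_le_one₀ (by positivity) (pow_le_one₀ hr0 hr1.le)
  rw [DSpace.normSq_eq, DSpace.normSq_eq, ← ENNReal.ofReal_ofNat 4,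
    ← ENNReal.ofReal_mul (by norm_num), ENNReal.ofReal_le_ofReal_iff (by positivity)] at h1
  refine le_of_sq_le_sq (h1.trans (le_of_eq ?_)) (by positivity)
  ring

/-- Bounded sequences that converge weakly against a dense subspace converge weakly. -/
lemma tendsto_inner_of_dense {H : Type*} [NormedAddCommGroup H] [InnerProductSpace ℂ H]
    {S : Submodule ℂ H} (hS : S.topologicalClosure = ⊤) {x : ℕ → H} {y : H} {B : ℝ}
    (hB : ∀ k, ‖x k‖ ≤ B) (h : ∀ g ∈ S, Tendsto (fun k => inner ℂ g (x k)) atTop (𝓝 (inner ℂ g y)))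
    (g : H) : Tendsto (fun k => inner ℂ g (x k)) atTop (𝓝 (inner ℂ g y)) := by
  have hB0 : 0 ≤ B := (norm_nonneg _).trans (hB 0)
  rw [Metric.tendsto_atTop]
  intro ε hε
  set K := B + ‖y‖ + 1 with hK
  have hK0 : 0 < K := by positivity
  have hg : g ∈ closure (S : Set H) := by
    rw [← Submodule.topologicalClosure_coe, hS]
    trivial
  obtain ⟨g', hg', hd⟩ := Metric.mem_closure_iff.mp hg (ε / (2 * K)) (by positivity)
  obtain ⟨N, hN⟩ := Metric.tendsto_atTop.mp (h g' hg') (ε / 2) (by positivity)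
  refine ⟨N, fun k hk => ?_⟩
  have h1 := hN k hk
  rw [dist_eq_norm, ← inner_sub_right] at h1 ⊢
  have h2 : inner ℂ g (x k - y) = inner ℂ (g - g') (x k - y) + inner ℂ g' (x k - y) := by
    rw [← inner_add_left, sub_add_cancel]
  rw [dist_eq_norm] at hd
  have h3 : ‖x k - y‖ ≤ K := (norm_sub_le _ _).trans (by linarith [hB k])
  have h4 : ‖(inner ℂ (g - g') (x k - y) : ℂ)‖ ≤ ε / 2 := by
    refine (norm_inner_le_norm _ _).trans ?_
    calc ‖g - g'‖ * ‖x k - y‖ ≤ ε / (2 * K) * K := by gcongr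
      _ = ε / 2 := by field_simp
  rw [h2]
  exact (norm_add_le _ _).trans_lt (by linarith)

/-- The element of `D(μ)` that represents the `n`-th Taylor coefficient. -/
noncomputable def DSpace.rep (n : ℕ) : DSpace μ :=
  (InnerProductSpace.toDual ℂ (DSpace μ)).symm (DSpace.coeffCLM μ n)

lemma DSpace.inner_rep (n : ℕ) (x : DSpace μ) :
    inner ℂ (DSpace.rep μ n) x = DSpace.coeffCLM μ n x :=
  InnerProductSpace.toDual_symm_apply

/-- The span of the representing elements of the Taylor coefficients. -/
noncomputable def repD : Submodule ℂ (DSpace μ) := Submodule.span ℂ (Set.range (DSpace.rep μ))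

lemma topologicalClosure_repD : (repD μ).topologicalClosure = ⊤ := by
  rw [Submodule.topologicalClosure_eq_top_iff, Submodule.eq_bot_iff]
  intro x hx
  refine DSpace.ext_coeff μ fun n => ?_
  rw [← DSpace.inner_rep, map_zero]
  exact hx _ (Submodule.subset_span ⟨n, rfl⟩)

/-- The dilations `h_r` are bounded and converge to `h` coefficientwise, hence weakly. They lie in
the closed span of the polynomials, so `⟨h, h_r⟩ = 0` when `h` is orthogonal to it, and the limit is
`‖h‖² = 0`. -/
lemma topologicalClosure_polyD : (polyD μ).topologicalClosure = ⊤ := by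
  rw [Submodule.topologicalClosure_eq_top_iff, Submodule.eq_bot_iff]
  intro h hh
  have hr0 : ∀ k : ℕ, (0 : ℝ) ≤ 1 - 1 / ((k : ℝ) + 1) := fun k => by
    rw [sub_nonneg, div_le_one (by positivity)]
    have : (0 : ℝ) ≤ k := Nat.cast_nonneg k
    linarith
  have hr1 : ∀ k : ℕ, 1 - 1 / ((k : ℝ) + 1) < 1 := fun k => by
    have : 0 < 1 / ((k : ℝ) + 1) := by positivity
    linarith
  choose x hxK hxB hxc using fun k : ℕ => DSpace.exists_dilation μ h (hr0 k) (hr1 k)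
  have hlim : Tendsto (fun k : ℕ => ((1 - 1 / ((k : ℝ) + 1) : ℝ) : ℂ)) atTop (𝓝 1) := by
    have h1 := (tendsto_const_nhds (x := (1 : ℝ))).sub (tendsto_one_div_add_atTop_nhds_zero_nat (𝕜 := ℝ))
    rw [sub_zero] at h1
    have h2 := (Complex.continuous_ofReal.tendsto _).comp h1
    simpa [Function.comp_def] using h2
  have hw : ∀ g ∈ repD μ, Tendsto (fun k => inner ℂ g (x k)) atTop (𝓝 (inner ℂ g h)) := by
    intro g hg
    induction hg using Submodule.span_induction with
    | mem g hg =>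
      obtain ⟨n, rfl⟩ := hg
      simp_rw [DSpace.inner_rep, hxc]
      simpa using (hlim.pow n).mul_const (DSpace.coeffCLM μ n h)
    | zero => simp
    | add g g' _ _ h1 h2 =>
      simp_rw [inner_add_left]
      exact h1.add h2
    | smul c g _ h1 =>
      simp_rw [inner_smul_left]
      exact h1.const_mul _
  have h1 := tendsto_inner_of_dense (topologicalClosure_repD μ) hxB hw h
  have h2 : ∀ k, inner ℂ h (x k) = 0 := fun k => by
    have h3 : h ∈ ((polyD μ).topologicalClosure)ᗮ := by
      rwa [Submodule.orthogonal_closure]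
    rw [← inner_conj_symm, h3 _ (hxK k), map_zero]
  simp_rw [h2] at h1
  exact inner_self_eq_zero.mp (tendsto_nhds_unique h1 tendsto_const_nhds)

end DSpaceDense

/-! ### The inner product of `D(μ)` on polynomials -/

/-- The coefficients of `(f - f(w)) / (z - w)`, for `f = ∑ a n z ^ n` with `a n = 0` for `N ≤ n`. -/
noncomputable def quotSeq (N : ℕ) (a : ℕ → ℂ) (w : ℂ) (j : ℕ) : ℂ :=
  ∑ i ∈ Finset.range N, w ^ i * a (j + 1 + i)

lemma quotSeq_sub {N : ℕ} {a : ℕ → ℂ} (ha : ∀ n, N ≤ n → a n = 0) (w : ℂ) (j : ℕ) :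
    a (j + 1) = quotSeq N a w j - w * quotSeq N a w (j + 1) := by
  rw [quotSeq, quotSeq, Finset.mul_sum, ← Finset.sum_sub_distrib]
  have h : ∀ i ∈ Finset.range N, w ^ i * a (j + 1 + i) - w * (w ^ i * a (j + 1 + 1 + i)) =
      w ^ i * a (j + 1 + i) - w ^ (i + 1) * a (j + 1 + (i + 1)) := fun i _ => by
    rw [show j + 1 + 1 + i = j + 1 + (i + 1) by ring]
    ring
  rw [Finset.sum_congr rfl h, Finset.sum_range_sub' (fun i => w ^ i * a (j + 1 + i)),
    ha (j + 1 + N) (by omega)]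
  simp

lemma quotSeq_eq_zero {N : ℕ} {a : ℕ → ℂ} (ha : ∀ n, N ≤ n → a n = 0) (w : ℂ) {j : ℕ} (hj : N ≤ j) :
    quotSeq N a w j = 0 :=
  Finset.sum_eq_zero fun i _ => by rw [ha _ (by omega), mul_zero]

lemma quotSeq_mono {N M : ℕ} (h : N ≤ M) {a : ℕ → ℂ} (ha : ∀ n, N ≤ n → a n = 0) (w : ℂ) (j : ℕ) :
    quotSeq M a w j = quotSeq N a w j := by
  refine (Finset.sum_subset (Finset.range_mono h) fun i _ hi => ?_).symm
  rw [Finset.mem_range, not_lt] at hi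
  rw [ha _ (by omega), mul_zero]

lemma quotSeq_add_smul (N : ℕ) (a b : ℕ → ℂ) (c w : ℂ) (j : ℕ) :
    quotSeq N (a + c • b) w j = quotSeq N a w j + c * quotSeq N b w j := by
  simp only [quotSeq, Pi.add_apply, Pi.smul_apply, smul_eq_mul, mul_add, Finset.sum_add_distrib,
    Finset.mul_sum]
  congr 1
  exact Finset.sum_congr rfl fun i _ => by ring

lemma quotSeq_single {N n : ℕ} (h : n < N) (w : ℂ) (j : ℕ) :
    quotSeq N (Pi.single n 1) w j = if j < n then w ^ (n - 1 - j) else 0 := by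
  rw [quotSeq]
  split_ifs with hj
  · rw [Finset.sum_eq_single (n - 1 - j)]
    · rw [show j + 1 + (n - 1 - j) = n by omega, Pi.single_eq_same, mul_one]
    · intro i _ hi
      rw [Pi.single_eq_of_ne (by omega), mul_zero]
    · intro hi
      exact absurd (Finset.mem_range.mpr (by omega)) hi
  · exact Finset.sum_eq_zero fun i _ => by rw [Pi.single_eq_of_ne (by omega), mul_zero]

lemma continuous_quotSeq (N : ℕ) (a : ℕ → ℂ) (j : ℕ) :
    Continuous fun w : ClosedDisc => quotSeq N a w j := by
  unfold quotSeq
  fun_prop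

lemma norm_quotSeq_le {N : ℕ} {a : ℕ → ℂ} {A : ℝ} (hA : ∀ n, ‖a n‖ ≤ A) {w : ℂ} (hw : ‖w‖ ≤ 1)
    (j : ℕ) : ‖quotSeq N a w j‖ ≤ N * A := by
  refine (norm_sum_le _ _).trans ?_
  refine (Finset.sum_le_sum (g := fun _ => A) fun i _ => ?_).trans (by simp)
  rw [norm_mul, norm_pow]
  exact (mul_le_of_le_one_left (norm_nonneg _) (pow_le_one₀ (norm_nonneg _) hw)).trans (hA _)

lemma sqsum_of_eq_zero {N : ℕ} {a : ℕ → ℂ} (ha : ∀ n, N ≤ n → a n = 0) :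
    sqsum a = ENNReal.ofReal (∑ n ∈ Finset.range N, ‖a n‖ ^ 2) := by
  rw [sqsum, tsum_eq_sum (s := Finset.range N) fun n hn => by
    rw [ha n (by simpa using hn)]; simp, ENNReal.ofReal_sum_of_nonneg fun n _ => sq_nonneg _]
  exact Finset.sum_congr rfl fun n _ => enorm_sq_eq_ofReal _

/-- For a polynomial the quotient is given by finite sums that are continuous in `w`, which makes
the integrals over `μ` harmless. -/
lemma locDir_of_eq_zero (w : ClosedDisc) {f : Disc → ℂ} (hf : f ∈ Hol) {N : ℕ}
    (h : ∀ n, N ≤ n → coeff f n = 0) :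
    locDir w f = ENNReal.ofReal (∑ j ∈ Finset.range N, ‖quotSeq N (coeff f) w j‖ ^ 2) := by
  have h1 := sqsum_of_eq_zero fun n hn => quotSeq_eq_zero h w (j := n) hn
  rw [← h1]
  refine locDir_eq w hf ?_ fun n => quotSeq_sub h w n
  rw [h1]
  exact ENNReal.ofReal_lt_top

section CauchyMap

variable (μ : Measure ClosedDisc) [IsFiniteMeasure μ]

lemma integrable_of_continuous {E : Type*} [NormedAddCommGroup E] {f : ClosedDisc → E}
    (hf : Continuous f) : Integrable f μ :=
  hf.integrable_of_hasCompactSupport (HasCompactSupport.of_compactSpace _)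

lemma dirichletNormSq_of_eq_zero {f : Disc → ℂ} (hf : f ∈ Hol) {N : ℕ}
    (h : ∀ n, N ≤ n → coeff f n = 0) :
    dirichletNormSq μ f = ENNReal.ofReal (∑ n ∈ Finset.range N, ‖coeff f n‖ ^ 2 +
      ∫ w, ∑ j ∈ Finset.range N, ‖quotSeq N (coeff f) w j‖ ^ 2 ∂μ) := by
  have h0 : ∀ w : ClosedDisc, 0 ≤ ∑ j ∈ Finset.range N, ‖quotSeq N (coeff f) w j‖ ^ 2 :=
    fun w => Finset.sum_nonneg fun j _ => sq_nonneg _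
  have hc : Continuous fun w : ClosedDisc => ∑ j ∈ Finset.range N, ‖quotSeq N (coeff f) w j‖ ^ 2 :=
    continuous_finsetSum _ fun j _ => (continuous_quotSeq N (coeff f) j).norm.pow 2
  rw [dirichletNormSq_eq, energy_eq_lintegral_locDir μ hf,
    ENNReal.ofReal_add (Finset.sum_nonneg fun j _ => sq_nonneg _) (integral_nonneg h0),
    ofReal_integral_eq_lintegral_ofReal (integrable_of_continuous μ hc) (Eventually.of_forall h0),
    sqsum_of_eq_zero h]
  congr 1
  exact lintegral_congr fun w => locDir_of_eq_zero w hf h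

lemma integral_combination {μ : Measure ClosedDisc} {f g h k : ClosedDisc → ℂ} (hf : Integrable f μ) (hg : Integrable g μ)
    (hh : Integrable h μ) (hk : Integrable k μ) (c d : ℂ) :
    ∫ w, (f w - g w + (h w - k w) * c) / d ∂μ =
      (∫ w, f w ∂μ - ∫ w, g w ∂μ + (∫ w, h w ∂μ - ∫ w, k w ∂μ) * c) / d := by
  have h1 : Integrable (fun w => (h w - k w) * c) μ := (hh.sub hk).mul_const c
  have h2 : Integrable (fun w => f w - g w) μ := hf.sub hg
  rw [integral_div, integral_add h2 h1, integral_mul_const, integral_sub hf hg, integral_sub hh hk]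

variable [NeZero μ]

lemma DSpace.norm_sq_of_eq_zero (x : DSpace μ) {N : ℕ}
    (h : ∀ n, N ≤ n → DSpace.coeffCLM μ n x = 0) :
    ‖x‖ ^ 2 = ∑ n ∈ Finset.range N, ‖DSpace.coeffCLM μ n x‖ ^ 2 +
      ∫ w, ∑ j ∈ Finset.range N, ‖quotSeq N (fun n => DSpace.coeffCLM μ n x) w j‖ ^ 2 ∂μ := by
  have h1 := DSpace.normSq_eq μ x
  rw [dirichletNormSq_of_eq_zero μ (DSpace.mem_hol μ x) h,
    ENNReal.ofReal_eq_ofReal_iff (add_nonneg (Finset.sum_nonneg fun j _ => sq_nonneg _)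
      (integral_nonneg fun w => Finset.sum_nonneg fun j _ => sq_nonneg _)) (sq_nonneg _)] at h1
  exact h1.symm

lemma conj_mul_eq_polarization (u v : ℂ) :
    conj u * v = ((‖u + 1 * v‖ ^ 2 : ℝ) - (‖u + (-1) * v‖ ^ 2 : ℝ) +
      ((‖u + (-Complex.I) * v‖ ^ 2 : ℝ) - (‖u + Complex.I * v‖ ^ 2 : ℝ)) * Complex.I) / 4 := by
  have h := inner_eq_sum_norm_sq_div_four (𝕜 := ℂ) u v
  rw [RCLike.inner_apply'] at h
  rw [h]
  simp only [smul_eq_mul, one_mul, neg_mul, sub_eq_add_neg, RCLike.I_to_complex]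
  push_cast
  rfl

/-- Polarization of the norm formula `‖f‖² + ∫ ‖Q_w f‖² dμ(w)`, carried out at once for the
coefficients and for the quotients under the integral. -/
lemma DSpace.inner_of_eq_zero (x y : DSpace μ) {N : ℕ}
    (hx : ∀ n, N ≤ n → DSpace.coeffCLM μ n x = 0) (hy : ∀ n, N ≤ n → DSpace.coeffCLM μ n y = 0) :
    inner ℂ y x = ∑ n ∈ Finset.range N, conj (DSpace.coeffCLM μ n y) * DSpace.coeffCLM μ n x +
      ∫ w, ∑ j ∈ Finset.range N, conj (quotSeq N (fun n => DSpace.coeffCLM μ n y) w j) *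
        quotSeq N (fun n => DSpace.coeffCLM μ n x) w j ∂μ := by
  set X : ClosedDisc → ℕ → ℂ := fun w j => quotSeq N (fun n => DSpace.coeffCLM μ n x) w j with hX
  set Y : ClosedDisc → ℕ → ℂ := fun w j => quotSeq N (fun n => DSpace.coeffCLM μ n y) w j with hY
  have hXc : ∀ j, Continuous fun w => X w j := fun j =>
    continuous_quotSeq N (fun n => DSpace.coeffCLM μ n x) j
  have hYc : ∀ j, Continuous fun w => Y w j := fun j =>
    continuous_quotSeq N (fun n => DSpace.coeffCLM μ n y) j
  have hc : ∀ c : ℂ, Integrable (fun w => ∑ j ∈ Finset.range N, ‖Y w j + c * X w j‖ ^ 2) μ :=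
    fun c => integrable_of_continuous μ (continuous_finsetSum _ fun j _ =>
      ((hYc j).add ((hXc j).const_mul c)).norm.pow 2)
  have hn : ∀ c : ℂ, ((‖y + c • x‖ : ℂ)) ^ 2 =
      ∑ n ∈ Finset.range N, ((‖DSpace.coeffCLM μ n y + c * DSpace.coeffCLM μ n x‖ ^ 2 : ℝ) : ℂ) +
      ∫ w, ((∑ j ∈ Finset.range N, ‖Y w j + c * X w j‖ ^ 2 : ℝ) : ℂ) ∂μ := by
    intro c
    have h1 := DSpace.norm_sq_of_eq_zero μ (y + c • x) (N := N) fun n hn => by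
      rw [map_add, map_smul, hx n hn, hy n hn]
      simp
    have h2 : (fun n => DSpace.coeffCLM μ n (y + c • x)) =
        (fun n => DSpace.coeffCLM μ n y) + c • fun n => DSpace.coeffCLM μ n x := by
      funext n
      rw [map_add, map_smul]
      rfl
    rw [h2] at h1
    simp only [quotSeq_add_smul] at h1
    simp only [map_add, map_smul, smul_eq_mul] at h1
    have h3 : ‖y + c • x‖ ^ 2 =
      ∑ n ∈ Finset.range N, ‖DSpace.coeffCLM μ n y + c * DSpace.coeffCLM μ n x‖ ^ 2 +
      ∫ w, ∑ j ∈ Finset.range N, ‖Y w j + c * X w j‖ ^ 2 ∂μ := h1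
    rw [integral_complex_ofReal, ← Complex.ofReal_sum, ← Complex.ofReal_add, ← h3]
    push_cast
    rfl
  have h := inner_eq_sum_norm_sq_div_four (𝕜 := ℂ) y x
  have e1 : y + x = y + (1 : ℂ) • x := by rw [one_smul]
  have e2 : y - x = y + (-1 : ℂ) • x := by rw [neg_one_smul, sub_eq_add_neg]
  have e3 : y - (RCLike.I : ℂ) • x = y + (-Complex.I) • x := by
    rw [neg_smul, sub_eq_add_neg]; rfl
  have e4 : y + (RCLike.I : ℂ) • x = y + Complex.I • x := rfl
  rw [e1, e2, e3, e4] at h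
  refine h.trans ?_
  have hco : ∀ z : ℝ, (RCLike.ofReal z : ℂ) = (z : ℂ) := fun _ => rfl
  simp only [hco, hn, RCLike.I_to_complex]
  have hi : ∫ w, ∑ j ∈ Finset.range N, conj (Y w j) * X w j ∂μ =
      ((∫ w, ((∑ j ∈ Finset.range N, ‖Y w j + 1 * X w j‖ ^ 2 : ℝ) : ℂ) ∂μ) -
        (∫ w, ((∑ j ∈ Finset.range N, ‖Y w j + (-1) * X w j‖ ^ 2 : ℝ) : ℂ) ∂μ) +
        ((∫ w, ((∑ j ∈ Finset.range N, ‖Y w j + (-Complex.I) * X w j‖ ^ 2 : ℝ) : ℂ) ∂μ) -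
        (∫ w, ((∑ j ∈ Finset.range N, ‖Y w j + Complex.I * X w j‖ ^ 2 : ℝ) : ℂ) ∂μ)) *
          Complex.I) / 4 := by
    have hc' : ∀ c : ℂ, Integrable
        (fun w => ((∑ j ∈ Finset.range N, ‖Y w j + c * X w j‖ ^ 2 : ℝ) : ℂ)) μ :=
      fun c => (hc c).ofReal
    rw [← integral_combination (hc' 1) (hc' (-1)) (hc' (-Complex.I)) (hc' Complex.I)]
    refine integral_congr_ae (Eventually.of_forall fun w => ?_)
    simp only [conj_mul_eq_polarization]
    push_cast
    rw [← Finset.sum_div, Finset.sum_add_distrib, ← Finset.sum_mul, Finset.sum_sub_distrib,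
      Finset.sum_sub_distrib]
  have hs : ∑ n ∈ Finset.range N, conj (DSpace.coeffCLM μ n y) * DSpace.coeffCLM μ n x = _ :=
    Finset.sum_congr rfl fun n _ => conj_mul_eq_polarization _ _
  rw [hi, hs, ← Finset.sum_div, Finset.sum_add_distrib, ← Finset.sum_mul, Finset.sum_sub_distrib,
    Finset.sum_sub_distrib]
  ring

lemma exists_of_mem_polyD {x : DSpace μ} (hx : x ∈ polyD μ) :
    ∃ N, ∀ n, N ≤ n → DSpace.coeffCLM μ n x = 0 := by
  induction hx using Submodule.span_induction with
  | mem x hx =>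
    obtain ⟨k, rfl⟩ := hx
    refine ⟨k + 1, fun n hn => ?_⟩
    rw [DSpace.coeffCLM_mono, if_neg (by omega)]
  | zero => exact ⟨0, fun n _ => map_zero _⟩
  | add x y _ _ h1 h2 =>
    obtain ⟨N, hN⟩ := h1
    obtain ⟨M, hM⟩ := h2
    refine ⟨max N M, fun n hn => ?_⟩
    rw [map_add, hN n (le_of_max_le_left hn), hM n (le_of_max_le_right hn), add_zero]
  | smul c x _ h1 =>
    obtain ⟨N, hN⟩ := h1
    exact ⟨N, fun n hn => by rw [map_smul, hN n hn, smul_zero]⟩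

/-- The quotient of `z^n` at `w` is `∑_{j<n} w^(n-1-j) z^j`. The sum under the integral is therefore
the `n`-th coefficient of `z Q_w f / (1 - conj w z)`. -/
lemma DSpace.inner_mono (x : DSpace μ) {N : ℕ} (hx : ∀ n, N ≤ n → DSpace.coeffCLM μ n x = 0)
    (n : ℕ) : inner ℂ (DSpace.mono μ n) x = DSpace.coeffCLM μ n x +
      ∫ w : ClosedDisc, ∑ j ∈ Finset.range n, conj (w : ℂ) ^ (n - 1 - j) *
        quotSeq N (fun n => DSpace.coeffCLM μ n x) w j ∂μ := by
  set M := max N (n + 1) with hM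
  have hNM : N ≤ M := le_max_left _ _
  have hnM : n < M := le_max_right N (n + 1)
  have e : (fun k => DSpace.coeffCLM μ k (DSpace.mono μ n)) = Pi.single n 1 := by
    funext k
    rw [DSpace.coeffCLM_mono, Pi.single_apply]
  have hy : ∀ k, M ≤ k → DSpace.coeffCLM μ k (DSpace.mono μ n) = 0 := fun k hk => by
    rw [DSpace.coeffCLM_mono, if_neg (by omega)]
  rw [DSpace.inner_of_eq_zero μ x (DSpace.mono μ n) (fun k hk => hx k (hNM.trans hk)) hy, e]
  congr 1
  · rw [Finset.sum_eq_single n]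
    · rw [DSpace.coeffCLM_mono, if_pos rfl, map_one, one_mul]
    · intro k _ hk
      rw [DSpace.coeffCLM_mono, if_neg hk, map_zero, zero_mul]
    · intro h
      exact absurd (Finset.mem_range.mpr hnM) h
  · refine integral_congr_ae (Eventually.of_forall fun w => ?_)
    simp only [quotSeq_single hnM, quotSeq_mono hNM hx]
    rw [← Finset.sum_subset (Finset.range_mono hnM.le) fun j _ hj => by
      rw [if_neg (by simpa using hj), map_zero, zero_mul]]
    refine Finset.sum_congr rfl fun j hj => ?_
    rw [if_pos (Finset.mem_range.mp hj), map_pow]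

end CauchyMap

/-! ### Boundedness of the Cauchy map -/

lemma cderiv_partialSum (a : ℕ → ℂ) (N : ℕ) (z : Disc) :
    cderiv (partialSum a N) z = ∑ n ∈ Finset.range N, a n * (n * (z : ℂ) ^ (n - 1)) := by
  refine cderiv_eq_of_hasDerivAt z (F := fun u : ℂ => ∑ n ∈ Finset.range N, a n * u ^ n)
    (fun _ => rfl) (HasDerivAt.fun_sum fun n _ => ?_)
  exact (hasDerivAt_pow n (z : ℂ)).const_mul (a n)

/-- The function `z f(z) / (1 - conj w z)`. -/
noncomputable def mulCauchyKer (w : ℂ) (f : Disc → ℂ) : Disc → ℂ := coordSub 0 * (cauchyKer w * f)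

lemma mulCauchyKer_mem_hol {w : ℂ} (hw : ‖w‖ ≤ 1) {f : Disc → ℂ} (hf : f ∈ Hol) :
    mulCauchyKer w f ∈ Hol :=
  mul_mem_hol (coordSub_mem_hol 0) (mul_mem_hol (cauchyKer_mem_hol hw) hf)

lemma one_sub_conj_mul_ne_zero' {w : ℂ} (hw : ‖w‖ ≤ 1) (z : Disc) : 1 - conj w * (z : ℂ) ≠ 0 := by
  have := denom_pos z ⟨w, mem_closedBall_zero_iff.mpr hw⟩
  exact norm_pos_iff.mp this

lemma cderiv_cauchyKer {w : ℂ} (hw : ‖w‖ ≤ 1) (z : Disc) :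
    cderiv (cauchyKer w) z = conj w * cauchyKer w z ^ 2 := by
  have h0 := one_sub_conj_mul_ne_zero' hw z
  refine cderiv_eq_of_hasDerivAt z (F := fun u => 1 / (1 - conj w * u)) (fun _ => rfl) ?_
  have h1 : HasDerivAt (fun u : ℂ => 1 - conj w * u) (-(conj w * 1)) z :=
    ((hasDerivAt_id (z : ℂ)).const_mul (conj w)).const_sub 1
  have h2 := h1.inv h0
  simp only [one_div]
  refine h2.congr_deriv ?_
  rw [cauchyKer]
  field_simp

/-- One factor `1 / (1 - conj w z)` is split off for the Cauchy–Schwarz inequality in `w`; the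
bracket is square integrable against `1 - |z|²`, uniformly in `w`. -/
lemma cderiv_mulCauchyKer {w : ℂ} (hw : ‖w‖ ≤ 1) {f : Disc → ℂ} (hf : f ∈ Hol) (z : Disc) :
    cderiv (mulCauchyKer w f) z =
      cauchyKer w z * (cauchyKer w z * f z + z * cderiv f z) := by
  have h0 := one_sub_conj_mul_ne_zero' hw z
  rw [mulCauchyKer, cderiv_mul (coordSub_mem_hol 0) (mul_mem_hol (cauchyKer_mem_hol hw) hf),
    cderiv_coordSub, cderiv_mul (cauchyKer_mem_hol hw) hf, cderiv_cauchyKer hw, coordSub,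
    Pi.mul_apply]
  have h1 : 1 + (z : ℂ) * conj w * cauchyKer w z = cauchyKer w z := by
    have h0' : 1 - (z : ℂ) * conj w ≠ 0 := by rwa [mul_comm]
    rw [cauchyKer]
    field_simp
    ring
  have h2 : 1 * (cauchyKer w z * f z) + ((z : ℂ) - 0) *
      (conj w * cauchyKer w z ^ 2 * f z + cauchyKer w z * cderiv f z) =
      cauchyKer w z * f z * (1 + (z : ℂ) * conj w * cauchyKer w z) +
        cauchyKer w z * (z * cderiv f z) := by ring
  rw [h2, h1]
  ring

lemma coeff_mulCauchyKer {w : ℂ} (hw : ‖w‖ ≤ 1) {f : Disc → ℂ} (hf : f ∈ Hol) (n : ℕ) :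
    coeff (mulCauchyKer w f) (n + 1) =
      ∑ j ∈ Finset.range (n + 1), conj w ^ (n - j) * coeff f j := by
  have hg := mul_mem_hol (cauchyKer_mem_hol hw) hf
  set g := cauchyKer w * f with hg'
  have h1 : ∀ z : Disc, HasSum
      (fun k => (fun k => if k = 0 then 0 else coeff g (k - 1) : ℕ → ℂ) k * (z : ℂ) ^ k)
      (mulCauchyKer w f z) := by
    intro z
    have h2 := hasSum_const_add_coordSub_mul
      (b := fun k => if k = 0 then 0 else coeff g (k - 1)) (F := coeff g) (w := 0) (c := 0)
      (fun n => by simp) (by simp) (hasSum_coeff hg z)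
    rw [zero_add] at h2
    exact h2
  rw [coeff_of_hasSum h1]
  simp only [Nat.add_eq_zero_iff, one_ne_zero, and_false, if_false, Nat.add_sub_cancel]
  rw [coeff_mul (cauchyKer_mem_hol hw) hf, coeff_cauchyKer hw,
    ← Finset.Nat.sum_antidiagonal_swap]
  exact Finset.Nat.sum_antidiagonal_eq_sum_range_succ (fun i j => conj w ^ j * coeff f i) n

lemma hasSum_integral_series (μ : Measure ClosedDisc) [IsFiniteMeasure μ]
    {c : ℕ → ClosedDisc → ℂ} (hc : ∀ n, Continuous (c n)) {B : ℝ}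
    (hB : ∀ n w, ‖c n w‖ ≤ B * ((n : ℝ) + 1) ^ 2) (z : Disc) :
    HasSum (fun n => (∫ w, c n w ∂μ) * (z : ℂ) ^ n) (∫ w, ∑' n, c n w * (z : ℂ) ^ n ∂μ) := by
  simp_rw [← integral_mul_const]
  refine hasSum_integral_of_summable_integral_norm
    (fun n => integrable_of_continuous μ ((hc n).mul_const _)) ?_
  refine Summable.of_nonneg_of_le (fun n => integral_nonneg fun w => norm_nonneg _) (fun n => ?_)
    ((summable_sq_mul_pow z B).mul_left (mass μ))
  have h1 : ∀ w, ‖c n w * (z : ℂ) ^ n‖ ≤ B * ((n : ℝ) + 1) ^ 2 * ‖(z : ℂ)‖ ^ n := fun w => by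
    rw [norm_mul, norm_pow]
    exact mul_le_mul_of_nonneg_right (hB n w) (by positivity)
  refine (integral_mono (integrable_of_continuous μ ((hc n).mul_const _)).norm
    (integrable_const _) h1).trans (le_of_eq ?_)
  rw [integral_const, smul_eq_mul, mass]

/-! ### The Cauchy transform of a polynomial and its norm in `L²_{a,μ}`. -/

section CauchyMap

variable (μ : Measure ClosedDisc) [IsFiniteMeasure μ] [NeZero μ]

/-- The Cauchy transform of an element of `D(μ)`, given by its Taylor coefficients. -/
noncomputable def DSpace.cauchy (x : DSpace μ) : Disc → ℂ :=
  ofCoeff fun n => inner ℂ (DSpace.mono μ n) x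

lemma DSpace.norm_inner_mono_le (x : DSpace μ) (n : ℕ) :
    ‖(inner ℂ (DSpace.mono μ n) x : ℂ)‖ ≤ (1 + mass μ) * ‖x‖ * (n + 1) := by
  refine (norm_inner_le_norm _ _).trans ?_
  refine (mul_le_mul_of_nonneg_right (DSpace.norm_mono_le μ n) (norm_nonneg _)).trans (le_of_eq ?_)
  ring

lemma DSpace.hasSum_cauchy (x : DSpace μ) (z : Disc) :
    HasSum (fun n => (inner ℂ (DSpace.mono μ n) x : ℂ) * (z : ℂ) ^ n) (DSpace.cauchy μ x z) :=
  (summable_mul_pow_of_bound (DSpace.norm_inner_mono_le μ x) z).hasSum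

lemma DSpace.cauchy_mem_hol (x : DSpace μ) : DSpace.cauchy μ x ∈ Hol :=
  hol_of_hasSum (DSpace.hasSum_cauchy μ x)

lemma DSpace.coeff_cauchy (x : DSpace μ) (n : ℕ) :
    coeff (DSpace.cauchy μ x) n = inner ℂ (DSpace.mono μ n) x :=
  congrFun (coeff_of_hasSum (DSpace.hasSum_cauchy μ x)) n

/-- The derivative of `U f = f + ∫ z Q_w f / (1 - conj w z) dμ(w)`. Comparing Taylor coefficients of
the derivatives avoids differentiating under the integral. -/
lemma DSpace.cderiv_cauchy (x : DSpace μ) {N : ℕ} (hx : ∀ n, N ≤ n → DSpace.coeffCLM μ n x = 0)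
    (z : Disc) :
    cderiv (DSpace.cauchy μ x) z = cderiv (DSpace.toFun μ x) z +
      ∫ w : ClosedDisc, cderiv (mulCauchyKer w
        (partialSum (quotSeq N (fun n => DSpace.coeffCLM μ n x) w) N)) z ∂μ := by
  set a : ℕ → ℂ := fun n => DSpace.coeffCLM μ n x with ha
  set P : ClosedDisc → Disc → ℂ := fun w => partialSum (quotSeq N a w) N with hP
  have hPh : ∀ w, P w ∈ Hol := fun w => partialSum_mem_hol _ _
  have hPc : ∀ w, coeff (P w) = quotSeq N a w := fun w => by
    rw [hP, coeff_partialSum]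
    funext j
    split_ifs with h
    · rfl
    · exact (quotSeq_eq_zero hx w (not_lt.mp h)).symm
  set c : ℕ → ClosedDisc → ℂ := fun n w =>
    (n + 1) * ∑ j ∈ Finset.range (n + 1), conj (w : ℂ) ^ (n - j) * quotSeq N a w j with hc
  have hco : ∀ n (w : ClosedDisc), coeff (cderiv (mulCauchyKer w (P w))) n = c n w := fun n w => by
    rw [coeff_cderiv, coeff_mulCauchyKer w.norm_le_one (hPh w), hPc]
  have hconj : Continuous fun w : ClosedDisc => conj (w : ℂ) :=
    Complex.continuous_conj.comp continuous_subtype_val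
  have hcc : ∀ n, Continuous (c n) := fun n =>
    continuous_const.mul (continuous_finsetSum _ fun j _ =>
      (hconj.pow _).mul (continuous_quotSeq N a j))
  have hA : ∀ n, ‖a n‖ ≤ ‖x‖ := fun n => DSpace.norm_coeff_le μ x n
  have hcb : ∀ n w, ‖c n w‖ ≤ (N * ‖x‖) * ((n : ℝ) + 1) ^ 2 := by
    intro n w
    have e : ‖(n + 1 : ℂ)‖ = n + 1 := by exact_mod_cast Complex.norm_natCast (n + 1)
    rw [hc, norm_mul, e]
    have h1 : ‖∑ j ∈ Finset.range (n + 1), conj (w : ℂ) ^ (n - j) * quotSeq N a w j‖ ≤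
        ((n : ℝ) + 1) * (N * ‖x‖) := by
      refine (norm_sum_le _ _).trans ?_
      refine (Finset.sum_le_sum (g := fun _ => N * ‖x‖) fun j _ => ?_).trans (by simp)
      rw [norm_mul, norm_pow, RCLike.norm_conj]
      exact (mul_le_of_le_one_left (norm_nonneg _) (pow_le_one₀ (norm_nonneg _)
        w.norm_le_one)).trans (norm_quotSeq_le hA w.norm_le_one j)
    calc ((n : ℝ) + 1) * ‖∑ j ∈ Finset.range (n + 1), conj (w : ℂ) ^ (n - j) * quotSeq N a w j‖
        ≤ ((n : ℝ) + 1) * (((n : ℝ) + 1) * (N * ‖x‖)) := by gcongr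
      _ = _ := by ring
  have h1 := hasSum_integral_series μ hcc hcb z
  have h2 : ∀ w, ∑' n, c n w * (z : ℂ) ^ n = cderiv (mulCauchyKer w (P w)) z := fun w => by
    rw [← (hasSum_coeff (cderiv_mem_hol (mulCauchyKer_mem_hol w.norm_le_one (hPh w))) z).tsum_eq]
    exact tsum_congr fun n => by rw [hco]
  simp_rw [h2] at h1
  have h3 := (hasSum_coeff (cderiv_mem_hol (DSpace.mem_hol μ x)) z).add h1
  refine (hasSum_coeff (cderiv_mem_hol (DSpace.cauchy_mem_hol μ x)) z).unique ?_
  refine h3.congr_fun fun n => ?_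
  rw [coeff_cderiv, coeff_cderiv, DSpace.coeff_cauchy, DSpace.inner_mono μ x hx (n + 1), mul_add,
    add_mul, DSpace.coeffCLM_apply, hc]
  simp only [integral_const_mul]
  rfl

/-- The reason for the weight `(1 - |z|²)² / V_μ`: it cancels exactly the constant produced by
Cauchy–Schwarz in `w`. -/
lemma lintegral_cauchyKer_mul_weightE (z : Disc) :
    (∫⁻ w : ClosedDisc, ‖cauchyKer w z‖ₑ ^ 2 ∂μ) * ENNReal.ofReal (weightE μ z) =
      ENNReal.ofReal (1 - ‖(z : ℂ)‖ ^ 2) := by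
  have h0 := one_sub_pos z
  have h1 : ∀ w : ClosedDisc, ‖cauchyKer w z‖ₑ ^ 2 =
      ENNReal.ofReal (poisson z w / (1 - ‖(z : ℂ)‖ ^ 2)) := fun w => by
    rw [enorm_sq_eq_ofReal, poisson_eq, mul_div_cancel_right₀ _ h0.ne']
  simp_rw [h1]
  rw [← ofReal_integral_eq_lintegral_ofReal ((integrable_poisson μ z).div_const _)
    (Eventually.of_forall fun w => div_nonneg (poisson_pos z w).le h0.le), integral_div,
    ← ENNReal.ofReal_mul (div_nonneg (integral_nonneg fun w => (poisson_pos z w).le) h0.le)]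
  congr 1
  have h2 := weightV_pos μ z
  rw [weightE]
  change weightV μ z / _ * _ = _
  field_simp

/-- The first term is a Carleson integral, with constant `4`, the second half of Littlewood–Paley,
with constant `1`; squaring the sum gives `2 · 4 + 2 · 1`. -/
lemma lintegral_kernel_bound (w : ClosedDisc) {f : Disc → ℂ} (hf : f ∈ Hol)
    (hs : sqsum (coeff f) < ∞) :
    ∫⁻ z : Disc, ‖cauchyKer w z * f z + z * cderiv f z‖ₑ ^ 2 *
      ENNReal.ofReal (1 - ‖(z : ℂ)‖ ^ 2) ∂dA ≤ 10 * sqsum (coeff f) := by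
  have hp : ∀ z : Disc, ‖cauchyKer w z * f z + z * cderiv f z‖ₑ ^ 2 *
      ENNReal.ofReal (1 - ‖(z : ℂ)‖ ^ 2) ≤ 2 * (‖f z‖ₑ ^ 2 * ENNReal.ofReal (poisson z w)) +
        2 * (‖cderiv f z‖ₑ ^ 2 * ENNReal.ofReal (1 - ‖(z : ℂ)‖ ^ 2)) := by
    intro z
    refine (mul_le_mul_left (enorm_add_sq_le _ _) _).trans ?_
    rw [add_mul, mul_assoc, mul_assoc]
    refine add_le_add (mul_le_mul_right (le_of_eq ?_) _) (mul_le_mul_right ?_ _)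
    · rw [poisson_eq, ← enorm_sq_mul_ofReal, enorm_mul, mul_pow]
      ring
    · refine mul_le_mul_left ?_ _
      rw [enorm_mul]
      refine pow_le_pow_left₀ zero_le (mul_le_of_le_one_left' ?_) 2
      rw [← ofReal_norm]
      exact ENNReal.ofReal_le_one.mpr z.norm_lt_one.le
  refine (lintegral_mono hp).trans ?_
  rw [lintegral_add_right, lintegral_const_mul' _ _ ENNReal.ofNat_ne_top,
    lintegral_const_mul' _ _ ENNReal.ofNat_ne_top]
  · have h1 := lintegral_poisson_le w hf hs
    have h2 := lintegral_cderiv_one_sub_sq_le hf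
    have h3 : (10 : ℝ≥0∞) * sqsum (coeff f) = 2 * (4 * sqsum (coeff f)) + 2 * sqsum (coeff f) := by
      rw [← mul_assoc, ← add_mul]
      norm_num
    rw [h3]
    exact add_le_add (mul_le_mul_right h1 _) (mul_le_mul_right h2 _)
  · exact (((measurable_cderiv hf).enorm.pow_const 2).mul (by fun_prop)).const_mul 2

lemma weightedNormSq_cauchy_le_of_mem_polyD {x : DSpace μ} (hx : x ∈ polyD μ) :
    weightedNormSq μ (DSpace.cauchy μ x) ≤ ENNReal.ofReal ((20 + 8 / mass μ) * ‖x‖ ^ 2) := by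
  have hm := mass_pos μ
  obtain ⟨N, hN⟩ := exists_of_mem_polyD μ hx
  set a : ℕ → ℂ := fun n => DSpace.coeffCLM μ n x with ha
  set P : ClosedDisc → Disc → ℂ := fun w => partialSum (quotSeq N a w) N with hP
  have hPh : ∀ w, P w ∈ Hol := fun w => partialSum_mem_hol _ _
  have hPc : ∀ w, coeff (P w) = quotSeq N a w := fun w => by
    rw [hP, coeff_partialSum]
    funext j
    split_ifs with h
    · rfl
    · exact (quotSeq_eq_zero hN w (not_lt.mp h)).symm
  have hPs : ∀ w, sqsum (coeff (P w)) = locDir w (DSpace.toFun μ x) := fun w => by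
    rw [hPc, sqsum_of_eq_zero fun n hn => quotSeq_eq_zero hN w hn,
      locDir_of_eq_zero w (DSpace.mem_hol μ x) hN]
    rfl
  have hPt : ∀ w, sqsum (coeff (P w)) < ∞ := fun w => by
    rw [hPc, sqsum_of_eq_zero fun n hn => quotSeq_eq_zero hN w hn]
    exact ENNReal.ofReal_lt_top
  set h : Disc → ClosedDisc → ℂ := fun z w => cauchyKer w z * P w z + z * cderiv (P w) z with hh
  have hk : Continuous fun p : Disc × ClosedDisc => cauchyKer (p.2 : ℂ) p.1 := by
    have hconj : Continuous fun p : Disc × ClosedDisc => conj (p.2 : ℂ) :=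
      Complex.continuous_conj.comp (by fun_prop)
    unfold cauchyKer
    exact continuous_const.div (by fun_prop) fun p => one_sub_conj_mul_ne_zero' p.2.norm_le_one p.1
  have hq : ∀ j, Continuous fun p : Disc × ClosedDisc => quotSeq N a (p.2 : ℂ) j := fun j =>
    (continuous_quotSeq N a j).comp continuous_snd
  have hcont : Continuous fun p : Disc × ClosedDisc => h p.1 p.2 := by
    simp only [hh, hP, cderiv_partialSum, partialSum]
    refine (hk.mul (continuous_finsetSum _ fun j _ => (hq j).mul (by fun_prop))).add
      (Continuous.mul (by fun_prop) (continuous_finsetSum _ fun j _ => (hq j).mul (by fun_prop)))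
  -- Cauchy–Schwarz in `w`, separating the factor `1 / (1 - conj w z)` from `h z w`.
  have hI : ∀ z, ‖∫ w : ClosedDisc, cderiv (mulCauchyKer w (P w)) z ∂μ‖ₑ ^ 2 *
      ENNReal.ofReal (weightE μ z) ≤
      ∫⁻ w, ‖h z w‖ₑ ^ 2 * ENNReal.ofReal (1 - ‖(z : ℂ)‖ ^ 2) ∂μ := by
    intro z
    have h1 : ‖∫ w : ClosedDisc, cderiv (mulCauchyKer w (P w)) z ∂μ‖ₑ ≤
        ∫⁻ w : ClosedDisc, ‖cauchyKer w z‖ₑ * ‖h z w‖ₑ ∂μ := by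
      refine (enorm_integral_le_lintegral_enorm _).trans (lintegral_mono fun w => ?_)
      rw [cderiv_mulCauchyKer w.norm_le_one (hPh w), enorm_mul]
    have h2 := (pow_le_pow_left₀ zero_le h1 2).trans (lintegral_mul_sq_le μ
      (f := fun w : ClosedDisc => ‖cauchyKer w z‖ₑ) (g := fun w => ‖h z w‖ₑ)
      ((hk.comp (Continuous.prodMk_right z)).measurable.enorm.aemeasurable)
      ((hcont.comp (Continuous.prodMk_right z)).measurable.enorm.aemeasurable))
    refine (mul_le_mul_left h2 _).trans (le_of_eq ?_)
    rw [mul_right_comm, lintegral_cauchyKer_mul_weightE, mul_comm,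
      lintegral_mul_const' _ _ ENNReal.ofReal_ne_top]
  -- After Tonelli the uniform bound in `w` leaves `∫ ‖Q_w f‖² dμ(w)`, which is the energy.
  have hE : ∫⁻ z, (∫⁻ w, ‖h z w‖ₑ ^ 2 * ENNReal.ofReal (1 - ‖(z : ℂ)‖ ^ 2) ∂μ) ∂dA ≤
      10 * energy μ (DSpace.toFun μ x) := by
    rw [lintegral_lintegral_swap, energy_eq_lintegral_locDir μ (DSpace.mem_hol μ x),
      ← lintegral_const_mul' _ _ ENNReal.ofNat_ne_top]
    · refine lintegral_mono fun w => ?_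
      rw [← hPs w]
      exact lintegral_kernel_bound w (hPh w) (hPt w)
    · have h1 : Measurable fun p : Disc × ClosedDisc =>
          ‖h p.1 p.2‖ₑ ^ 2 * ENNReal.ofReal (1 - ‖(p.1 : ℂ)‖ ^ 2) :=
        (hcont.measurable.enorm.pow_const 2).mul (by fun_prop)
      exact h1.aemeasurable
  have hd : ∫⁻ z, ‖cderiv (DSpace.toFun μ x) z‖ₑ ^ 2 * ENNReal.ofReal (weightE μ z) ∂dA ≤
      ENNReal.ofReal (4 / mass μ) * sqsum (coeff (DSpace.toFun μ x)) := by
    refine le_trans (lintegral_mono fun z => ?_) (le_trans (le_of_eq (lintegral_const_mul'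
      (ENNReal.ofReal (4 / mass μ)) (fun z : Disc => ‖cderiv (DSpace.toFun μ x) z‖ₑ ^ 2 *
        ENNReal.ofReal (1 - ‖(z : ℂ)‖ ^ 2)) ENNReal.ofReal_ne_top))
      (mul_le_mul_right (lintegral_cderiv_one_sub_sq_le (DSpace.mem_hol μ x)) _))
    rw [mul_left_comm, ← ENNReal.ofReal_mul (by positivity)]
    exact mul_le_mul_right (ENNReal.ofReal_le_ofReal (weightE_le μ z)) _
  have h0 : ‖DSpace.cauchy μ x origin‖ₑ ^ 2 ≤ sqsum (coeff (DSpace.toFun μ x)) := by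
    rw [← coeff_zero_eq (DSpace.cauchy μ x), DSpace.coeff_cauchy, DSpace.inner_mono μ x hN 0]
    simp only [Finset.range_zero, Finset.sum_empty, integral_zero, add_zero]
    exact ENNReal.le_tsum (f := fun n => ‖coeff (DSpace.toFun μ x) n‖ₑ ^ 2) 0
  have hmain : weightedNormSq μ (DSpace.cauchy μ x) ≤
      ENNReal.ofReal (20 + 8 / mass μ) * dirichletNormSq μ (DSpace.toFun μ x) := by
    set S := sqsum (coeff (DSpace.toFun μ x)) with hS
    set En := energy μ (DSpace.toFun μ x) with hEn
    have h1 : ∫⁻ z, ‖cderiv (DSpace.cauchy μ x) z‖ₑ ^ 2 * ENNReal.ofReal (weightE μ z) ∂dA ≤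
        2 * (ENNReal.ofReal (4 / mass μ) * S) + 2 * (10 * En) := by
      refine le_trans (lintegral_mono (g := fun z => 2 * (‖cderiv (DSpace.toFun μ x) z‖ₑ ^ 2 *
          ENNReal.ofReal (weightE μ z)) +
          2 * ∫⁻ w, ‖h z w‖ₑ ^ 2 * ENNReal.ofReal (1 - ‖(z : ℂ)‖ ^ 2) ∂μ) fun z => ?_) ?_
      · rw [DSpace.cderiv_cauchy μ x hN]
        refine (mul_le_mul_left (enorm_add_sq_le _ _) _).trans ?_
        rw [add_mul, mul_assoc, mul_assoc]
        exact add_le_add le_rfl (mul_le_mul_right (hI z) _)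
      · rw [lintegral_add_left, lintegral_const_mul' _ _ ENNReal.ofNat_ne_top,
          lintegral_const_mul' _ _ ENNReal.ofNat_ne_top]
        · exact add_le_add (mul_le_mul_right hd _) (mul_le_mul_right hE _)
        · exact (((measurable_cderiv (DSpace.mem_hol μ x)).enorm.pow_const 2).mul
            (ENNReal.measurable_ofReal.comp (measurable_weightE μ))).const_mul 2
    have e1 : (2 : ℝ≥0∞) * (ENNReal.ofReal (4 / mass μ) * S) = ENNReal.ofReal (8 / mass μ) * S := by
      rw [← mul_assoc, ← ENNReal.ofReal_ofNat 2, ← ENNReal.ofReal_mul zero_le_two]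
      congr 2
      ring
    have e2 : (2 : ℝ≥0∞) * (10 * En) = 20 * En := by
      rw [← mul_assoc]
      norm_num
    rw [e1, e2] at h1
    refine (add_le_add h0 h1).trans ?_
    rw [dirichletNormSq_eq, mul_add, ENNReal.ofReal_add (by norm_num) (by positivity),
      ENNReal.ofReal_ofNat, add_mul, add_mul, ← add_assoc]
    have e3 : S ≤ 20 * S := le_mul_of_one_le_left' (by norm_num)
    exact add_le_add (add_le_add e3 le_rfl) le_self_add
  rw [DSpace.normSq_eq, ← ENNReal.ofReal_mul (by positivity)] at hmain
  exact hmain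

end CauchyMap

/-! ### Comparison of `V_μ` with `U_μ` and the Carleson bound for `V_μ dA`. -/

lemma ofReal_weightV (μ : Measure ClosedDisc) [IsFiniteMeasure μ] (z : Disc) :
    ENNReal.ofReal (weightV μ z) = ∫⁻ w, ENNReal.ofReal (poisson z w) ∂μ :=
  ofReal_integral_eq_lintegral_ofReal (integrable_poisson μ z)
    (Eventually.of_forall fun w => (poisson_pos z w).le)

lemma ofReal_weightV_le (μ : Measure ClosedDisc) [IsFiniteMeasure μ] (z : Disc) : ENNReal.ofReal (weightV μ z) ≤ weightU μ z := by
  rw [ofReal_weightV, weightU_eq]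
  exact lintegral_mono fun w => poisson_le_locKernel z w

lemma lintegral_mul_weightV_le (μ : Measure ClosedDisc) [IsFiniteMeasure μ] {f : Disc → ℂ} (hf : f ∈ Hol) (hs : sqsum (coeff f) < ∞) :
    ∫⁻ z, ‖f z‖ₑ ^ 2 * ENNReal.ofReal (weightV μ z) ∂dA ≤
      ENNReal.ofReal (4 * mass μ) * sqsum (coeff f) := by
  have h1 : ∀ z, ‖f z‖ₑ ^ 2 * ENNReal.ofReal (weightV μ z) =
      ∫⁻ w, ‖f z‖ₑ ^ 2 * ENNReal.ofReal (poisson z w) ∂μ := fun z => by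
    rw [ofReal_weightV, lintegral_const_mul' _ _ (by
      rw [enorm_sq_eq_ofReal]; exact ENNReal.ofReal_ne_top)]
  simp_rw [h1]
  rw [lintegral_lintegral_swap]
  · refine (lintegral_mono fun w => lintegral_poisson_le w hf hs).trans (le_of_eq ?_)
    rw [lintegral_const, ENNReal.ofReal_mul (by norm_num), mass, ofReal_measureReal,
      ENNReal.ofReal_ofNat]
    ring
  · have h2 : Measurable fun p : Disc × ClosedDisc =>
        ‖f p.1‖ₑ ^ 2 * ENNReal.ofReal (poisson p.1 p.2) :=
      (((continuous_hol hf).comp continuous_fst).measurable.enorm.pow_const 2).mul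
        (ENNReal.measurable_ofReal.comp continuous_poisson.measurable)
    exact h2.aemeasurable

/-! ### The Cauchy map on all of `D(μ)`. -/

section CauchyMap

variable (μ : Measure ClosedDisc) [IsFiniteMeasure μ] [NeZero μ]

/-- The bound passes from polynomials to their limits because the norm of `L²_{a,μ}` is lower
semicontinuous for coefficientwise convergence with linear bounds. -/
lemma weightedNormSq_cauchy_le (x : DSpace μ) :
    weightedNormSq μ (DSpace.cauchy μ x) ≤ ENNReal.ofReal ((20 + 8 / mass μ) * ‖x‖ ^ 2) := by
  have hm := mass_pos μ
  have hx : x ∈ closure (polyD μ : Set (DSpace μ)) := by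
    rw [← Submodule.topologicalClosure_coe, topologicalClosure_polyD]
    trivial
  obtain ⟨p, hp, hlim⟩ := mem_closure_iff_seq_limit.mp hx
  obtain ⟨R, hR⟩ := (Metric.isBounded_range_of_tendsto p hlim).exists_norm_le
  have hR' : ∀ k, ‖p k‖ ≤ R := fun k => hR _ ⟨k, rfl⟩
  have H : HolTendsto (fun k => DSpace.cauchy μ (p k)) (DSpace.cauchy μ x) := by
    refine holTendsto_of_coeff (B := (1 + mass μ) * R) (fun k => DSpace.cauchy_mem_hol μ _)
      (DSpace.cauchy_mem_hol μ _) (fun n => ?_) fun k n => ?_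
    · simp_rw [DSpace.coeff_cauchy]
      exact tendsto_const_nhds.inner hlim
    · rw [DSpace.coeff_cauchy]
      refine (DSpace.norm_inner_mono_le μ (p k) n).trans ?_
      have := hR' k
      gcongr
  refine (weightedNormSq_le_liminf μ H).trans ((liminf_le_liminf (Eventually.of_forall fun k =>
    weightedNormSq_cauchy_le_of_mem_polyD μ (hp k))).trans (le_of_eq ?_))
  exact (ENNReal.tendsto_ofReal ((hlim.norm.pow 2).const_mul _)).liminf_eq

lemma DSpace.cauchy_add (x y : DSpace μ) :
    DSpace.cauchy μ (x + y) = DSpace.cauchy μ x + DSpace.cauchy μ y :=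
  eq_of_coeff_eq (DSpace.cauchy_mem_hol μ _) (Hol.add_mem (DSpace.cauchy_mem_hol μ _)
    (DSpace.cauchy_mem_hol μ _)) (funext fun n => by
      rw [coeff_add (DSpace.cauchy_mem_hol μ _) (DSpace.cauchy_mem_hol μ _), Pi.add_apply,
        DSpace.coeff_cauchy, DSpace.coeff_cauchy, DSpace.coeff_cauchy, inner_add_right])

lemma DSpace.cauchy_smul (c : ℂ) (x : DSpace μ) :
    DSpace.cauchy μ (c • x) = c • DSpace.cauchy μ x :=
  eq_of_coeff_eq (DSpace.cauchy_mem_hol μ _) (Hol.smul_mem c (DSpace.cauchy_mem_hol μ _))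
    (funext fun n => by
      rw [coeff_smul c (DSpace.cauchy_mem_hol μ _), Pi.smul_apply,
        DSpace.coeff_cauchy, DSpace.coeff_cauchy, inner_smul_right, smul_eq_mul])

lemma exists_toFun_eq_cauchy (x : DSpace μ) :
    ∃ y : WeightedSpace μ, WeightedSpace.toFun μ y = DSpace.cauchy μ x :=
  exists_weightedSpace μ (DSpace.cauchy_mem_hol μ x)
    (lt_of_le_of_lt (weightedNormSq_cauchy_le μ x) ENNReal.ofReal_lt_top)

/-- The Cauchy map from `D(μ)` to `L²_{a,μ}`, as a linear map. -/
noncomputable def cauchyLM : DSpace μ →ₗ[ℂ] WeightedSpace μ where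
  toFun x := (exists_toFun_eq_cauchy μ x).choose
  map_add' x y := WeightedSpace.toFun_injective μ (by
    rw [map_add, (exists_toFun_eq_cauchy μ _).choose_spec,
      (exists_toFun_eq_cauchy μ _).choose_spec, (exists_toFun_eq_cauchy μ _).choose_spec,
      DSpace.cauchy_add])
  map_smul' c x := WeightedSpace.toFun_injective μ (by
    rw [map_smul, (exists_toFun_eq_cauchy μ _).choose_spec,
      (exists_toFun_eq_cauchy μ _).choose_spec, DSpace.cauchy_smul, RingHom.id_apply])

lemma toFun_cauchyLM (x : DSpace μ) :
    WeightedSpace.toFun μ (cauchyLM μ x) = DSpace.cauchy μ x :=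
  (exists_toFun_eq_cauchy μ x).choose_spec

lemma norm_cauchyLM_sq_le (x : DSpace μ) :
    ‖cauchyLM μ x‖ ^ 2 ≤ (20 + 8 / mass μ) * ‖x‖ ^ 2 := by
  have hm := mass_pos μ
  have h := weightedNormSq_cauchy_le μ x
  rwa [← toFun_cauchyLM, weightedNormSq_toFun, ENNReal.ofReal_le_ofReal_iff (by positivity)] at h

/-- The Cauchy map from `D(μ)` to `L²_{a,μ}`. -/
noncomputable def cauchyCLM : DSpace μ →L[ℂ] WeightedSpace μ :=
  (cauchyLM μ).mkContinuous (√(20 + 8 / mass μ)) fun x => by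
    have hm := mass_pos μ
    refine le_of_sq_le_sq ((norm_cauchyLM_sq_le μ x).trans (le_of_eq ?_)) (by positivity)
    rw [mul_pow, Real.sq_sqrt (by positivity)]

lemma toFun_cauchyCLM (x : DSpace μ) :
    WeightedSpace.toFun μ (cauchyCLM μ x) = DSpace.cauchy μ x := toFun_cauchyLM μ x

lemma norm_cauchyCLM_sq_le (x : DSpace μ) :
    ‖cauchyCLM μ x‖ ^ 2 ≤ (20 + 8 / mass μ) * ‖x‖ ^ 2 := norm_cauchyLM_sq_le μ x

/-- The preimages of the polynomials under `U` are the combinations of these representers; this is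
what makes a dense subspace of `D(μ)` computable on the `E(μ)` side. -/
lemma cauchy_rep (n : ℕ) : DSpace.cauchy μ (DSpace.rep μ n) = monomial n := by
  refine eq_of_coeff_eq (DSpace.cauchy_mem_hol μ _) (monomial_mem_hol n) (funext fun k => ?_)
  rw [DSpace.coeff_cauchy, ← inner_conj_symm, DSpace.inner_rep, DSpace.coeffCLM_mono,
    coeff_monomial, Pi.single_apply]
  by_cases h : n = k
  · simp [h]
  · simp [h, Ne.symm h]

lemma cauchy_sum_rep (a : ℕ → ℂ) (N : ℕ) :
    DSpace.cauchy μ (∑ n ∈ Finset.range N, a n • DSpace.rep μ n) = partialSum a N := by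
  rw [← toFun_cauchyCLM, map_sum, map_sum]
  funext z
  simp only [map_smul, toFun_cauchyCLM, cauchy_rep, Finset.sum_apply, Pi.smul_apply, smul_eq_mul]
  rfl

/-! ### The pairing of `D(μ)` and `E(μ)` -/

lemma norm_add_sq_eq_norm_sub_sq_add (a b : ℂ) :
    ‖a + b‖ ^ 2 = ‖a - b‖ ^ 2 + 4 * (conj b * a).re := by
  rw [Complex.sq_norm, Complex.sq_norm, Complex.normSq_apply, Complex.normSq_apply]
  simp only [Complex.add_re, Complex.add_im, Complex.sub_re, Complex.sub_im, Complex.mul_re,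
    Complex.conj_re, Complex.conj_im]
  ring

/-- The difference of the two squares is `4 Re (conj b a)`, estimated by the arithmetic–geometric
mean inequality for `√v |a|` and `|r| |b| / √v`. With `r = 1 - |z|²` and `v = V_μ(z)` the last
weight is that of `L²_{a,μ}`. -/
lemma norm_add_sq_mul_le (a b : ℂ) {r v : ℝ} (hv : 0 < v) :
    ‖a + b‖ ^ 2 * r ≤ ‖a - b‖ ^ 2 * r + 2 * (‖a‖ ^ 2 * v + ‖b‖ ^ 2 * (r ^ 2 / v)) := by
  have h1 := norm_add_sq_eq_norm_sub_sq_add a b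
  have h2 : (conj b * a).re * r ≤ ‖a‖ * ‖b‖ * |r| := by
    have h3 := Complex.abs_re_le_norm (conj b * a)
    rw [norm_mul, RCLike.norm_conj] at h3
    calc (conj b * a).re * r ≤ |(conj b * a).re * r| := le_abs_self _
      _ = |(conj b * a).re| * |r| := abs_mul _ _
      _ ≤ ‖a‖ * ‖b‖ * |r| := by
          rw [mul_comm ‖a‖]
          gcongr
  have h4 : 2 * (‖a‖ * ‖b‖ * |r|) ≤ ‖a‖ ^ 2 * v + ‖b‖ ^ 2 * (r ^ 2 / v) := by
    have h5 : 0 ≤ (‖a‖ * v - ‖b‖ * |r|) ^ 2 / v := by positivity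
    have h6 : (‖a‖ * v - ‖b‖ * |r|) ^ 2 / v =
        ‖a‖ ^ 2 * v + ‖b‖ ^ 2 * (|r| ^ 2 / v) - 2 * (‖a‖ * ‖b‖ * |r|) := by
      field_simp
      ring
    rw [h6, sq_abs] at h5
    linarith
  rw [h1]
  linarith

lemma lintegral_add_sq_le {A B : Disc → ℂ} (hA : A ∈ Hol) (hB : B ∈ Hol) :
    ∫⁻ z : Disc, ‖(A + B) z‖ₑ ^ 2 * ENNReal.ofReal (1 - ‖(z : ℂ)‖ ^ 2) ∂dA ≤
      ∫⁻ z : Disc, ‖(A - B) z‖ₑ ^ 2 * ENNReal.ofReal (1 - ‖(z : ℂ)‖ ^ 2) ∂dA +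
      2 * (∫⁻ z, ‖A z‖ₑ ^ 2 * ENNReal.ofReal (weightV μ z) ∂dA +
        ∫⁻ z, ‖B z‖ₑ ^ 2 * ENNReal.ofReal (weightE μ z) ∂dA) := by
  have hmB := (continuous_hol hB).measurable.enorm.pow_const 2
  have hmS := (continuous_hol (Hol.sub_mem hA hB)).measurable.enorm.pow_const 2
  have hE : Measurable fun z => ENNReal.ofReal (weightE μ z) :=
    ENNReal.measurable_ofReal.comp (measurable_weightE μ)
  have hBE : Measurable fun z => ‖B z‖ₑ ^ 2 * ENNReal.ofReal (weightE μ z) := hmB.mul hE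
  have hSE : Measurable fun z : Disc =>
      ‖(A - B) z‖ₑ ^ 2 * ENNReal.ofReal (1 - ‖(z : ℂ)‖ ^ 2) := hmS.mul (by fun_prop)
  rw [← lintegral_add_right _ hBE, ← lintegral_const_mul' _ _ ENNReal.ofNat_ne_top,
    ← lintegral_add_left hSE]
  refine lintegral_mono fun z => ?_
  have h0 := weightV_pos μ z
  rw [enorm_sq_mul_ofReal, enorm_sq_mul_ofReal, enorm_sq_mul_ofReal, enorm_sq_mul_ofReal,
    ← ENNReal.ofReal_add (by positivity) (mul_nonneg (sq_nonneg _) (weightE_nonneg μ z)),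
    ← ENNReal.ofReal_ofNat 2, ← ENNReal.ofReal_mul zero_le_two,
    ← ENNReal.ofReal_add (mul_nonneg (sq_nonneg _) (one_sub_pos z).le)
      (mul_nonneg zero_le_two (add_nonneg (by positivity)
        (mul_nonneg (sq_nonneg _) (weightE_nonneg μ z))))]
  exact ENNReal.ofReal_le_ofReal (norm_add_sq_mul_le (A z) (B z) h0)

lemma lintegral_one_sub_sq_of_eq_zero {f : Disc → ℂ} (hf : f ∈ Hol) {N : ℕ}
    (h : ∀ n, N ≤ n → coeff f n = 0) :
    ∫⁻ z : Disc, ‖f z‖ₑ ^ 2 * ENNReal.ofReal (1 - ‖(z : ℂ)‖ ^ 2) ∂dA =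
      ENNReal.ofReal (∑ n ∈ Finset.range N, ‖coeff f n‖ ^ 2 * (1 / ((n + 1) * (n + 2)))) := by
  rw [lintegral_one_sub_sq hf, tsum_eq_sum (s := Finset.range N) fun n hn => by
    rw [h n (by simpa using hn)]; simp, ENNReal.ofReal_sum_of_nonneg fun n _ => by positivity]
  exact Finset.sum_congr rfl fun n _ => enorm_sq_mul_ofReal _ _

/-- The Hardy space pairing of polynomials is bounded with respect to `D(μ)` and `L²_{a,μ}`. -/
lemma re_pairing_le (x : DSpace μ) (y : WeightedSpace μ) {N : ℕ}
    (hx : ∀ n, N ≤ n → DSpace.coeffCLM μ n x = 0)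
    (hy : ∀ n, N ≤ n → coeff (WeightedSpace.toFun μ y) n = 0) :
    (∑ n ∈ Finset.range (N + 1), conj (coeff (WeightedSpace.toFun μ y) n) *
      DSpace.coeffCLM μ n x).re ≤ (5 + 4 * mass μ) * ‖x‖ ^ 2 + 1 / 2 * ‖y‖ ^ 2 := by
  have hm := mass_pos μ
  set f := DSpace.toFun μ x with hf'
  set q := WeightedSpace.toFun μ y with hq'
  have hf : f ∈ Hol := DSpace.mem_hol μ x
  have hq : q ∈ Hol := WeightedSpace.toFun_mem_hol μ y
  have hx' : ∀ n, N ≤ n → coeff f n = 0 := hx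
  -- `L = (f - f(0)) / z`. Adding it to `f'` changes the factor `n + 1` to `n + 2`, so that the
  -- moment `1 / ((n + 1)(n + 2))` of `1 - |z|²` gives exactly the `H²` pairing with `q'`.
  set L := partialSum (fun n => coeff f (n + 1)) N with hL'
  have hL : L ∈ Hol := partialSum_mem_hol _ _
  have hLc : coeff L = fun n => coeff f (n + 1) := by
    rw [hL', coeff_partialSum]
    funext n
    split_ifs with h
    · rfl
    · exact (hx' _ (by omega)).symm
  have hA : cderiv f + L ∈ Hol := Hol.add_mem (cderiv_mem_hol hf) hL
  have hB := cderiv_mem_hol hq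
  have hAc : ∀ n, coeff (cderiv f + L) n = (n + 2) * coeff f (n + 1) := fun n => by
    rw [coeff_add (cderiv_mem_hol hf) hL, Pi.add_apply, coeff_cderiv, hLc]
    ring
  have hLs : sqsum (coeff L) ≤ sqsum (coeff f) := by
    rw [hLc]
    exact ENNReal.tsum_comp_le_tsum_of_injective (add_left_injective 1) fun n => ‖coeff f n‖ₑ ^ 2
  have hfs : sqsum (coeff f) < ∞ := DSpace.sqsum_lt_top μ x
  -- For `f'` by `V_μ ≤ U_μ`, for `L` by the Carleson bound.
  have hXA : ∫⁻ z, ‖(cderiv f + L) z‖ₑ ^ 2 * ENNReal.ofReal (weightV μ z) ∂dA ≤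
      ENNReal.ofReal ((2 + 8 * mass μ) * ‖x‖ ^ 2) := by
    have h1 : ∫⁻ z, ‖(cderiv f + L) z‖ₑ ^ 2 * ENNReal.ofReal (weightV μ z) ∂dA ≤
        2 * energy μ f + 2 * (ENNReal.ofReal (4 * mass μ) * sqsum (coeff f)) := by
      refine (lintegral_mono (g := fun z => 2 * (‖cderiv f z‖ₑ ^ 2 * weightU μ z) +
        2 * (‖L z‖ₑ ^ 2 * ENNReal.ofReal (weightV μ z))) fun z => ?_).trans ?_
      · refine (mul_le_mul_left (enorm_add_sq_le _ _) _).trans ?_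
        rw [add_mul, mul_assoc, mul_assoc]
        exact add_le_add (mul_le_mul_right (mul_le_mul_right (ofReal_weightV_le μ z) _) _) le_rfl
      · rw [lintegral_add_left, lintegral_const_mul' _ _ ENNReal.ofNat_ne_top,
          lintegral_const_mul' _ _ ENNReal.ofNat_ne_top]
        · exact add_le_add le_rfl (mul_le_mul_right ((lintegral_mul_weightV_le μ hL
            (lt_of_le_of_lt hLs hfs)).trans (mul_le_mul_right hLs _)) _)
        · exact (((measurable_cderiv hf).enorm.pow_const 2).mul (measurable_weightU μ)).const_mul 2
    refine h1.trans ?_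
    rw [ENNReal.ofReal_mul (p := 2 + 8 * mass μ) (by positivity), ← DSpace.normSq_eq, dirichletNormSq_eq,
      ENNReal.ofReal_add zero_le_two (by positivity), ENNReal.ofReal_ofNat, add_mul, mul_add,
      ← hf']
    have e1 : (2 : ℝ≥0∞) * (ENNReal.ofReal (4 * mass μ) * sqsum (coeff f)) =
        ENNReal.ofReal (8 * mass μ) * sqsum (coeff f) := by
      rw [← mul_assoc, ← ENNReal.ofReal_ofNat 2, ← ENNReal.ofReal_mul zero_le_two]
      congr 2
      ring
    rw [e1]
    exact add_le_add le_add_self (mul_le_mul_right le_self_add _)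
  have hXB : ENNReal.ofReal (‖coeff q 0‖ ^ 2) +
      ∫⁻ z, ‖cderiv q z‖ₑ ^ 2 * ENNReal.ofReal (weightE μ z) ∂dA = ENNReal.ofReal (‖y‖ ^ 2) := by
    rw [← weightedNormSq_toFun, weightedNormSq, coeff_zero_eq q, enorm_sq_eq_ofReal]
  -- The subtracted `‖q(0)‖²` later absorbs the constant term of the pairing, so the coefficient `1
  -- / 2` of `‖y‖²` is not exceeded.
  have hXB' : ∫⁻ z, ‖cderiv q z‖ₑ ^ 2 * ENNReal.ofReal (weightE μ z) ∂dA ≤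
      ENNReal.ofReal (‖y‖ ^ 2 - ‖coeff q 0‖ ^ 2) := by
    rw [ENNReal.ofReal_sub _ (sq_nonneg _), ← hXB,
      ENNReal.add_sub_cancel_left ENNReal.ofReal_ne_top]
  have hq0 : 0 ≤ ‖y‖ ^ 2 - ‖coeff q 0‖ ^ 2 := by
    have h1 : ENNReal.ofReal (‖coeff q 0‖ ^ 2) ≤ ENNReal.ofReal (‖y‖ ^ 2) := by
      rw [← hXB]; exact le_self_add
    rw [ENNReal.ofReal_le_ofReal_iff (sq_nonneg _)] at h1
    linarith
  have hcs : ∀ n, coeff (cderiv f + L + cderiv q) n =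
      (n + 2) * coeff f (n + 1) + (n + 1) * coeff q (n + 1) := fun n => by
    rw [coeff_add hA hB, Pi.add_apply, hAc, coeff_cderiv]
  have hcd : ∀ n, coeff (cderiv f + L - cderiv q) n =
      (n + 2) * coeff f (n + 1) - (n + 1) * coeff q (n + 1) := fun n => by
    rw [coeff_sub hA hB, Pi.sub_apply, hAc, coeff_cderiv]
  have hmain := lintegral_add_sq_le μ hA hB
  rw [lintegral_one_sub_sq_of_eq_zero (N := N) (Hol.add_mem hA hB) fun n hn => by
      rw [hcs, hx' _ (by omega), hy _ (by omega)]; simp,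
    lintegral_one_sub_sq_of_eq_zero (N := N) (Hol.sub_mem hA hB) fun n hn => by
      rw [hcd, hx' _ (by omega), hy _ (by omega)]; simp] at hmain
  have hsum : ENNReal.ofReal (∑ n ∈ Finset.range N,
      ‖coeff (cderiv f + L + cderiv q) n‖ ^ 2 * (1 / ((n + 1) * (n + 2)))) ≤
      ENNReal.ofReal (∑ n ∈ Finset.range N,
      ‖coeff (cderiv f + L - cderiv q) n‖ ^ 2 * (1 / ((n + 1) * (n + 2))) +
        2 * ((2 + 8 * mass μ) * ‖x‖ ^ 2 + (‖y‖ ^ 2 - ‖coeff q 0‖ ^ 2))) := by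
    refine hmain.trans ?_
    rw [ENNReal.ofReal_add (Finset.sum_nonneg fun n _ => by positivity) (by positivity),
      ENNReal.ofReal_mul zero_le_two, ENNReal.ofReal_add (by positivity) hq0, ENNReal.ofReal_ofNat]
    exact add_le_add le_rfl (mul_le_mul_right (add_le_add hXA hXB') _)
  rw [ENNReal.ofReal_le_ofReal_iff (add_nonneg (Finset.sum_nonneg fun n _ => by positivity)
    (by positivity))] at hsum
  have hterm : ∀ n : ℕ, ‖coeff (cderiv f + L + cderiv q) n‖ ^ 2 * (1 / (((n : ℝ) + 1) * (n + 2))) =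
      ‖coeff (cderiv f + L - cderiv q) n‖ ^ 2 * (1 / (((n : ℝ) + 1) * (n + 2))) +
        4 * (conj (coeff q (n + 1)) * coeff f (n + 1)).re := by
    intro n
    rw [hcs, hcd, norm_add_sq_eq_norm_sub_sq_add]
    have h1 : conj (((n : ℂ) + 1) * coeff q (n + 1)) * (((n : ℂ) + 2) * coeff f (n + 1)) =
        ((((n : ℝ) + 1) * (n + 2) : ℝ) : ℂ) * (conj (coeff q (n + 1)) * coeff f (n + 1)) := by
      simp only [map_mul, map_add, map_natCast, map_one]
      push_cast
      ring
    rw [h1, Complex.re_ofReal_mul]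
    field_simp
  rw [Finset.sum_congr rfl fun n _ => hterm n, Finset.sum_add_distrib, ← Finset.mul_sum] at hsum
  have h0 : (conj (coeff q 0) * coeff f 0).re ≤ 1 / 2 * (‖coeff q 0‖ ^ 2 + ‖x‖ ^ 2) := by
    refine (Complex.re_le_norm _).trans ?_
    rw [norm_mul, RCLike.norm_conj]
    have h1 : ‖coeff f 0‖ ≤ ‖x‖ := DSpace.norm_coeff_le μ x 0
    nlinarith [sq_nonneg (‖coeff q 0‖ - ‖x‖), norm_nonneg (coeff q 0),
      mul_le_mul_of_nonneg_left h1 (norm_nonneg (coeff q 0))]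
  rw [Finset.sum_range_succ', Complex.add_re, Complex.re_sum]
  change ∑ n ∈ Finset.range N, (conj (coeff q (n + 1)) * coeff f (n + 1)).re +
    (conj (coeff q 0) * coeff f 0).re ≤ _
  nlinarith [mul_nonneg hm.le (sq_nonneg ‖x‖), sq_nonneg ‖x‖]

/-- A bound on an element of `D(μ)` from a bound on its inner products with polynomials. -/
lemma norm_sq_le_of_re_inner_le {f : DSpace μ} {K B : ℝ} (hK : 0 < K)
    (h : ∀ x ∈ polyD μ, (inner ℂ f x : ℂ).re ≤ K * ‖x‖ ^ 2 + 1 / 2 * B ^ 2) :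
    ‖f‖ ^ 2 ≤ 2 * K * B ^ 2 := by
  have hall : ∀ x, (inner ℂ f x : ℂ).re ≤ K * ‖x‖ ^ 2 + 1 / 2 * B ^ 2 := by
    intro x
    have hx : x ∈ closure (polyD μ : Set (DSpace μ)) := by
      rw [← Submodule.topologicalClosure_coe, topologicalClosure_polyD]
      trivial
    refine closure_minimal (t := {x | (inner ℂ f x : ℂ).re ≤ K * ‖x‖ ^ 2 + 1 / 2 * B ^ 2}) h ?_ hx
    exact isClosed_le (Complex.continuous_re.comp (continuous_const.inner continuous_id))
      (by fun_prop)
  -- This multiple of `f` balances the linear left side against `K ‖x‖²`: half of the left side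
  -- survives.
  have h1 := hall (((1 / (2 * K) : ℝ) : ℂ) • f)
  rw [inner_smul_right, Complex.re_ofReal_mul, norm_smul, Complex.norm_real, Real.norm_eq_abs,
    abs_of_pos (by positivity)] at h1
  have h2 : (inner ℂ f f : ℂ).re = ‖f‖ ^ 2 := by
    rw [inner_self_eq_norm_sq_to_K]
    have : ((‖f‖ : ℂ)) ^ 2 = ((‖f‖ ^ 2 : ℝ) : ℂ) := by push_cast; rfl
    exact (congrArg Complex.re this).trans (Complex.ofReal_re _)
  rw [h2, mul_pow] at h1
  have h3 : K * ((1 / (2 * K)) ^ 2 * ‖f‖ ^ 2) = 1 / 2 * (1 / (2 * K) * ‖f‖ ^ 2) := by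
    field_simp
  have h4 : 1 / (2 * K) * ‖f‖ ^ 2 ≤ B ^ 2 := by linarith
  rw [one_div, inv_mul_le_iff₀ (by positivity)] at h4
  exact h4

lemma inner_sum_rep (a : ℕ → ℂ) (N : ℕ) (x : DSpace μ) :
    inner ℂ (∑ n ∈ Finset.range N, a n • DSpace.rep μ n) x =
      ∑ n ∈ Finset.range N, conj (a n) * DSpace.coeffCLM μ n x := by
  rw [sum_inner]
  exact Finset.sum_congr rfl fun n _ => by rw [inner_smul_left, DSpace.inner_rep]

lemma exists_sum_rep_of_mem_repD {f : DSpace μ} (hf : f ∈ repD μ) :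
    ∃ (a : ℕ → ℂ) (N : ℕ), f = ∑ n ∈ Finset.range N, a n • DSpace.rep μ n := by
  obtain ⟨c, rfl⟩ := (Finsupp.mem_span_range_iff_exists_finsupp).mp hf
  obtain ⟨N, hN⟩ := c.support.exists_nat_subset_range
  refine ⟨c, N, ?_⟩
  exact Finsupp.sum_of_support_subset c hN _ fun n _ => by simp

/-- On combinations of representers `U f` is a polynomial and `⟨f, x⟩` is its `H²` pairing with `x`,
so `re_pairing_le` bounds `f` by duality with polynomials. Density and continuity extend the
inequality to every `f`. -/
lemma norm_sq_le_norm_cauchyCLM_sq (f : DSpace μ) :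
    ‖f‖ ^ 2 ≤ 2 * (5 + 4 * mass μ) * ‖cauchyCLM μ f‖ ^ 2 := by
  have hm := mass_pos μ
  have hmem : f ∈ closure (repD μ : Set (DSpace μ)) := by
    rw [← Submodule.topologicalClosure_coe, topologicalClosure_repD]
    trivial
  refine closure_minimal (t := {f | ‖f‖ ^ 2 ≤ 2 * (5 + 4 * mass μ) * ‖cauchyCLM μ f‖ ^ 2})
    (fun f hf => ?_) (isClosed_le (by fun_prop) (by fun_prop)) hmem
  obtain ⟨a, N, rfl⟩ := exists_sum_rep_of_mem_repD μ hf
  refine norm_sq_le_of_re_inner_le μ (by positivity) fun x hx => ?_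
  obtain ⟨M, hM⟩ := exists_of_mem_polyD μ hx
  have hc : ∀ n, coeff (WeightedSpace.toFun μ
      (cauchyCLM μ (∑ n ∈ Finset.range N, a n • DSpace.rep μ n))) n =
      if n < N then a n else 0 := fun n => by
    rw [toFun_cauchyCLM, cauchy_sum_rep, coeff_partialSum]
  have h := re_pairing_le μ x (cauchyCLM μ (∑ n ∈ Finset.range N, a n • DSpace.rep μ n))
    (N := max N M) (fun n hn => hM n (le_of_max_le_right hn)) fun n hn => by
      rw [hc, if_neg (by omega)]
  refine le_trans (le_of_eq ?_) h
  rw [inner_sum_rep]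
  congr 1
  rw [← Finset.sum_subset (Finset.range_mono (show N ≤ max N M + 1 by omega)) fun n _ hn => by
    rw [hc, if_neg (by simpa using hn), map_zero, zero_mul]]
  refine Finset.sum_congr rfl fun n hn => ?_
  rw [hc, if_pos (Finset.mem_range.mp hn)]

lemma cauchyCLM_mem_E (f : DSpace μ) : cauchyCLM μ f ∈ E μ := by
  have hmem : f ∈ closure (repD μ : Set (DSpace μ)) := by
    rw [← Submodule.topologicalClosure_coe, topologicalClosure_repD]
    trivial
  refine closure_minimal (t := cauchyCLM μ ⁻¹' (E μ : Set (WeightedSpace μ))) (fun f hf => ?_)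
    ((isClosed_E μ).preimage (cauchyCLM μ).continuous) hmem
  obtain ⟨a, N, rfl⟩ := exists_sum_rep_of_mem_repD μ hf
  refine mem_E_of_mem_polyE μ ?_
  change WeightedSpace.toFun μ _ ∈ polynomials
  rw [toFun_cauchyCLM, cauchy_sum_rep]
  exact partialSum_mem_polynomials _ _

/-- An operator bounded below on a complete space has closed range, and this range contains every
polynomial. -/
lemma exists_cauchyCLM_eq {y : WeightedSpace μ} (hy : y ∈ E μ) : ∃ f, cauchyCLM μ f = y := by
  have hm := mass_pos μ
  have hanti : AntilipschitzWith (Real.toNNReal (√(2 * (5 + 4 * mass μ)))) (cauchyCLM μ) := by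
    refine (cauchyCLM μ).antilipschitz_of_bound fun f => ?_
    rw [Real.coe_toNNReal _ (Real.sqrt_nonneg _)]
    refine le_of_sq_le_sq ((norm_sq_le_norm_cauchyCLM_sq μ f).trans (le_of_eq ?_)) (by positivity)
    rw [mul_pow, Real.sq_sqrt (by positivity)]
  have hcl := hanti.isClosed_range (cauchyCLM μ).uniformContinuous
  refine closure_minimal (t := Set.range (cauchyCLM μ)) (fun p hp => ?_) hcl
    (show y ∈ closure (polyE μ : Set (WeightedSpace μ)) from hy)
  obtain ⟨a, N, h⟩ := exists_partialSum_of_mem_polynomials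
    (show WeightedSpace.toFun μ p ∈ polynomials from hp)
  refine ⟨∑ n ∈ Finset.range N, a n • DSpace.rep μ n, WeightedSpace.toFun_injective μ ?_⟩
  rw [toFun_cauchyCLM, cauchy_sum_rep, h]

end CauchyMap

/-! ### The Cauchy duality of `D(μ)` and `E(μ)` -/

lemma circleAverage_pow_mul_conj_pow_of_le {n m : ℕ} (h : m ≤ n) :
    Real.circleAverage (fun z : ℂ => z ^ n * conj (z ^ m)) 0 1 = if n = m then 1 else 0 := by
  have h1 : Real.circleAverage (fun z : ℂ => z ^ n * conj (z ^ m)) 0 1 =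
      Real.circleAverage (fun z : ℂ => z ^ (n - m)) 0 1 := by
    refine Real.circleAverage_congr_sphere fun z hz => ?_
    have hz1 : ‖z‖ = 1 := by simpa using hz
    have h2 : z ^ m * conj (z ^ m) = 1 := by
      rw [Complex.mul_conj', norm_pow, hz1]
      simp
    change z ^ n * conj (z ^ m) = z ^ (n - m)
    rw [← Nat.sub_add_cancel h, pow_add, mul_assoc, h2, mul_one, Nat.add_sub_cancel]
  have hd : DiffContOnCl ℂ (fun z : ℂ => z ^ (n - m)) (ball 0 |1|) :=
    (differentiable_pow (n - m)).diffContOnCl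
  rw [h1, hd.circleAverage, zero_pow_eq]
  congr 1
  rw [eq_iff_iff]
  omega

lemma circleIntegrable_pow_mul_conj_pow (n m : ℕ) :
    CircleIntegrable (fun z : ℂ => z ^ n * conj (z ^ m)) 0 1 := by
  refine ContinuousOn.circleIntegrable zero_le_one (Continuous.continuousOn ?_)
  exact (continuous_pow n).mul (Complex.continuous_conj.comp (continuous_pow m))

lemma circleAverage_pow_mul_conj_pow (n m : ℕ) :
    Real.circleAverage (fun z : ℂ => z ^ n * conj (z ^ m)) 0 1 = if n = m then 1 else 0 := by
  rcases le_total m n with h | h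
  · exact circleAverage_pow_mul_conj_pow_of_le h
  -- The case `n ≤ m` is the complex conjugate of the other one.
  · have h1 := (Complex.conjCLE : ℂ →L[ℝ] ℂ).circleAverage_comp_comm
      (circleIntegrable_pow_mul_conj_pow m n)
    rw [circleAverage_pow_mul_conj_pow_of_le h] at h1
    have h2 : (fun z : ℂ => z ^ n * conj (z ^ m)) =
        ((Complex.conjCLE : ℂ →L[ℝ] ℂ) ∘ fun z : ℂ => z ^ m * conj (z ^ n)) := by
      funext z
      simp [mul_comm]
    rw [h2, h1]
    simp [apply_ite, eq_comm]

lemma circleAverage_polynomial (p q : Polynomial ℂ) :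
    Real.circleAverage (fun z => p.eval z * conj (q.eval z)) 0 1 =
      ∑ n ∈ Finset.range (p.natDegree + 1), p.coeff n * conj (q.coeff n) := by
  have h1 : (fun z : ℂ => p.eval z * conj (q.eval z)) = fun z =>
      ∑ n ∈ Finset.range (p.natDegree + 1), ∑ m ∈ Finset.range (q.natDegree + 1),
        (p.coeff n * conj (q.coeff m)) • (z ^ n * conj (z ^ m)) := by
    funext z
    rw [Polynomial.eval_eq_sum_range, Polynomial.eval_eq_sum_range, map_sum, Finset.sum_mul_sum]
    refine Finset.sum_congr rfl fun n _ => Finset.sum_congr rfl fun m _ => ?_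
    rw [map_mul, smul_eq_mul]
    ring
  have hi : ∀ n m, CircleIntegrable
      (fun z : ℂ => (p.coeff n * conj (q.coeff m)) • (z ^ n * conj (z ^ m))) 0 1 := fun n m => by
    have hc : Continuous fun z : ℂ => z ^ n * conj (z ^ m) :=
      (continuous_pow n).mul (Complex.continuous_conj.comp (continuous_pow m))
    exact ContinuousOn.circleIntegrable zero_le_one
      (hc.const_smul (p.coeff n * conj (q.coeff m))).continuousOn
  rw [h1, Real.circleAverage_fun_sum fun n _ =>
    CircleIntegrable.fun_sum _ fun m _ => hi n m]
  refine Finset.sum_congr rfl fun n _ => ?_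
  rw [Real.circleAverage_fun_sum fun m _ => hi n m]
  simp only [Real.circleAverage_fun_smul, circleAverage_pow_mul_conj_pow]
  by_cases hn : n ∈ Finset.range (q.natDegree + 1)
  · rw [Finset.sum_eq_single_of_mem n hn fun m _ hm => by simp [Ne.symm hm]]
    simp
  · have hq : q.coeff n = 0 := Polynomial.coeff_eq_zero_of_natDegree_lt (by simpa using hn)
    rw [hq, map_zero, mul_zero]
    refine Finset.sum_eq_zero fun m hm => ?_
    have hnm : n ≠ m := fun h => hn (h ▸ hm)
    rw [if_neg hnm, smul_zero]

lemma coeff_eval (q : Polynomial ℂ) (n : ℕ) :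
    coeff (fun z : Disc => q.eval (z : ℂ)) n = q.coeff n := by
  have h : (fun z : Disc => q.eval (z : ℂ)) = partialSum q.coeff (q.natDegree + 1) := by
    funext z
    rw [Polynomial.eval_eq_sum_range]
    rfl
  rw [h, coeff_partialSum]
  dsimp only
  split_ifs with hn
  · rfl
  · exact (Polynomial.coeff_eq_zero_of_natDegree_lt (by omega)).symm

section Duality

variable (μ : Measure ClosedDisc) [IsFiniteMeasure μ]

lemma exists_dSpace_of_mem {f : Disc → ℂ} (hf : f ∈ dirichletSpace μ) :
    ∃ x : DSpace μ, DSpace.toFun μ x = f := ⟨⟨f, hf⟩, rfl⟩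

lemma DSpace.toFun_sum_mono (p : Polynomial ℂ) :
    DSpace.toFun μ (∑ n ∈ Finset.range (p.natDegree + 1), p.coeff n • DSpace.mono μ n) =
      fun z : Disc => p.eval (z : ℂ) := by
  funext z
  rw [map_sum, Finset.sum_apply, Polynomial.eval_eq_sum_range]
  refine Finset.sum_congr rfl fun n _ => ?_
  rw [map_smul, DSpace.toFun_mono]
  rfl

variable [NeZero μ]

/-- The functions `1 / (1 - conj l z)`, as elements of `D(μ)`. -/
lemma DSpace.exists_szego (l : Disc) : ∃ s : DSpace μ, DSpace.toFun μ s = szego l ∧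
    HasSum (fun n => conj (l : ℂ) ^ n • DSpace.mono μ n) s := by
  have hs : Summable fun n : ℕ => ‖conj (l : ℂ) ^ n‖ * ((n : ℝ) + 1) := by
    have hl : ‖‖(l : ℂ)‖‖ < 1 := by simpa using l.norm_lt_one
    have h1 := summable_pow_mul_geometric_of_norm_lt_one (R := ℝ) 1 hl
    have h2 := summable_geometric_of_lt_one (norm_nonneg _) l.norm_lt_one
    refine (h1.add h2).congr fun n => ?_
    rw [norm_pow, RCLike.norm_conj]
    ring
  obtain ⟨s, hs, hc⟩ := DSpace.exists_hasSum μ hs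
  refine ⟨s, ?_, hs⟩
  change DSpace.toFun μ s = cauchyKer l
  refine eq_of_coeff_eq (DSpace.mem_hol μ s) (cauchyKer_mem_hol l.norm_lt_one.le) ?_
  rw [coeff_cauchyKer l.norm_lt_one.le]
  exact funext hc

lemma szego_mem_dirichletSpace (l : Disc) : szego l ∈ dirichletSpace μ := by
  obtain ⟨s, hs, -⟩ := DSpace.exists_szego μ l
  rw [← hs]
  exact s.2

/-- The expansion of `1 / (1 - conj l z)` in monomials converges in `D(μ)`, so the inner product
with it may be taken term by term. -/
lemma cauchyMap_toFun (x : DSpace μ) : cauchyMap μ (DSpace.toFun μ x) = DSpace.cauchy μ x := by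
  funext l
  obtain ⟨s, hs, hsum⟩ := DSpace.exists_szego μ l
  rw [cauchyMap, ← hs, ← DSpace.inner_eq]
  refine HasSum.unique (f := fun n => (inner ℂ (DSpace.mono μ n) x : ℂ) * (l : ℂ) ^ n) ?_
    (DSpace.hasSum_cauchy μ x l)
  have h1 := (innerSL ℂ x).hasSum hsum
  have h2 := h1.map (starRingEnd ℂ) Complex.continuous_conj
  simp only [innerSL_apply_apply, inner_conj_symm] at h2
  refine h2.congr_fun fun n => ?_
  simp only [Function.comp_apply, inner_conj_symm, inner_smul_left, map_pow, Complex.conj_conj]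
  ring

lemma cauchyCLM_injective : Function.Injective (cauchyCLM μ) := by
  refine (injective_iff_map_eq_zero _).mpr fun x hx => ?_
  have h := norm_sq_le_norm_cauchyCLM_sq μ x
  rw [hx, norm_zero] at h
  have h1 : ‖x‖ ^ 2 = 0 := le_antisymm (by simpa using h) (sq_nonneg _)
  simpa using h1

lemma injOn_cauchyMap : Set.InjOn (cauchyMap μ) (dirichletSpace μ) := by
  intro f hf g hg h
  obtain ⟨x, rfl⟩ := exists_dSpace_of_mem μ hf
  obtain ⟨y, rfl⟩ := exists_dSpace_of_mem μ hg
  rw [cauchyMap_toFun, cauchyMap_toFun, ← toFun_cauchyCLM, ← toFun_cauchyCLM] at h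
  rw [cauchyCLM_injective μ (WeightedSpace.toFun_injective μ h)]

lemma image_cauchyMap : cauchyMap μ '' dirichletSpace μ = carrierE μ := by
  refine Set.Subset.antisymm ?_ ?_
  · rintro _ ⟨f, hf, rfl⟩
    obtain ⟨x, rfl⟩ := exists_dSpace_of_mem μ hf
    exact ⟨cauchyCLM μ x, cauchyCLM_mem_E μ x, by rw [toFun_cauchyCLM, cauchyMap_toFun]⟩
  · rintro _ ⟨y, hy, rfl⟩
    obtain ⟨x, rfl⟩ := exists_cauchyCLM_eq μ hy
    exact ⟨DSpace.toFun μ x, x.2, by rw [toFun_cauchyCLM, cauchyMap_toFun]⟩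

lemma dirichletInner_polynomial {f : Disc → ℂ} (hf : f ∈ dirichletSpace μ) (p q : Polynomial ℂ)
    (h : cauchyMap μ f = fun z : Disc => q.eval (z : ℂ)) :
    dirichletInner μ (fun z : Disc => p.eval (z : ℂ)) f =
      Real.circleAverage (fun z => p.eval z * conj (q.eval z)) 0 1 := by
  obtain ⟨x, rfl⟩ := exists_dSpace_of_mem μ hf
  rw [← DSpace.toFun_sum_mono μ, ← DSpace.inner_eq, inner_sum, circleAverage_polynomial]
  refine Finset.sum_congr rfl fun n _ => ?_
  rw [inner_smul_right, ← inner_conj_symm, ← DSpace.coeff_cauchy, ← cauchyMap_toFun, h, coeff_eval]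

lemma norm_equivalence {f : Disc → ℂ} (hf : f ∈ dirichletSpace μ) {φ : E μ}
    (h : WeightedSpace.toFun μ φ = cauchyMap μ f) :
    ENNReal.ofReal (1 / (2 * (5 + 4 * mass μ))) * dirichletNormSq μ f ≤
        ENNReal.ofReal (‖φ‖ ^ 2) ∧
      ENNReal.ofReal (‖φ‖ ^ 2) ≤ ENNReal.ofReal (20 + 8 / mass μ) * dirichletNormSq μ f := by
  have hm := mass_pos μ
  obtain ⟨x, rfl⟩ := exists_dSpace_of_mem μ hf
  rw [cauchyMap_toFun, ← toFun_cauchyCLM] at h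
  have h1 : ‖φ‖ = ‖cauchyCLM μ x‖ := by
    rw [← WeightedSpace.toFun_injective μ h]
    rfl
  rw [h1, DSpace.normSq_eq, ← ENNReal.ofReal_mul (by positivity),
    ← ENNReal.ofReal_mul (by positivity)]
  refine ⟨ENNReal.ofReal_le_ofReal ?_, ENNReal.ofReal_le_ofReal (norm_cauchyCLM_sq_le μ x)⟩
  rw [one_div, inv_mul_le_iff₀ (by positivity)]
  exact norm_sq_le_norm_cauchyCLM_sq μ x

end Duality

/-! ### Toeplitz operators with conjugate analytic symbol -/

/-- The action of the adjoint of multiplication by `∑ φ k z ^ k` on Taylor coefficients `a n` that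
vanish for `N ≤ n`. -/
noncomputable def toepSeq (N : ℕ) (φ a : ℕ → ℂ) (n : ℕ) : ℂ :=
  ∑ k ∈ Finset.range N, conj (φ k) * a (n + k)

lemma toepSeq_eq_zero {N : ℕ} (φ : ℕ → ℂ) {a : ℕ → ℂ} (ha : ∀ n, N ≤ n → a n = 0) {n : ℕ}
    (hn : N ≤ n) : toepSeq N φ a n = 0 :=
  Finset.sum_eq_zero fun k _ => by rw [ha _ (by omega), mul_zero]

/-- Both operations are combinations of powers of the backward shift, hence they commute. -/
lemma quotSeq_toepSeq (N : ℕ) (φ a : ℕ → ℂ) (w : ℂ) (j : ℕ) :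
    quotSeq N (toepSeq N φ a) w j = toepSeq N φ (quotSeq N a w) j := by
  simp only [quotSeq, toepSeq, Finset.mul_sum]
  rw [Finset.sum_comm]
  refine Finset.sum_congr rfl fun k _ => Finset.sum_congr rfl fun i _ => ?_
  rw [show j + 1 + i + k = j + k + 1 + i by ring]
  ring

/-- The adjoint relation `⟨T a, b⟩ = ⟨a, φ b⟩`; truncation at `N` loses nothing since `a` vanishes
from there on. -/
lemma sum_mul_toepSeq {N : ℕ} (φ : ℕ → ℂ) {a : ℕ → ℂ} (ha : ∀ n, N ≤ n → a n = 0) (b : ℕ → ℂ) :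
    ∑ n ∈ Finset.range N, conj (b n) * toepSeq N φ a n =
      ∑ m ∈ Finset.range N, conj (∑ kl ∈ Finset.HasAntidiagonal.antidiagonal m,
        φ kl.1 * b kl.2) * a m := by
  set s := ((Finset.range N) ×ˢ (Finset.range N)).filter fun kl => kl.1 + kl.2 < N with hs
  have h1 : ∑ n ∈ Finset.range N, conj (b n) * toepSeq N φ a n =
      ∑ kl ∈ s, conj (φ kl.1 * b kl.2) * a (kl.1 + kl.2) := by
    rw [hs, Finset.sum_filter_of_ne, Finset.sum_product_right]
    · refine Finset.sum_congr rfl fun n _ => ?_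
      rw [toepSeq, Finset.mul_sum]
      refine Finset.sum_congr rfl fun k _ => ?_
      rw [map_mul, add_comm n k]
      ring
    · intro kl _ h
      by_contra h2
      exact h (by rw [ha _ (not_lt.mp h2), mul_zero])
  have hmaps : ∀ kl ∈ s, kl.1 + kl.2 ∈ Finset.range N := fun kl hkl => by
    rw [hs, Finset.mem_filter] at hkl
    exact Finset.mem_range.mpr hkl.2
  rw [h1, ← Finset.sum_fiberwise_of_maps_to hmaps]
  refine Finset.sum_congr rfl fun m hm => ?_
  rw [map_sum, Finset.sum_mul]
  have h2 : s.filter (fun kl => kl.1 + kl.2 = m) = Finset.HasAntidiagonal.antidiagonal m := by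
    ext kl
    have := Finset.mem_range.mp hm
    simp only [hs, Finset.mem_filter, Finset.mem_product, Finset.mem_range,
      Finset.HasAntidiagonal.mem_antidiagonal]
    omega
  rw [h2]
  refine Finset.sum_congr rfl fun kl hkl => ?_
  rw [Finset.HasAntidiagonal.mem_antidiagonal.mp hkl]

/-- Multiplication on `H²`, compared pointwise on circles of radius `r < 1` before letting `r → 1`.
-/
lemma sqsum_coeff_mul_le {φ f : Disc → ℂ} (hφ : φ ∈ Hol) (hf : f ∈ Hol) {M : ℝ}
    (hM : ∀ z, ‖φ z‖ ≤ M) :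
    sqsum (coeff (φ * f)) ≤ ENNReal.ofReal (M ^ 2) * sqsum (coeff f) := by
  have hM0 : 0 ≤ M := (norm_nonneg _).trans (hM origin)
  refine sqsum_le_of_forall_lt fun r hr0 hr1 => ?_
  have h1 := lintegral_angle (mul_mem_hol hφ hf) hr0 hr1
  have h2 := lintegral_angle hf hr0 hr1
  have h3 : ∫⁻ θ in Set.Ioo (-Real.pi) Real.pi, ‖ext (φ * f) (circleMap 0 r θ)‖ₑ ^ 2 ≤
      ENNReal.ofReal (M ^ 2) *
        ∫⁻ θ in Set.Ioo (-Real.pi) Real.pi, ‖ext f (circleMap 0 r θ)‖ₑ ^ 2 := by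
    rw [← lintegral_const_mul' _ _ ENNReal.ofReal_ne_top]
    refine lintegral_mono fun θ => ?_
    have hz : circleMap 0 r θ ∈ ball (0 : ℂ) 1 := by
      rw [mem_ball_zero_iff, norm_circleMap_zero, abs_of_nonneg hr0]
      exact hr1
    set z : Disc := ⟨circleMap 0 r θ, hz⟩ with hzd
    have e1 : ext (φ * f) (circleMap 0 r θ) = φ z * f z := ext_coe (φ * f) z
    have e2 : ext f (circleMap 0 r θ) = f z := ext_coe f z
    rw [e1, e2, enorm_mul, mul_pow]
    refine mul_le_mul_left ?_ _
    rw [enorm_sq_eq_ofReal]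
    exact ENNReal.ofReal_le_ofReal (pow_le_pow_left₀ (norm_nonneg _) (hM z) 2)
  rw [h1, h2, mul_left_comm] at h3
  have hp0 : ENNReal.ofReal (2 * Real.pi) ≠ 0 := by
    simpa using Real.pi_pos
  rw [ENNReal.mul_le_mul_iff_right hp0 ENNReal.ofReal_ne_top] at h3
  refine h3.trans (mul_le_mul_right (ENNReal.tsum_le_tsum fun n => ?_) _)
  refine mul_le_of_le_one_right' (ENNReal.ofReal_le_one.mpr (pow_le_one₀ hr0 hr1.le))

/-- An adjoint has the same bound: with `b = T a`, `‖b‖² = ⟨a, φ b⟩ ≤ ‖a‖ M ‖b‖`. Working with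
squares and sums up to `N` keeps everything finite. -/
lemma sqsum_toepSeq_le {φ : Disc → ℂ} (hφ : φ ∈ Hol) {M : ℝ} (hM : ∀ z, ‖φ z‖ ≤ M) {N : ℕ}
    {a : ℕ → ℂ} (ha : ∀ n, N ≤ n → a n = 0) :
    sqsum (toepSeq N (coeff φ) a) ≤ ENNReal.ofReal (M ^ 2) * sqsum a := by
  set b := toepSeq N (coeff φ) a with hb
  have hb0 : ∀ n, N ≤ n → b n = 0 := fun n hn => toepSeq_eq_zero (coeff φ) ha hn
  set g := partialSum b N with hg
  have hgh : g ∈ Hol := partialSum_mem_hol _ _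
  have hgc : coeff g = b := by
    rw [hg, coeff_partialSum]
    funext n
    split_ifs with h
    · rfl
    · exact (hb0 n (not_lt.mp h)).symm
  set c := coeff (φ * g) with hc
  have hcle := sqsum_coeff_mul_le hφ hgh hM
  rw [hgc, sqsum_of_eq_zero hb0, ← ENNReal.ofReal_mul (sq_nonneg _)] at hcle
  have hcN : ∑ n ∈ Finset.range N, ‖c n‖ ^ 2 ≤ M ^ 2 * ∑ n ∈ Finset.range N, ‖b n‖ ^ 2 := by
    have h1 : ∑ n ∈ Finset.range N, ‖c n‖ₑ ^ 2 ≤ sqsum c := ENNReal.sum_le_tsum _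
    have h2 := h1.trans hcle
    rw [Finset.sum_congr rfl fun n _ => enorm_sq_eq_ofReal (c n),
      ← ENNReal.ofReal_sum_of_nonneg fun n _ => sq_nonneg _,
      ENNReal.ofReal_le_ofReal_iff (mul_nonneg (sq_nonneg _)
        (Finset.sum_nonneg fun n _ => sq_nonneg _))] at h2
    exact h2
  have hid := sum_mul_toepSeq (coeff φ) ha b
  have hcm : ∀ m, ∑ kl ∈ Finset.HasAntidiagonal.antidiagonal m, coeff φ kl.1 * b kl.2 = c m :=
    fun m => by rw [hc, coeff_mul hφ hgh, hgc]
  simp only [hcm, ← hb] at hid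
  set A := ∑ n ∈ Finset.range N, ‖a n‖ ^ 2 with hA
  set S := ∑ n ∈ Finset.range N, ‖b n‖ ^ 2 with hS
  have hS0 : 0 ≤ S := Finset.sum_nonneg fun n _ => sq_nonneg _
  have hA0 : 0 ≤ A := Finset.sum_nonneg fun n _ => sq_nonneg _
  have h1 : S ≤ ∑ m ∈ Finset.range N, ‖c m‖ * ‖a m‖ := by
    have h2 : ((S : ℝ) : ℂ) = ∑ m ∈ Finset.range N, conj (c m) * a m := by
      rw [← hid, hS]
      push_cast
      exact Finset.sum_congr rfl fun n _ => (Complex.conj_mul' (b n)).symm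
    have h3 : S = ‖((S : ℝ) : ℂ)‖ := by
      rw [Complex.norm_real, Real.norm_eq_abs, abs_of_nonneg hS0]
    rw [h3, h2]
    refine (norm_sum_le _ _).trans (le_of_eq (Finset.sum_congr rfl fun m _ => ?_))
    rw [norm_mul, RCLike.norm_conj]
  have h2 : S ^ 2 ≤ (M ^ 2 * S) * A :=
    (pow_le_pow_left₀ hS0 h1 2).trans ((Finset.sum_mul_sq_le_sq_mul_sq _ _ _).trans
      (mul_le_mul_of_nonneg_right hcN hA0))
  have h3 : S ≤ M ^ 2 * A := by
    rcases hS0.eq_or_lt with h | h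
    · rw [← h]
      positivity
    · nlinarith
  rw [sqsum_of_eq_zero hb0, sqsum_of_eq_zero ha, ← ENNReal.ofReal_mul (sq_nonneg _)]
  exact ENNReal.ofReal_le_ofReal h3

lemma norm_le_opNorm_of_eigenfunctional {H : Type*} [NormedAddCommGroup H] [NormedSpace ℂ H]
    (T : H →L[ℂ] H) (e : H →L[ℂ] ℂ) {c : ℂ} (h : ∀ f, e (T f) = c * e f) {o : H} (ho : e o ≠ 0) :
    ‖c‖ ≤ ‖T‖ := by
  have he : 0 < ‖e‖ := by
    rw [norm_pos_iff]
    rintro rfl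
    exact ho rfl
  have h1 : ‖c • e‖ ≤ ‖e‖ * ‖T‖ := by
    have h2 : c • e = e.comp T := ContinuousLinearMap.ext fun f => (h f).symm
    rw [h2]
    exact ContinuousLinearMap.opNorm_comp_le _ _
  rw [norm_smul, mul_comm] at h1
  exact le_of_mul_le_mul_left h1 he

section Multipliers

variable (μ : Measure ClosedDisc) [IsFiniteMeasure μ] [NeZero μ]

lemma DSpace.eq_sum_mono {x : DSpace μ} {N : ℕ} (hx : ∀ n, N ≤ n → DSpace.coeffCLM μ n x = 0) :
    x = ∑ n ∈ Finset.range N, DSpace.coeffCLM μ n x • DSpace.mono μ n := by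
  refine DSpace.ext_coeff μ fun n => ?_
  simp only [map_sum, map_smul, DSpace.coeffCLM_mono, smul_eq_mul, mul_ite, mul_one, mul_zero,
    Finset.sum_ite_eq, Finset.mem_range]
  split_ifs with h
  · rfl
  · exact hx n (not_lt.mp h)

/-- The adjoint of multiplication by a bounded function acts boundedly on `D(μ)`. -/
lemma DSpace.exists_toeplitz {φ : Disc → ℂ} (hφ : φ ∈ Hol) {M : ℝ} (hM : ∀ z, ‖φ z‖ ≤ M)
    {x : DSpace μ} {N : ℕ} (hx : ∀ n, N ≤ n → DSpace.coeffCLM μ n x = 0) :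
    ∃ y : DSpace μ, (∀ n, DSpace.coeffCLM μ n y =
      toepSeq N (coeff φ) (fun n => DSpace.coeffCLM μ n x) n) ∧ ‖y‖ ^ 2 ≤ M ^ 2 * ‖x‖ ^ 2 := by
  set a : ℕ → ℂ := fun n => DSpace.coeffCLM μ n x with ha
  set b := toepSeq N (coeff φ) a with hb
  have hb0 : ∀ n, N ≤ n → b n = 0 := fun n hn => toepSeq_eq_zero (coeff φ) hx hn
  set y : DSpace μ := ∑ n ∈ Finset.range N, b n • DSpace.mono μ n with hy
  have hyc : ∀ n, DSpace.coeffCLM μ n y = b n := fun n => by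
    simp only [hy, map_sum, map_smul, DSpace.coeffCLM_mono, smul_eq_mul, mul_ite, mul_one, mul_zero,
      Finset.sum_ite_eq, Finset.mem_range]
    split_ifs with h
    · rfl
    · exact (hb0 n (not_lt.mp h)).symm
  refine ⟨y, hyc, ?_⟩
  have hyc' : coeff (DSpace.toFun μ y) = b := funext hyc
  have hxc' : coeff (DSpace.toFun μ x) = a := rfl
  have h1 : dirichletNormSq μ (DSpace.toFun μ y) ≤
      ENNReal.ofReal (M ^ 2) * dirichletNormSq μ (DSpace.toFun μ x) := by
    rw [dirichletNormSq_eq, dirichletNormSq_eq, mul_add,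
      energy_eq_lintegral_locDir μ (DSpace.mem_hol μ y),
      energy_eq_lintegral_locDir μ (DSpace.mem_hol μ x),
      ← lintegral_const_mul' _ _ ENNReal.ofReal_ne_top, hyc', hxc']
    refine add_le_add (sqsum_toepSeq_le hφ hM hx) (lintegral_mono fun w => ?_)
    rw [locDir_of_eq_zero w (DSpace.mem_hol μ y) (N := N) (by rw [hyc']; exact hb0),
      locDir_of_eq_zero w (DSpace.mem_hol μ x) (N := N) (by rw [hxc']; exact hx), hyc', hxc',
      ← sqsum_of_eq_zero fun n hn => quotSeq_eq_zero hb0 w hn,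
      ← sqsum_of_eq_zero fun n hn => quotSeq_eq_zero hx w hn]
    have h2 : quotSeq N b w = toepSeq N (coeff φ) (quotSeq N a w) :=
      funext fun j => quotSeq_toepSeq N (coeff φ) a w j
    rw [h2]
    exact sqsum_toepSeq_le hφ hM fun n hn => quotSeq_eq_zero hx w hn
  rwa [DSpace.normSq_eq, DSpace.normSq_eq, ← ENNReal.ofReal_mul (sq_nonneg _),
    ENNReal.ofReal_le_ofReal_iff (by positivity)] at h1

/-! ### Multipliers of `E(μ)` -/

lemma mul_mem_hardyTwo {φ f : Disc → ℂ} (hφ : φ ∈ Hol) {M : ℝ} (hM : ∀ z, ‖φ z‖ ≤ M)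
    (hf : f ∈ Hol) (hs : sqsum (coeff f) < ∞) : φ * f ∈ hardyTwo :=
  ⟨mul_mem_hol hφ hf, sqsum_lt_top_iff.mp (lt_of_le_of_lt (sqsum_coeff_mul_le hφ hf hM)
    (ENNReal.mul_lt_top ENNReal.ofReal_lt_top hs))⟩

/-- The product `φ p` lies in `H²`, hence equals `U f` for some `f`. Its pairing with a polynomial
`x` is the pairing of `p` with the coanalytic Toeplitz transform of `x`, whose `D(μ)` norm is at
most `M ‖x‖`; duality then bounds `f`. -/
lemma exists_mul_of_mem_polyE {φ : Disc → ℂ} (hφ : φ ∈ Hol) {M : ℝ} (hM0 : 0 < M)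
    (hM : ∀ z, ‖φ z‖ ≤ M) {p : WeightedSpace μ} (hp : p ∈ polyE μ) :
    ∃ y ∈ E μ, WeightedSpace.toFun μ y = φ * WeightedSpace.toFun μ p ∧
      ‖y‖ ^ 2 ≤ (20 + 8 / mass μ) * (2 * ((5 + 4 * mass μ) * M ^ 2) * ‖p‖ ^ 2) := by
  have hm := mass_pos μ
  obtain ⟨q, L, hq⟩ := exists_partialSum_of_mem_polynomials
    (show WeightedSpace.toFun μ p ∈ polynomials from hp)
  have hqc : ∀ n, L ≤ n → coeff (WeightedSpace.toFun μ p) n = 0 := fun n hn => by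
    rw [hq, coeff_partialSum]
    exact if_neg (not_lt.mpr hn)
  have hph := WeightedSpace.toFun_mem_hol μ p
  have hs : sqsum (coeff (WeightedSpace.toFun μ p)) < ∞ := by
    rw [sqsum_of_eq_zero hqc]
    exact ENNReal.ofReal_lt_top
  obtain ⟨y, hyE, hy⟩ := hardyTwo_subset_carrierE μ (mul_mem_hardyTwo hφ hM hph hs)
  refine ⟨y, hyE, hy, ?_⟩
  obtain ⟨f, rfl⟩ := exists_cauchyCLM_eq μ hyE
  rw [toFun_cauchyCLM] at hy
  refine (norm_cauchyCLM_sq_le μ f).trans (mul_le_mul_of_nonneg_left ?_ (by positivity))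
  refine norm_sq_le_of_re_inner_le μ (by positivity) fun x hx => ?_
  obtain ⟨K, hK⟩ := exists_of_mem_polyD μ hx
  set N := max K L with hN
  have hxN : ∀ n, N ≤ n → DSpace.coeffCLM μ n x = 0 := fun n hn => hK n (le_of_max_le_left hn)
  have hqN : ∀ n, N ≤ n → coeff (WeightedSpace.toFun μ p) n = 0 :=
    fun n hn => hqc n (le_of_max_le_right hn)
  obtain ⟨t, htc, htn⟩ := DSpace.exists_toeplitz μ hφ hM hxN
  have htN : ∀ n, N ≤ n → DSpace.coeffCLM μ n t = 0 := fun n hn => by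
    rw [htc]
    exact toepSeq_eq_zero (coeff φ) hxN hn
  have hpair := re_pairing_le μ t p htN hqN
  -- The term `n = N` is zero; it is included only to match the range in `re_pairing_le`.
  have e : (inner ℂ f x : ℂ) = ∑ n ∈ Finset.range (N + 1),
      conj (coeff (WeightedSpace.toFun μ p) n) * DSpace.coeffCLM μ n t := by
    rw [Finset.sum_range_succ, htN N le_rfl, mul_zero, add_zero]
    simp only [htc]
    rw [sum_mul_toepSeq (coeff φ) hxN]
    conv_lhs => rw [DSpace.eq_sum_mono μ hxN, inner_sum]
    refine Finset.sum_congr rfl fun n _ => ?_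
    rw [inner_smul_right, ← inner_conj_symm, ← DSpace.coeff_cauchy, hy, coeff_mul hφ hph, mul_comm]
  rw [e]
  refine hpair.trans (add_le_add ?_ le_rfl)
  rw [mul_assoc]
  exact mul_le_mul_of_nonneg_left htn (by positivity)

/-- The bound on polynomials applies to differences, so the products of `φ` with approximating
polynomials form a Cauchy sequence; evaluations identify its limit. -/
lemma mul_mem_carrierE {φ : Disc → ℂ} (hφ : φ ∈ Hol) {M : ℝ} (hM0 : 0 < M) (hM : ∀ z, ‖φ z‖ ≤ M)
    {f : Disc → ℂ} (hf : f ∈ carrierE μ) : φ * f ∈ carrierE μ := by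
  have hm := mass_pos μ
  obtain ⟨y, hy, rfl⟩ := hf
  obtain ⟨p, hp, hlim⟩ := mem_closure_iff_seq_limit.mp
    (show y ∈ closure (polyE μ : Set (WeightedSpace μ)) from hy)
  choose z hzE hz _ using fun k => exists_mul_of_mem_polyE μ hφ hM0 hM (hp k)
  set K := √((20 + 8 / mass μ) * (2 * ((5 + 4 * mass μ) * M ^ 2))) with hK
  have hK0 : 0 < K := Real.sqrt_pos.mpr (by positivity)
  have hd : ∀ k l, dist (z k) (z l) ≤ K * dist (p k) (p l) := by
    intro k l
    obtain ⟨v, -, hv, hvn⟩ := exists_mul_of_mem_polyE μ hφ hM0 hM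
      (Submodule.sub_mem _ (hp k) (hp l))
    have h1 : z k - z l = v := WeightedSpace.toFun_injective μ (by
      rw [map_sub, hz, hz, hv, map_sub, mul_sub])
    rw [dist_eq_norm, dist_eq_norm, h1]
    refine le_of_sq_le_sq (hvn.trans (le_of_eq ?_)) (by positivity)
    rw [mul_pow, hK, Real.sq_sqrt (by positivity), mul_assoc (20 + 8 / mass μ)]
  have hcau : CauchySeq z := by
    rw [Metric.cauchySeq_iff]
    intro ε hε
    obtain ⟨N, hN⟩ := Metric.cauchySeq_iff.mp hlim.cauchySeq (ε / K) (by positivity)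
    refine ⟨N, fun k hk l hl => (hd k l).trans_lt ?_⟩
    calc K * dist (p k) (p l) < K * (ε / K) := mul_lt_mul_of_pos_left (hN k hk l hl) hK0
      _ = ε := by field_simp
  obtain ⟨u, hu⟩ := cauchySeq_tendsto_of_complete hcau
  refine ⟨u, (isClosed_E μ).mem_of_tendsto hu (Eventually.of_forall hzE), funext fun s => ?_⟩
  have h1 := ((WeightedSpace.evalCLM μ s).continuous.tendsto _).comp hu
  have h2 := (((WeightedSpace.evalCLM μ s).continuous.tendsto _).comp hlim).const_mul (φ s)
  refine tendsto_nhds_unique h1 (h2.congr fun k => ?_)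
  simp only [Function.comp_apply, WeightedSpace.evalCLM_apply, hz, Pi.mul_apply]

lemma sqsum_coeff_monomial_zero_lt_top : sqsum (coeff (monomial 0)) < ∞ := by
  rw [sqsum_of_eq_zero (N := 1) fun n hn => by
    rw [coeff_monomial, Pi.single_eq_of_ne (by omega)]]
  exact ENNReal.ofReal_lt_top

lemma monomial_zero_eq_one : monomial 0 = 1 := funext fun _ => pow_zero _

lemma one_mem_carrierE : (1 : Disc → ℂ) ∈ carrierE μ := by
  rw [← monomial_zero_eq_one]
  exact hardyTwo_subset_carrierE μ
    ⟨monomial_mem_hol 0, sqsum_lt_top_iff.mp sqsum_coeff_monomial_zero_lt_top⟩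

lemma hardyInfty_subset_multipliers : hardyInfty ⊆ multipliers (carrierE μ) := by
  rintro φ ⟨hφ, C, hC⟩
  have hC0 : 0 ≤ C := (norm_nonneg _).trans (hC origin)
  have hM : ∀ z, ‖φ z‖ ≤ C + 1 := fun z => (hC z).trans (by linarith)
  have hmul : ∀ f ∈ carrierE μ, φ * f ∈ carrierE μ := fun f hf =>
    mul_mem_carrierE μ hφ (by positivity) hM hf
  refine ⟨?_, hmul⟩
  have h := hmul 1 (one_mem_carrierE μ)
  rwa [mul_one] at h

/-- Multiplication is continuous by the closed graph theorem, as evaluations are continuous and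
separate points. Evaluation at `z`, nonzero on the constant `1`, is an eigenvector of the adjoint
with eigenvalue `φ z`, so the operator norm bounds `φ`. -/
lemma multipliers_subset_hardyInfty : multipliers (carrierE μ) ⊆ hardyInfty := by
  rintro φ ⟨hφE, hφ⟩
  have hφh : φ ∈ Hol := by
    obtain ⟨y, -, rfl⟩ := hφE
    exact WeightedSpace.toFun_mem_hol μ y
  refine ⟨hφh, ?_⟩
  have hex : ∀ f : E μ, ∃ g : E μ, WeightedSpace.toFun μ g = φ * WeightedSpace.toFun μ f := by
    intro f
    obtain ⟨g, hg, h⟩ := hφ _ ⟨f, f.2, rfl⟩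
    exact ⟨⟨g, hg⟩, h⟩
  have hinj : ∀ f g : E μ, WeightedSpace.toFun μ f = WeightedSpace.toFun μ g → f = g :=
    fun f g h => Subtype.ext (WeightedSpace.toFun_injective μ h)
  choose S hS using hex
  let T : E μ →ₗ[ℂ] E μ :=
    { toFun := S
      map_add' := fun f g => hinj _ _ (by
        rw [hS, Submodule.coe_add, Submodule.coe_add, map_add, map_add, hS, hS, mul_add])
      map_smul' := fun c f => hinj _ _ (by
        rw [hS, RingHom.id_apply, Submodule.coe_smul, Submodule.coe_smul, map_smul, map_smul, hS,
          mul_smul_comm]) }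
  let e : Disc → E μ →L[ℂ] ℂ := fun z => (WeightedSpace.evalCLM μ z).comp (E μ).subtypeL
  have heT : ∀ z f, e z (T f) = φ z * e z f := fun z f => congrFun (hS f) z
  have hT : Continuous T := by
    refine T.continuous_of_seq_closed_graph fun u x y hu hv => hinj _ _ (funext fun z => ?_)
    have h1 := ((e z).continuous.tendsto _).comp hv
    have h2 := (((e z).continuous.tendsto _).comp hu).const_mul (φ z)
    have h3 : e z y = φ z * e z x :=
      tendsto_nhds_unique h1 (h2.congr fun k => (heT z (u k)).symm)
    exact h3.trans (heT z x).symm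
  let T' : E μ →L[ℂ] E μ := ⟨T, hT⟩
  obtain ⟨o, hoE, ho⟩ := one_mem_carrierE μ
  refine ⟨‖T'‖, fun z => ?_⟩
  exact norm_le_opNorm_of_eigenfunctional T' (e z) (heT z) (o := ⟨o, hoE⟩)
    ((congrFun ho z).trans_ne one_ne_zero)

end Multipliers

end DirichletType

open DirichletType in
theorem lemma2p2 (μ : MeasureTheory.Measure ClosedDisc) [MeasureTheory.IsFiniteMeasure μ]
    [NeZero μ] :
    (hardyTwo ⊆ carrierE μ ∧ carrierE μ ⊆ bergman) ∧
    (CompleteSpace (E μ) ∧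
      ∃ R : RKHS ℂ (E μ) Disc ℂ, ∀ (f : E μ) (z : Disc),
        R.coeCLM f z = WeightedSpace.toFun μ f z) ∧
    ((∀ l : Disc, szego l ∈ dirichletSpace μ) ∧
      Set.InjOn (cauchyMap μ) (dirichletSpace μ) ∧
      cauchyMap μ '' dirichletSpace μ = carrierE μ ∧
      (∀ f ∈ dirichletSpace μ, ∀ p q : Polynomial ℂ,
        cauchyMap μ f = (fun z : Disc => q.eval (z : ℂ)) →
          dirichletInner μ (fun z : Disc => p.eval (z : ℂ)) f =
            Real.circleAverage (fun z => p.eval z * (starRingEnd ℂ) (q.eval z)) 0 1) ∧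
      ∃ c C : ℝ, 0 < c ∧ 0 < C ∧
        ∀ f ∈ dirichletSpace μ, ∀ φ : E μ, WeightedSpace.toFun μ φ = cauchyMap μ f →
          ENNReal.ofReal c * dirichletNormSq μ f ≤ ENNReal.ofReal (‖φ‖ ^ 2) ∧
            ENNReal.ofReal (‖φ‖ ^ 2) ≤ ENNReal.ofReal C * dirichletNormSq μ f) ∧
    multipliers (carrierE μ) = hardyInfty := by
  have hm := mass_pos μ
  refine ⟨⟨hardyTwo_subset_carrierE μ, carrierE_subset_bergman μ⟩,
    ⟨inferInstance, rkhsE μ, fun f z => rfl⟩,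
    ⟨szego_mem_dirichletSpace μ, injOn_cauchyMap μ, image_cauchyMap μ,
      fun f hf p q h => dirichletInner_polynomial μ hf p q h,
      1 / (2 * (5 + 4 * mass μ)), 20 + 8 / mass μ, by positivity, by positivity,
      fun f hf φ h => norm_equivalence μ hf h⟩,
    Set.Subset.antisymm (multipliers_subset_hardyInfty μ) (hardyInfty_subset_multipliers μ)⟩
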